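/- Let $\zeta_9=e^{2\pi i/9}$, $\zeta_3=\zeta_9^3$, $E=\mathbb{Q}(\zeta_9)$, and let $$\Gamma=\{g\in U(3)\mid \text{all entries of } g \text{ lie in } \mathbb{Z}[\zeta_9,\tfrac13]\}.$$ Let $$H=\frac{1}{\sqrt{-3}}\begin{pmatrix}1&1&1\\1&\zeta_3&\overline{\zeta_3}\\1&\overline{\zeta_3}&\zeta_3\end{pmatrix},\qquad \mathcal{D}=\{\mathrm{diag}(\pm\zeta_9^{a},\pm\zeta_9^{b},\pm\zeta_9^{c})\mid a,b,c\in\mathbb{Z}/9\mathbb{Z}\},$$ with independent signs and $\sqrt{-3}=i\sqrt3$; these are the Clifford+D gates $\{H\}\cup\mathcal{D}\subseteq\Gamma$. Let $\mathcal{O}$ be the localization of $\mathbb{Z}[\zeta_9]$ at the prime ideal generated by $\pi=1-\zeta_9$. The vertices of the Bruhat–Tits building of $GL_3$ over $E$ with the $\pi$-adic valuation are the cosets $gE^\times GL_3(\mathcal{O})$, $g\in GL_3(E)$, and three vertices form a triangle if they can be represented, in some order, by $g_1,g_2,g_3$ with $\pi g_3\mathcal{O}^3\subsetneq g_1\mathcal{O}^3\subsetneq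 g_2\mathcal{O}^3\subsetneq g_3\mathcal{O}^3$. Let $\mathcal{T}$ be the tree fixed by the involution induced by $g\mapsto (g^*)^{-1}$: its vertices are the fixed vertices of the building and the midpoints of the edges whose endpoints are exchanged, and a fixed vertex is joined to the midpoint of an exchanged edge if the vertex and the edge span a triangle. Let $v_0$ be the coset of the identity, $\mathrm{dist}$ the graph distance in $\mathcal{T}$, and $C=\mathrm{Stab}_\Gamma(v_0)$. 1. The group generated by $\{H\}\cup\mathcal{D}$ is $\Gamma$. 2. There is an efficient (polynomial-time) algorithm for the word problem in $\Gamma$ with respect to $\{H\}\cup\mathcal{D}$, that is, for writing a given element of $\Gamma$ as a product of gates. In detail: every $\gamma\in\Gamma$ can be given by integers $k\ge0$ and $a_{ijm}$ with $\gamma_{ij}=3^{-k}\sum_{m=0}^{5}a_{ijm}\zeta_9^m$. Every set $R\subseteq\mathcal{D}$ of representatives of the cosets $\mathcal{D}/(\mathcal{D}\cap HCH^{-1})$ has exactly $108$ elements, and for each such $R$ there are a program for an integer register machine (finitely many registers; addition, subtraction, multiplication, division with remainder, sign tests, loops, and output of gates; costs counted in bit operations) and a polynomial $p$ such that for every $\gamma\in\Gamma$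 and all integers $k,a_{ijm}$ describing $\gamma$, of total bit length $n$, the program halts within $p(n)$ bit operations and outputs a word in $\{H\}\cup\mathcal{D}$ whose product is $\gamma$. Moreover, this word has the form $$u\cdot H^{-1}c_r^{-1}\,H^{-1}c_{r-1}^{-1}\cdots H^{-1}c_1^{-1}\qquad(H^{-1}=HHH),$$ where $u$ is a word in $\{H\}\cup\mathcal{D}$, $c_1,\dots,c_r\in R$, $\gamma c_1Hc_2H\cdots c_rH\in C$, and for all $1\le j\le r$ $$\mathrm{dist}(\gamma c_1H\cdots c_jHv_0,v_0)\le\mathrm{dist}(\gamma c_1H\cdots c_{j-1}Hv_0,v_0)-2 .$$ -/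

import Mathlib

noncomputable section

namespace CliffordD

open Matrix

/-! ## Arithmetic of the ninth cyclotomic field, inside the complex numbers -/

/-- The primitive ninth root of unity `ζ₉ = exp (2πi/9)`. -/
def ζ₉ : ℂ := Complex.exp (2 * Real.pi * Complex.I / 9)

theorem ζ₉_prim : IsPrimitiveRoot ζ₉ 9 := by
  have h := Complex.isPrimitiveRoot_exp 9 (by norm_num)
  simpa [ζ₉] using h

theorem ζ₉_ne_zero : ζ₉ ≠ 0 := Complex.exp_ne_zero _

theorem ζ₉_pow : ζ₉ ^ 9 = 1 := ζ₉_prim.pow_eq_one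

theorem ζ₉_rel : 1 + ζ₉ ^ 3 + ζ₉ ^ 6 = 0 := by
  have h3 : ζ₉ ^ 3 ≠ 1 := ζ₉_prim.pow_ne_one_of_pos_of_lt (by norm_num) (by norm_num)
  have h : (ζ₉ ^ 3 - 1) * (1 + ζ₉ ^ 3 + ζ₉ ^ 6) = 0 := by
    linear_combination ζ₉_pow
  exact (mul_eq_zero.mp h).resolve_left (sub_ne_zero.mpr h3)

theorem star_ζ₉ : star ζ₉ = ζ₉ ^ 8 := by
  have h1 : star ζ₉ * ζ₉ = 1 := by
    have h := Complex.normSq_eq_conj_mul_self (z := ζ₉)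
    rw [Complex.normSq_eq_norm_sq, ζ₉_prim.norm'_eq_one (by norm_num)] at h
    simpa using h.symm
  apply mul_right_cancel₀ ζ₉_ne_zero
  rw [h1]
  linear_combination - ζ₉_pow

/-- The square root `√-3 = i√3`. -/
def sqrtNegThree : ℂ := Complex.I * (Real.sqrt 3 : ℝ)

theorem sqrtNegThree_sq : sqrtNegThree ^ 2 = -3 := by
  have h : ((Real.sqrt 3 : ℝ) : ℂ) ^ 2 = 3 := by
    rw [← Complex.ofReal_pow, Real.sq_sqrt (by norm_num)]; norm_num
  rw [sqrtNegThree, mul_pow, h, Complex.I_sq]; ring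

theorem sqrtNegThree_ne_zero : sqrtNegThree ≠ 0 := by
  intro h
  have h2 := sqrtNegThree_sq
  rw [h] at h2
  norm_num at h2

theorem star_sqrtNegThree : star sqrtNegThree = -sqrtNegThree := by
  simp [sqrtNegThree]

theorem sqrtNegThree_inv : sqrtNegThree⁻¹ = -(sqrtNegThree * (1 / 3)) := by
  apply inv_eq_of_mul_eq_one_left
  linear_combination (-(1 / 3 : ℂ)) * sqrtNegThree_sq

/-- The ring of integers `ℤ[ζ₉]`. -/
def OE : Subring ℂ := Subring.closure {ζ₉}

/-- The ring `ℤ[ζ₉, 1/3]`. -/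
def OEinv3 : Subring ℂ := Subring.closure {ζ₉, 1 / 3}

/-- The cyclotomic field `E = ℚ(ζ₉)`. -/
def E : Subfield ℂ := Subfield.closure {ζ₉}

/-- The prime element `1 - ζ₉` of `ℤ[ζ₉]` above `3`. -/
def piE : ℂ := 1 - ζ₉

theorem ζ₉_mem_OE : ζ₉ ∈ OE := Subring.subset_closure rfl

theorem ζ₉_mem_OEinv3 : ζ₉ ∈ OEinv3 := Subring.subset_closure (by simp)

theorem third_mem_OEinv3 : (1 / 3 : ℂ) ∈ OEinv3 := Subring.subset_closure (by simp)

theorem ζ₉_mem_E : ζ₉ ∈ E := Subfield.subset_closure rfl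

theorem OEinv3_le_E : OEinv3 ≤ E.toSubring := by
  refine Subring.closure_le.mpr ?_
  rintro x (rfl | rfl)
  · exact ζ₉_mem_E
  · exact E.div_mem E.one_mem (by exact_mod_cast natCast_mem E 3)

theorem OE_le_E : OE ≤ E.toSubring :=
  Subring.closure_le.mpr (by rintro x rfl; exact ζ₉_mem_E)

theorem star_mem_OE {x : ℂ} (hx : x ∈ OE) : star x ∈ OE := by
  have h : OE ≤ OE.comap (starRingEnd ℂ) := by
    refine Subring.closure_le.mpr ?_
    rintro x rfl
    change star ζ₉ ∈ OE
    rw [star_ζ₉]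
    exact OE.pow_mem ζ₉_mem_OE 8
  exact h hx

theorem star_mem_OEinv3 {x : ℂ} (hx : x ∈ OEinv3) : star x ∈ OEinv3 := by
  have h : OEinv3 ≤ OEinv3.comap (starRingEnd ℂ) := by
    refine Subring.closure_le.mpr ?_
    rintro x (rfl | rfl)
    · change star ζ₉ ∈ OEinv3
      rw [star_ζ₉]
      exact OEinv3.pow_mem ζ₉_mem_OEinv3 8
    · change star (1 / 3 : ℂ) ∈ OEinv3
      have h3 : star (1 / 3 : ℂ) = 1 / 3 := by simp
      rw [h3]
      exact third_mem_OEinv3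
  exact h hx

theorem star_mem_E {x : ℂ} (hx : x ∈ E) : star x ∈ E := by
  have h : E ≤ E.comap (starRingEnd ℂ) := by
    refine Subfield.closure_le.mpr ?_
    rintro x rfl
    change star ζ₉ ∈ E
    rw [star_ζ₉]
    exact E.pow_mem ζ₉_mem_E 8
  exact h hx

/-- `DvdPi b` says that `b` lies in the prime ideal of `ℤ[ζ₉]` generated by `1 - ζ₉`. -/
def DvdPi (b : ℂ) : Prop := ∃ c ∈ OE, b = piE * c

theorem DvdPi.add {a b : ℂ} (ha : DvdPi a) (hb : DvdPi b) : DvdPi (a + b) := by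
  obtain ⟨c, hc, rfl⟩ := ha
  obtain ⟨d, hd, rfl⟩ := hb
  exact ⟨c + d, OE.add_mem hc hd, by ring⟩

theorem DvdPi.mul {a b : ℂ} (ha : DvdPi a) (hb : b ∈ OE) : DvdPi (a * b) := by
  obtain ⟨c, hc, rfl⟩ := ha
  exact ⟨c * b, OE.mul_mem hc hb, by ring⟩

theorem dvdPi_three : DvdPi 3 := by
  have h := ζ₉_mem_OE
  refine ⟨2 + 2 * ζ₉ + 2 * ζ₉ ^ 2 + ζ₉ ^ 3 + ζ₉ ^ 4 + ζ₉ ^ 5, ?_, ?_⟩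
  · have h2 : (2 : ℂ) ∈ OE := by exact_mod_cast natCast_mem OE 2
    exact OE.add_mem (OE.add_mem (OE.add_mem (OE.add_mem (OE.add_mem h2 (OE.mul_mem h2 h))
      (OE.mul_mem h2 (OE.pow_mem h 2))) (OE.pow_mem h 3)) (OE.pow_mem h 4)) (OE.pow_mem h 5)
  · rw [piE]; linear_combination ζ₉_rel

theorem exists_int_sub {x : ℂ} (hx : x ∈ OE) : ∃ n : ℤ, DvdPi (x - n) := by
  induction hx using Subring.closure_induction with
  | mem x hx =>
    rw [Set.mem_singleton_iff] at hx
    exact ⟨1, -1, OE.neg_mem OE.one_mem, by rw [hx, piE]; push_cast; ring⟩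
  | zero => exact ⟨0, 0, OE.zero_mem, by simp⟩
  | one => exact ⟨1, 0, OE.zero_mem, by simp⟩
  | add x y _ _ hx hy =>
    obtain ⟨n, hn⟩ := hx
    obtain ⟨m, hm⟩ := hy
    refine ⟨n + m, ?_⟩
    have h := hn.add hm
    have e : x + y - ((n + m : ℤ) : ℂ) = x - n + (y - m) := by push_cast; ring
    rwa [e]
  | neg x _ hx =>
    obtain ⟨n, hn⟩ := hx
    refine ⟨-n, ?_⟩
    have h := hn.mul (OE.neg_mem OE.one_mem)
    have e : -x - ((-n : ℤ) : ℂ) = (x - n) * (-1) := by push_cast; ring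
    rwa [e]
  | mul x y _ hy' hx hy =>
    obtain ⟨n, hn⟩ := hx
    obtain ⟨m, hm⟩ := hy
    refine ⟨n * m, ?_⟩
    have h := (hn.mul hy').add (hm.mul (intCast_mem OE n))
    have e : x * y - ((n * m : ℤ) : ℂ) = (x - n) * y + (y - m) * n := by push_cast; ring
    rwa [e]

/-- Every element outside the ideal `(1 - ζ₉)` is invertible modulo it. -/
theorem exists_inv_mod {b : ℂ} (hb : b ∈ OE) (hb' : ¬ DvdPi b) :
    ∃ c ∈ OE, DvdPi (b * c - 1) := by
  obtain ⟨n, hn⟩ := exists_int_sub hb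
  have h3 : ∀ q : ℤ, DvdPi (3 * (q : ℂ)) := fun q => dvdPi_three.mul (intCast_mem OE q)
  have hdiv : n = 3 * (n / 3) + n % 3 := (Int.mul_ediv_add_emod n 3).symm
  have hcast : (n : ℂ) = 3 * ((n / 3 : ℤ) : ℂ) + ((n % 3 : ℤ) : ℂ) := by
    exact_mod_cast congrArg (Int.cast (R := ℂ)) hdiv
  have h012 : n % 3 = 0 ∨ n % 3 = 1 ∨ n % 3 = 2 := by omega
  rcases h012 with h | h | h
  · exfalso
    apply hb'
    have h' := hn.add (h3 (n / 3))
    rw [h] at hcast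
    have e : b = b - n + 3 * ((n / 3 : ℤ) : ℂ) := by rw [hcast]; push_cast; ring
    rwa [e]
  · refine ⟨1, OE.one_mem, ?_⟩
    have h' := hn.add (h3 (n / 3))
    rw [h] at hcast
    have e : b * 1 - 1 = b - n + 3 * ((n / 3 : ℤ) : ℂ) := by rw [hcast]; push_cast; ring
    rwa [e]
  · refine ⟨-1, OE.neg_mem OE.one_mem, ?_⟩
    have h' := (hn.add (h3 (n / 3 + 1))).mul (OE.neg_mem OE.one_mem)
    rw [h] at hcast
    have e : b * (-1) - 1 = (b - n + 3 * ((n / 3 + 1 : ℤ) : ℂ)) * (-1) := by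
      rw [hcast]; push_cast; ring
    rwa [e]

theorem not_dvdPi_mul {b c : ℂ} (hb : b ∈ OE) (hb' : ¬ DvdPi b) (hc : c ∈ OE)
    (hc' : ¬ DvdPi c) : ¬ DvdPi (b * c) := by
  intro h
  obtain ⟨d, hd, hbd⟩ := exists_inv_mod hb hb'
  apply hc'
  have h' := (h.mul hd).add (hbd.mul (OE.neg_mem hc))
  have e : c = b * c * d + (b * d - 1) * (-c) := by ring
  rwa [e]

theorem ne_zero_of_not_dvdPi {b : ℂ} (hb : ¬ DvdPi b) : b ≠ 0 := by
  rintro rfl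
  exact hb ⟨0, OE.zero_mem, by simp⟩

theorem star_dvdPi {b : ℂ} (hb : DvdPi b) : DvdPi (star b) := by
  obtain ⟨c, hc, rfl⟩ := hb
  refine ⟨-(ζ₉ ^ 8) * star c, OE.mul_mem (OE.neg_mem (OE.pow_mem ζ₉_mem_OE 8)) (star_mem_OE hc), ?_⟩
  rw [star_mul', piE, star_sub, star_one, star_ζ₉]
  linear_combination (-star c) * ζ₉_pow

theorem isIntegral_of_mem_OE {x : ℂ} (hx : x ∈ OE) : IsIntegral ℤ x := by
  have h : OE ≤ (integralClosure ℤ ℂ).toSubring := by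
    refine Subring.closure_le.mpr ?_
    rintro x rfl
    exact ζ₉_prim.isIntegral (by norm_num)
  exact h hx

theorem not_dvdPi_one : ¬ DvdPi 1 := by
  rintro ⟨c, hc, h⟩
  have hz := ζ₉_mem_OE
  have hv : -2 * ζ₉ + 5 * ζ₉ ^ 2 - 7 * ζ₉ ^ 3 + 5 * ζ₉ ^ 4 - 2 * ζ₉ ^ 5 ∈ OE := by
    have h2 : (2 : ℂ) ∈ OE := by exact_mod_cast natCast_mem OE 2
    have h5 : (5 : ℂ) ∈ OE := by exact_mod_cast natCast_mem OE 5
    have h7 : (7 : ℂ) ∈ OE := by exact_mod_cast natCast_mem OE 7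
    exact OE.sub_mem (OE.add_mem (OE.sub_mem (OE.add_mem (OE.mul_mem (OE.neg_mem h2) hz)
      (OE.mul_mem h5 (OE.pow_mem hz 2))) (OE.mul_mem h7 (OE.pow_mem hz 3)))
      (OE.mul_mem h5 (OE.pow_mem hz 4))) (OE.mul_mem h2 (OE.pow_mem hz 5))
  have hthird : ((1 / 3 : ℚ) : ℂ) ∈ OE := by
    have e : ((1 / 3 : ℚ) : ℂ) =
        (-2 * ζ₉ + 5 * ζ₉ ^ 2 - 7 * ζ₉ ^ 3 + 5 * ζ₉ ^ 4 - 2 * ζ₉ ^ 5) * c ^ 6 := by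
      have h6 : piE ^ 6 * c ^ 6 = 1 := by rw [← mul_pow, ← h, one_pow]
      have hp : piE ^ 6 =
          3 * (-2 * ζ₉ + 5 * ζ₉ ^ 2 - 7 * ζ₉ ^ 3 + 5 * ζ₉ ^ 4 - 2 * ζ₉ ^ 5) := by
        rw [piE]; linear_combination ζ₉_rel
      rw [hp] at h6
      push_cast
      linear_combination (-(1 / 3 : ℂ)) * h6
    rw [e]
    exact OE.mul_mem hv (OE.pow_mem hc 6)
  have hint : IsIntegral ℤ (1 / 3 : ℚ) := by
    have h1 := isIntegral_of_mem_OE hthird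
    exact (isIntegral_algHom_iff (Algebra.ofId ℚ ℂ |>.restrictScalars ℤ)
      (Algebra.ofId ℚ ℂ).injective).mp (by simpa [Algebra.ofId_apply] using h1)
  obtain ⟨n, hn⟩ := IsIntegrallyClosed.isIntegral_iff.mp hint
  have hn' : (n : ℚ) = 1 / 3 := by simpa using hn
  have h3 : (3 * n : ℤ) = 1 := by
    have : (3 * n : ℚ) = 1 := by rw [hn']; norm_num
    exact_mod_cast this
  omega

/-- The valuation ring of the `(1 - ζ₉)`-adic valuation of `E`: the localization of `ℤ[ζ₉]` at its
prime ideal `(1 - ζ₉)`.  (The Bruhat-Tits building of `GL₃` is the same for `E` with this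
valuation as for its completion, so no completion is needed.) -/
def Opi : Subring ℂ where
  carrier := {x | ∃ a ∈ OE, ∃ b ∈ OE, ¬ DvdPi b ∧ x = a / b}
  mul_mem' := by
    rintro _ _ ⟨a, ha, b, hb, hb', rfl⟩ ⟨c, hc, d, hd, hd', rfl⟩
    exact ⟨a * c, OE.mul_mem ha hc, b * d, OE.mul_mem hb hd, not_dvdPi_mul hb hb' hd hd',
      div_mul_div_comm _ _ _ _⟩
  one_mem' := ⟨1, OE.one_mem, 1, OE.one_mem, not_dvdPi_one, by simp⟩
  add_mem' := by
    rintro _ _ ⟨a, ha, b, hb, hb', rfl⟩ ⟨c, hc, d, hd, hd', rfl⟩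
    exact ⟨a * d + b * c, OE.add_mem (OE.mul_mem ha hd) (OE.mul_mem hb hc), b * d,
      OE.mul_mem hb hd, not_dvdPi_mul hb hb' hd hd',
      div_add_div _ _ (ne_zero_of_not_dvdPi hb') (ne_zero_of_not_dvdPi hd')⟩
  zero_mem' := ⟨0, OE.zero_mem, 1, OE.one_mem, not_dvdPi_one, by simp⟩
  neg_mem' := by
    rintro _ ⟨a, ha, b, hb, hb', rfl⟩
    exact ⟨-a, OE.neg_mem ha, b, hb, hb', (neg_div b a).symm⟩

theorem star_mem_Opi {x : ℂ} (hx : x ∈ Opi) : star x ∈ Opi := by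
  obtain ⟨a, ha, b, hb, hb', rfl⟩ := hx
  refine ⟨star a, star_mem_OE ha, star b, star_mem_OE hb, fun h => hb' ?_, ?_⟩
  · simpa using star_dvdPi h
  · simp [div_eq_mul_inv]

theorem Opi_le_E : Opi ≤ E.toSubring := by
  rintro _ ⟨a, ha, b, hb, -, rfl⟩
  exact E.div_mem (OE_le_E ha) (OE_le_E hb)

/-! ## The group `Γ` and the gates -/

/-- The unitary group `U(3)`. -/
abbrev U3 := Matrix.unitaryGroup (Fin 3) ℂ

/-- The group `Γ` of all unitary `3 × 3` matrices with entries in `ℤ[ζ₉, 1/3]`. -/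
def Γ : Subgroup U3 where
  carrier := {g | ∀ i j, (g : Matrix (Fin 3) (Fin 3) ℂ) i j ∈ OEinv3}
  mul_mem' := by
    intro g h hg hh i j
    rw [Submonoid.coe_mul, Matrix.mul_apply]
    exact OEinv3.sum_mem fun k _ => OEinv3.mul_mem (hg i k) (hh k j)
  one_mem' := by
    intro i j
    rw [Submonoid.coe_one, Matrix.one_apply]
    split_ifs
    · exact OEinv3.one_mem
    · exact OEinv3.zero_mem
  inv_mem' := by
    intro g hg i j
    exact star_mem_OEinv3 (hg j i)

/-- The matrix of the gate `H`, where `ζ₃ = ζ₉ ^ 3` and its conjugate is `ζ₉ ^ 6`. -/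
def Hmat : Matrix (Fin 3) (Fin 3) ℂ :=
  (1 / sqrtNegThree) • !![1, 1, 1; 1, ζ₉ ^ 3, ζ₉ ^ 6; 1, ζ₉ ^ 6, ζ₉ ^ 3]

theorem Hmat_mul_star : Hmat * star Hmat = 1 := by
  have hs : (1 / sqrtNegThree) * star (1 / sqrtNegThree) = 1 / 3 := by
    rw [one_div, star_inv₀, star_sqrtNegThree, ← mul_inv, mul_neg, ← sq, sqrtNegThree_sq]
    norm_num
  have h3 : star (ζ₉ ^ 3) = ζ₉ ^ 6 := by
    rw [star_pow, star_ζ₉]; linear_combination (ζ₉ ^ 15 + ζ₉ ^ 6) * ζ₉_pow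
  have h6 : star (ζ₉ ^ 6) = ζ₉ ^ 3 := by
    rw [← h3, star_star]
  rw [Hmat, star_smul, smul_mul_smul_comm, hs]
  ext i j
  rw [Matrix.smul_apply, smul_eq_mul, Matrix.mul_apply, Fin.sum_univ_three]
  simp only [Matrix.star_apply]
  fin_cases i <;> fin_cases j <;>
    simp [h3, h6, -star_pow] <;>
    first
      | linear_combination ζ₉_rel
      | linear_combination ζ₉_rel + ζ₉ ^ 3 * ζ₉_pow
      | linear_combination (2 / 3 : ℂ) * ζ₉_pow
      | norm_num

/-- The gate `H`. -/
def H : U3 := ⟨Hmat, Matrix.mem_unitaryGroup_iff.mpr Hmat_mul_star⟩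

theorem sqrtNegThree_eq : sqrtNegThree = ζ₉ ^ 3 - ζ₉ ^ 6 := by
  have h3 : ζ₉ ^ 3 = Complex.exp (((2 * Real.pi / 3 : ℝ) : ℂ) * Complex.I) := by
    rw [ζ₉, ← Complex.exp_nat_mul]; congr 1; push_cast; ring
  have hc : ζ₉ ^ 6 = -1 - ζ₉ ^ 3 := by linear_combination ζ₉_rel
  have hcos : Real.cos (2 * Real.pi / 3) = -(1 / 2) := by
    rw [show 2 * Real.pi / 3 = Real.pi - Real.pi / 3 by ring, Real.cos_pi_sub,
      Real.cos_pi_div_three]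
  have hsin : Real.sin (2 * Real.pi / 3) = Real.sqrt 3 / 2 := by
    rw [show 2 * Real.pi / 3 = Real.pi - Real.pi / 3 by ring, Real.sin_pi_sub,
      Real.sin_pi_div_three]
  rw [hc, h3, Complex.exp_mul_I, ← Complex.ofReal_cos, ← Complex.ofReal_sin, hcos, hsin,
    sqrtNegThree]
  push_cast
  ring

theorem H_mem : H ∈ Γ := by
  have hz := ζ₉_mem_OEinv3
  have hs : 1 / sqrtNegThree ∈ OEinv3 := by
    rw [one_div, sqrtNegThree_inv, sqrtNegThree_eq]
    exact OEinv3.neg_mem (OEinv3.mul_mem (OEinv3.sub_mem (OEinv3.pow_mem hz 3)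
      (OEinv3.pow_mem hz 6)) third_mem_OEinv3)
  intro i j
  change Hmat i j ∈ OEinv3
  rw [Hmat, Matrix.smul_apply, smul_eq_mul]
  refine OEinv3.mul_mem hs ?_
  fin_cases i <;> fin_cases j <;>
    first
      | exact OEinv3.one_mem
      | exact OEinv3.pow_mem hz 3
      | exact OEinv3.pow_mem hz 6

/-- The group `𝒟` of all diagonal matrices `diag(±ζ₉ ^ a, ±ζ₉ ^ b, ±ζ₉ ^ c)`. -/
def 𝒟 : Subgroup U3 where
  carrier := {g | ∃ (s : Fin 3 → ℤˣ) (a : Fin 3 → ℤ),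
    (g : Matrix (Fin 3) (Fin 3) ℂ) = Matrix.diagonal fun i => ((s i : ℤ) : ℂ) * ζ₉ ^ a i}
  mul_mem' := by
    rintro g h ⟨s, a, hg⟩ ⟨t, b, hh⟩
    refine ⟨s * t, a + b, ?_⟩
    rw [Submonoid.coe_mul, hg, hh, Matrix.diagonal_mul_diagonal]
    congr 1
    funext i
    rw [Pi.mul_apply, Pi.add_apply, zpow_add₀ ζ₉_ne_zero]
    push_cast
    ring
  one_mem' := ⟨1, 0, by simp⟩
  inv_mem' := by
    rintro g ⟨s, a, hg⟩
    refine ⟨s, -a, ?_⟩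
    have h1 : ((g⁻¹ : U3) : Matrix (Fin 3) (Fin 3) ℂ) = star (g : Matrix (Fin 3) (Fin 3) ℂ) := rfl
    rw [h1, hg, Matrix.star_eq_conjTranspose, Matrix.diagonal_conjTranspose]
    congr 1
    funext i
    have hz : star ζ₉ = ζ₉⁻¹ := by
      rw [star_ζ₉]
      exact eq_inv_of_mul_eq_one_left (by linear_combination ζ₉_pow)
    rw [Pi.star_apply, star_mul', star_zpow₀, hz, Pi.neg_apply, _root_.zpow_neg]
    rw [_root_.inv_zpow]
    congr 1
    simp

theorem 𝒟_le : 𝒟 ≤ Γ := by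
  rintro g ⟨s, a, hg⟩ i j
  rw [hg, Matrix.diagonal_apply]
  split_ifs
  · refine OEinv3.mul_mem (intCast_mem _ _) ?_
    have hinv : ζ₉⁻¹ ∈ OEinv3 := by
      rw [inv_eq_of_mul_eq_one_left (by linear_combination ζ₉_pow : ζ₉ ^ 8 * ζ₉ = 1)]
      exact OEinv3.pow_mem ζ₉_mem_OEinv3 8
    obtain ⟨n, h | h⟩ := (a i).eq_nat_or_neg
    · rw [h, zpow_natCast]; exact OEinv3.pow_mem ζ₉_mem_OEinv3 n
    · rw [h, _root_.zpow_neg, zpow_natCast, ← inv_pow]; exact OEinv3.pow_mem hinv n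
  · exact OEinv3.zero_mem

/-- The Clifford+D gate set `{H} ∪ 𝒟`. -/
def gates : Set U3 := {H} ∪ (𝒟 : Set U3)

/-- The gate `H` as an element of `Γ`. -/
def HΓ : Γ := ⟨H, H_mem⟩

/-! ## The Bruhat-Tits tree -/

/-- The group of invertible matrices such that they and their inverses have entries in `A`,
that is, `GL₃(A)`. -/
def GLsub (A : Subring ℂ) : Subgroup (GL (Fin 3) ℂ) where
  carrier := {g | (∀ i j, (g : Matrix (Fin 3) (Fin 3) ℂ) i j ∈ A) ∧
    ∀ i j, ((g⁻¹ : GL (Fin 3) ℂ) : Matrix (Fin 3) (Fin 3) ℂ) i j ∈ A}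
  mul_mem' := by
    rintro g h ⟨hg, hg'⟩ ⟨hh, hh'⟩
    constructor
    · intro i j
      rw [Units.val_mul, Matrix.mul_apply]
      exact A.sum_mem fun k _ => A.mul_mem (hg i k) (hh k j)
    · intro i j
      rw [_root_.mul_inv_rev, Units.val_mul, Matrix.mul_apply]
      exact A.sum_mem fun k _ => A.mul_mem (hh' i k) (hg' k j)
  one_mem' := by
    have h : ∀ i j, (1 : Matrix (Fin 3) (Fin 3) ℂ) i j ∈ A := by
      intro i j
      rw [Matrix.one_apply]
      split_ifs
      · exact A.one_mem
      · exact A.zero_mem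
    exact ⟨h, by rw [inv_one]; exact h⟩
  inv_mem' := by
    rintro g ⟨hg, hg'⟩
    exact ⟨hg', by rw [inv_inv]; exact hg⟩

theorem star_inv_mem_GLsub {A : Subring ℂ} (hA : ∀ x ∈ A, star x ∈ A) {g : GL (Fin 3) ℂ}
    (hg : g ∈ GLsub A) : (star g)⁻¹ ∈ GLsub A := by
  refine ⟨fun i j => ?_, fun i j => ?_⟩
  · rw [← star_inv]; exact hA _ (hg.2 j i)
  · rw [inv_inv]; exact hA _ (hg.1 j i)

/-- `GL₃(E)`. -/
abbrev GLE : Subgroup (GL (Fin 3) ℂ) := GLsub E.toSubring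

/-- The subgroup `E^× GL₃(𝒪)` of `GL₃(E)`, where `𝒪` is the valuation ring. -/
def Ktilde : Subgroup GLE where
  carrier := {g | ∃ c ∈ E, c ≠ 0 ∧ ∃ k ∈ GLsub Opi,
    ((g : GL (Fin 3) ℂ) : Matrix (Fin 3) (Fin 3) ℂ) = c • (k : Matrix (Fin 3) (Fin 3) ℂ)}
  mul_mem' := by
    rintro g h ⟨c, hc, hc0, k, hk, hg⟩ ⟨d, hd, hd0, l, hl, hh⟩
    refine ⟨c * d, E.mul_mem hc hd, mul_ne_zero hc0 hd0, k * l, mul_mem hk hl, ?_⟩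
    rw [Subgroup.coe_mul, Units.val_mul, Units.val_mul, hg, hh, smul_mul_smul_comm]
  one_mem' := ⟨1, E.one_mem, one_ne_zero, 1, one_mem _, by simp⟩
  inv_mem' := by
    rintro g ⟨c, hc, hc0, k, hk, hg⟩
    refine ⟨c⁻¹, E.inv_mem hc, inv_ne_zero hc0, k⁻¹, inv_mem hk, ?_⟩
    rw [Subgroup.coe_inv]
    refine Units.inv_eq_of_mul_eq_one_right ?_
    rw [hg, smul_mul_smul_comm, mul_inv_cancel₀ hc0, one_smul, Units.mul_inv]

/-- The vertices of the Bruhat-Tits building of `GL₃(E)`: the cosets `g E^× GL₃(𝒪)`. -/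
abbrev BVertex := GLE ⧸ Ktilde

/-- The lattice `g 𝒪³`. -/
def lattice (g : GLE) : Set (Fin 3 → ℂ) :=
  {v | ∃ x : Fin 3 → ℂ, (∀ i, x i ∈ Opi) ∧
    v = ((g : GL (Fin 3) ℂ) : Matrix (Fin 3) (Fin 3) ℂ) *ᵥ x}

/-- The vertices `x, y, z` are represented by lattices `L₁, L₂, L₃` with
`(1 - ζ₉) L₃ < L₁ < L₂ < L₃`. -/
def IsChain (x y z : BVertex) : Prop :=
  ∃ g₁ g₂ g₃ : GLE, (g₁ : BVertex) = x ∧ (g₂ : BVertex) = y ∧ (g₃ : BVertex) = z ∧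
    (fun v => piE • v) '' lattice g₃ ⊂ lattice g₁ ∧
    lattice g₁ ⊂ lattice g₂ ∧ lattice g₂ ⊂ lattice g₃

/-- Three vertices form a triangle of the building. -/
def IsTriangle (v : Fin 3 → BVertex) : Prop :=
  ∃ σ : Equiv.Perm (Fin 3), IsChain (v (σ 0)) (v (σ 1)) (v (σ 2))

/-- The map `g ↦ g^# = (g*)⁻¹` on `GL₃(E)`. -/
def sharpGL (g : GLE) : GLE :=
  ⟨(star (g : GL (Fin 3) ℂ))⁻¹, star_inv_mem_GLsub (fun _ hx => star_mem_E hx) g.2⟩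

theorem sharpGL_mul (g h : GLE) : sharpGL (g * h) = sharpGL g * sharpGL h := by
  ext1
  simp [sharpGL, star_mul]

theorem sharpGL_mem_Ktilde {g : GLE} (hg : g ∈ Ktilde) : sharpGL g ∈ Ktilde := by
  obtain ⟨c, hc, hc0, k, hk, h⟩ := hg
  refine ⟨(star c)⁻¹, E.inv_mem (star_mem_E hc), inv_ne_zero (star_ne_zero.mpr hc0), (star k)⁻¹,
    star_inv_mem_GLsub (fun _ hx => star_mem_Opi hx) hk, ?_⟩
  change (((star (g : GL (Fin 3) ℂ))⁻¹ : GL (Fin 3) ℂ) : Matrix (Fin 3) (Fin 3) ℂ) = _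
  refine Units.inv_eq_of_mul_eq_one_right ?_
  rw [Units.coe_star, h, star_smul, smul_mul_smul_comm,
    mul_inv_cancel₀ (star_ne_zero.mpr hc0), one_smul, ← Units.coe_star, Units.mul_inv]

/-- The involution `#` on the vertices of the building. -/
def sharp : BVertex → BVertex :=
  Quotient.map' sharpGL (by
    intro g h hgh
    rw [QuotientGroup.leftRel_apply] at hgh ⊢
    have h1 := sharpGL_mem_Ktilde hgh
    have e : (sharpGL g)⁻¹ * sharpGL h = sharpGL (g⁻¹ * h) := by
      rw [inv_mul_eq_iff_eq_mul, ← sharpGL_mul, mul_inv_cancel_left]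
    rwa [e])

/-- The vertices of the building fixed by `#`. -/
abbrev LVertex := {v : BVertex // sharp v = v}

/-- The edges of the building whose endpoints are exchanged by `#`, standing for their midpoints. -/
abbrev RVertex := {e : Sym2 BVertex // ∃ x z, e = s(x, sharp x) ∧ IsTriangle ![x, sharp x, z]}

/-- The vertices of the tree. -/
abbrev TVertex := LVertex ⊕ RVertex

/-- The Bruhat-Tits tree `𝒯`, the subset of the building fixed by `#`: a fixed vertex is joined to
the midpoint of a reflected edge if together they form a triangle of the building (the segment
between them being the fixed part of the triangle). -/
def tree : SimpleGraph TVertex :=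
  SimpleGraph.fromRel fun a b =>
    match a, b with
    | Sum.inl v, Sum.inr e => ∃ x, e.1 = s(x, sharp x) ∧ IsTriangle ![v.1, x, sharp x]
    | _, _ => False

/-- The inclusion of `Γ` in `GL₃(E)`. -/
def toGLE : Γ →* GLE :=
  (Unitary.toUnits.comp Γ.subtype).codRestrict GLE (fun g =>
    ⟨fun i j => OEinv3_le_E (g.2 i j), fun i j => OEinv3_le_E ((g⁻¹).2 i j)⟩)

theorem sharp_toGLE (g : Γ) : sharp (toGLE g : BVertex) = (toGLE g : BVertex) := by
  have h : sharpGL (toGLE g) = toGLE g := by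
    apply Subtype.ext
    change (star (Unitary.toUnits g.1))⁻¹ = Unitary.toUnits g.1
    rw [inv_eq_iff_eq_inv, ← map_inv]
    rfl
  change ((sharpGL (toGLE g) : GLE) : BVertex) = _
  rw [h]

/-- The vertex `g v₀` of the tree, for `g` in `Γ`; `v₀` is the coset of the identity. -/
def orbitVertex (g : Γ) : TVertex := Sum.inl ⟨(toGLE g : BVertex), sharp_toGLE g⟩

/-- The distance in the tree from `g v₀` to `v₀`. -/
def distV0 (g : Γ) : ℕ := tree.dist (orbitVertex g) (orbitVertex 1)

/-- The stabilizer `C` of `v₀` in `Γ`. -/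
def C : Subgroup Γ := (MulAction.stabilizer GLE ((1 : GLE) : BVertex)).comap toGLE

/-- The subgroup `𝒟 ∩ H C H⁻¹` of `𝒟`. -/
def stabD : Subgroup 𝒟 :=
  (C.map (MulAut.conj HΓ).toMonoidHom).comap (Subgroup.inclusion 𝒟_le)

/-! ## Descent words -/

/-- The element `g c₁ H c₂ H ⋯ c_r H`, for a list `[c₁, …, c_r]`. -/
def descend (g : Γ) (cs : List 𝒟) : Γ :=
  cs.foldl (fun h c => h * Subgroup.inclusion 𝒟_le c * HΓ) g

/-- Every step along `g v₀, g c₁ H v₀, g c₁ H c₂ H v₀, …` lowers the distance to `v₀` by at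
least `2`, and the last of these vertices is `v₀`. -/
def IsDescent (g : Γ) (cs : List 𝒟) : Prop :=
  (∀ j < cs.length, distV0 (descend g (cs.take (j + 1))) + 2 ≤ distV0 (descend g (cs.take j))) ∧
    descend g cs ∈ C

/-- The word `H⁻¹ c_r⁻¹ ⋯ H⁻¹ c₂⁻¹ H⁻¹ c₁⁻¹`, where `H⁻¹` is written as `H H H`. -/
def descentTail (cs : List 𝒟) : List U3 :=
  cs.foldl (fun w c => H :: H :: H :: (c : U3)⁻¹ :: w) []

/-! ## Register programs with bit costs -/

/-- Programs over finitely many integer registers with an output list of symbols of `α`. -/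
inductive Prog (α : Type) : Type
  | skip : Prog α
  /-- Set register `r` to the integer `n`. -/
  | const (r : ℕ) (n : ℤ) : Prog α
  /-- Set register `r` to the sum of registers `a` and `b`. -/
  | add (r a b : ℕ) : Prog α
  /-- Set register `r` to the difference of registers `a` and `b`. -/
  | sub (r a b : ℕ) : Prog α
  /-- Set register `r` to the product of registers `a` and `b`. -/
  | mul (r a b : ℕ) : Prog α
  /-- Set register `r` to the integer quotient of registers `a` and `b`. -/
  | div (r a b : ℕ) : Prog α
  /-- Set register `r` to the remainder of register `a` modulo register `b`. -/
  | mod (r a b : ℕ) : Prog α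
  /-- Write the symbol `s` in front of the output. -/
  | push (s : α) : Prog α
  | seq (p q : Prog α) : Prog α
  /-- Run `p` if register `r` is positive and `q` otherwise. -/
  | ite (r : ℕ) (p q : Prog α) : Prog α
  /-- Run `p` as long as register `r` is positive. -/
  | loop (r : ℕ) (p : Prog α) : Prog α

/-- The content of the registers and the output written so far. -/
structure Config (α : Type) where
  reg : ℕ → ℤ
  out : List α

/-- The configuration after register `r` is set to `n`. -/
def Config.set {α : Type} (σ : Config α) (r : ℕ) (n : ℤ) : Config α :=
  ⟨Function.update σ.reg r n, σ.out⟩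

/-- The number of bits of an integer, with one bit for its sign. -/
def bits (n : ℤ) : ℕ := Nat.size n.natAbs + 1

/-- `Exec p σ τ t`: the program `p`, started in the configuration `σ`, halts in the configuration
`τ` after `t` bit operations.  Addition and subtraction cost the sum of the lengths of the
operands, multiplication and division cost their product, a test costs the length of the tested
register. -/
inductive Exec {α : Type} : Prog α → Config α → Config α → ℕ → Prop
  | skip (σ) : Exec .skip σ σ 1
  | const (σ) (r n) : Exec (.const r n) σ (σ.set r n) (1 + bits n)
  | add (σ) (r a b) : Exec (.add r a b) σ (σ.set r (σ.reg a + σ.reg b))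
      (1 + bits (σ.reg a) + bits (σ.reg b))
  | sub (σ) (r a b) : Exec (.sub r a b) σ (σ.set r (σ.reg a - σ.reg b))
      (1 + bits (σ.reg a) + bits (σ.reg b))
  | mul (σ) (r a b) : Exec (.mul r a b) σ (σ.set r (σ.reg a * σ.reg b))
      (1 + bits (σ.reg a) * bits (σ.reg b))
  | div (σ) (r a b) : Exec (.div r a b) σ (σ.set r (σ.reg a / σ.reg b))
      (1 + bits (σ.reg a) * bits (σ.reg b))
  | mod (σ) (r a b) : Exec (.mod r a b) σ (σ.set r (σ.reg a % σ.reg b))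
      (1 + bits (σ.reg a) * bits (σ.reg b))
  | push (σ) (s) : Exec (.push s) σ ⟨σ.reg, s :: σ.out⟩ 1
  | seq {p q σ τ υ t u} (hp : Exec p σ τ t) (hq : Exec q τ υ u) : Exec (.seq p q) σ υ (t + u)
  | ite_pos {r p q σ τ t} (h : 0 < σ.reg r) (hp : Exec p σ τ t) :
      Exec (.ite r p q) σ τ (1 + bits (σ.reg r) + t)
  | ite_neg {r p q σ τ t} (h : ¬ 0 < σ.reg r) (hq : Exec q σ τ t) :
      Exec (.ite r p q) σ τ (1 + bits (σ.reg r) + t)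
  | loop_pos {r p σ τ υ t u} (h : 0 < σ.reg r) (hp : Exec p σ τ t)
      (hw : Exec (.loop r p) τ υ u) : Exec (.loop r p) σ υ (1 + bits (σ.reg r) + t + u)
  | loop_neg {r p σ} (h : ¬ 0 < σ.reg r) : Exec (.loop r p) σ σ (1 + bits (σ.reg r))

/-- The program `p`, given the integers `l` in the registers `0, 1, 2, …` (and `0` in all others),
halts with output `w` after `t` bit operations. -/
def Computes {α : Type} (p : Prog α) (l : List ℤ) (w : List α) (t : ℕ) : Prop :=
  ∃ τ : Config α, Exec p ⟨fun r => l.getD r 0, []⟩ τ t ∧ τ.out = w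

/-! ## Matrices as input -/

/-- Integer data describing a `3 × 3` matrix over `ℤ[ζ₉, 1/3]`: coefficients with respect to
`1, ζ₉, …, ζ₉ ^ 5`, and the exponent of a common denominator `3 ^ k`. -/
structure MatrixCode where
  k : ℕ
  coeff : Fin 3 → Fin 3 → Fin 6 → ℤ

/-- The matrix described by the integer data. -/
def MatrixCode.toMatrix (x : MatrixCode) : Matrix (Fin 3) (Fin 3) ℂ :=
  Matrix.of fun i j => (∑ m : Fin 6, (x.coeff i j m : ℂ) * ζ₉ ^ (m : ℕ)) / 3 ^ x.k

/-- The 55 integers of the data, `k` first. -/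
def MatrixCode.toList (x : MatrixCode) : List ℤ :=
  (x.k : ℤ) :: (List.finRange 3).flatMap fun i =>
    (List.finRange 3).flatMap fun j => List.ofFn (x.coeff i j)

/-- The bit length of the data. -/
def MatrixCode.size (x : MatrixCode) : ℕ := (x.toList.map bits).sum

end CliffordD

end

/-! Everything is governed by the denominator exponent `dexp g`: the least `t` for which `π ^ t g`
is integral at `π`. Since `π` is the only prime above `3`, an entry of `g` integral at `π` already
lies in `ℤ[ζ₉]`. The distance from `g v₀` to `v₀` is `2 * dexp g` (`distV0_eq`) and `C` is the set
where `dexp` vanishes (`mem_C_iff`), so the geometric claim becomes: unless `dexp g = 0`, some gate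
`c` makes `dexp (g c H)` smaller than `dexp g`.

Distance. Call a vertex `l`-near if it has a representative `L` with `π ^ l 𝒪³ ⊆ L ⊆ 𝒪³`; each edge
of the tree costs one in `l`. For the lattice of a unitary `g`, comparing `g` with `g⁻¹ = g*` forces
`l ≥ 2t`. Conversely, `π ^ t` times a suitable column of `g` is primitive with norm divisible by `π
^ (2t)`. In a basis adapted to it, the lattices with exponents `(-s, 0, s)`, `0 ≤ s ≤ t`, are fixed
by the involution and give a path of length `2t`.

Descent. The residue field has three elements and conjugation is trivial on it, so three coordinates
with norm sum divisible by `π` are all units or all nonunits. Modulo `π ^ 4`, a unit becomes `1 + b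
π ^ 2` after a root of unity is removed. Hence, if `t ≥ 3`, a diagonal gate brings the sum of a
primitive row of `π ^ t g` into `π ^ 4 𝒪`. All rows are proportional to that row modulo `π ^ 3`, and
orthogonality supplies the missing factor of `π` for the others. As `ζ₃ - 1` is divisible by `π ^
3`, the other two Fourier sums lie in `π ^ 4 𝒪` as well; dividing by `√-3`, of valuation three,
leaves a gain of one. The values `t = 1, 2` do not occur (`three_le_dexp`): one sixth of the trace
of `x x̄` is a positive definite integral form on `ℤ[ζ₉]` whose vectors of norm one are roots of
unity, and a count with it excludes them.

The same form shows that the elements of `C` are monomial, hence products of a diagonal gate and a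
permutation matrix; the permutations come from `H ^ 2` and from conjugating `diag(1, ζ₃, ζ₃²)` by
`H`. Induction on `dexp` then gives generation. The subgroup `stabD` consists of the `±ζ₉ ^ a
diag(1, ω, ω²)` with `ω³ = 1`, which has order 54, against `18³` for `𝒟`. An element of `stabD`
moves past `H` into `C` without changing `dexp`, so the descending gate may be taken from any set of
representatives.

Algorithm. The registers hold `k` and the coordinates of `3 ^ k g`. The loop divides by `3` when
possible and otherwise multiplies by a descending `c H` found by divisibility tests; at `k = 0` a
finite table finishes. Unitarity bounds the coordinates in terms of `k`, which is itself linear in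
the input length, and `k + dexp g` drops in every round. So there are linearly many rounds on
integers of linear length. -/

noncomputable section

namespace CliffordD

open Matrix

/-! ## Coordinates in `ℤ[ζ₉]` -/

/-- The element of `ℤ[ζ₉]` with given coordinates with respect to `1, ζ₉, …, ζ₉ ^ 5`. -/
def ev (a : Fin 6 → ℤ) : ℂ := ∑ m : Fin 6, (a m : ℂ) * ζ₉ ^ (m : ℕ)

theorem ev_eq (a : Fin 6 → ℤ) : ev a = a 0 + a 1 * ζ₉ + a 2 * ζ₉ ^ 2 + a 3 * ζ₉ ^ 3 + a 4 * ζ₉ ^ 4 +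
    a 5 * ζ₉ ^ 5 := by
  simp [ev, Fin.sum_univ_six]

theorem ev_mem (a : Fin 6 → ℤ) : ev a ∈ OE :=
  OE.sum_mem fun _ _ => OE.mul_mem (intCast_mem _ _) (OE.pow_mem ζ₉_mem_OE _)

theorem ev_add (a b : Fin 6 → ℤ) : ev (a + b) = ev a + ev b := by
  simp [ev, add_mul, Finset.sum_add_distrib]

theorem ev_neg (a : Fin 6 → ℤ) : ev (-a) = -ev a := by
  simp [ev]

theorem ev_zero : ev 0 = 0 := by simp [ev]

theorem ev_smul (n : ℤ) (a : Fin 6 → ℤ) : ev (n • a) = n * ev a := by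
  simp [ev, Finset.mul_sum, mul_assoc]

theorem ev_sum {ι : Type*} (s : Finset ι) (f : ι → Fin 6 → ℤ) :
    ev (∑ i ∈ s, f i) = ∑ i ∈ s, ev (f i) := by
  classical
  induction s using Finset.induction_on with
  | empty => simp [ev_zero]
  | insert i s hi ih => rw [Finset.sum_insert hi, Finset.sum_insert hi, ev_add, ih]

theorem ev_single (m : Fin 6) : ev (Pi.single m 1) = ζ₉ ^ (m : ℕ) := by
  rw [ev, Finset.sum_eq_single m]
  · simp
  · intro b _ hb
    simp [Pi.single_eq_of_ne hb]
  · simp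

theorem ev_int (n : ℤ) : ev (n • Pi.single 0 1) = n := by
  rw [ev_smul, ev_single]; simp

theorem natDegree_minpoly_ζ₉ : (minpoly ℚ ζ₉).natDegree = 6 := by
  rw [← Polynomial.cyclotomic_eq_minpoly_rat ζ₉_prim (by norm_num),
    Polynomial.natDegree_cyclotomic]
  decide

/-- The ninth cyclotomic polynomial has degree six, so the first six powers of `ζ₉` are linearly
independent over `ℚ`. -/
theorem ev_injective : Function.Injective ev := by
  have h : ∀ a : Fin 6 → ℤ, ev a = 0 → a = 0 := by
    intro a ha
    have hli := linearIndependent_pow (K := ℚ) ζ₉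
    rw [natDegree_minpoly_ζ₉, Fintype.linearIndependent_iff] at hli
    have h0 := hli (fun i => (a i : ℚ)) (by
      rw [← ha, ev]
      refine Finset.sum_congr rfl fun i _ => ?_
      rw [Algebra.smul_def]
      simp)
    funext i
    exact_mod_cast h0 i
  intro a b hab
  refine sub_eq_zero.mp (h _ ?_)
  rw [sub_eq_add_neg, ev_add, ev_neg, hab, add_neg_cancel]

theorem exists_ev_mul_ζ₉ (a : Fin 6 → ℤ) :
    ev ![-a 5, a 0, a 1, a 2 - a 5, a 3, a 4] = ζ₉ * ev a := by
  simp only [ev_eq, Matrix.cons_val]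
  push_cast
  linear_combination (-(a 5 : ℂ)) * ζ₉_rel

theorem exists_ev {x : ℂ} (hx : x ∈ OE) : ∃ a, ev a = x := by
  -- Tracking multiplication by `x` instead of `x` itself makes the product case a mere composition.
  have h : ∀ a, ∃ b, ev b = x * ev a := by
    induction hx using Subring.closure_induction with
    | mem x hx =>
      rw [Set.mem_singleton_iff] at hx
      exact fun a => ⟨_, by rw [exists_ev_mul_ζ₉, hx]⟩
    | zero => exact fun a => ⟨0, by rw [ev_zero, zero_mul]⟩
    | one => exact fun a => ⟨a, (one_mul _).symm⟩
    | add x y _ _ hx hy =>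
      intro a
      obtain ⟨b, hb⟩ := hx a
      obtain ⟨c, hc⟩ := hy a
      exact ⟨b + c, by rw [ev_add, hb, hc, add_mul]⟩
    | neg x _ hx =>
      intro a
      obtain ⟨b, hb⟩ := hx a
      exact ⟨-b, by rw [ev_neg, hb, neg_mul]⟩
    | mul x y _ _ hx hy =>
      intro a
      obtain ⟨b, hb⟩ := hy a
      obtain ⟨c, hc⟩ := hx b
      exact ⟨c, by rw [hc, hb, mul_assoc]⟩
  obtain ⟨b, hb⟩ := h (Pi.single 0 1)
  exact ⟨b, by rw [hb, ev_single]; simp⟩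

/-! ### The trace form on the ring of integers -/

/-- The positive definite quadratic form giving the constant coordinate of `x * star x`. -/
def normForm (a : Fin 6 → ℤ) : ℤ :=
  (a 0 * a 0 - a 0 * a 3 + a 3 * a 3) + (a 1 * a 1 - a 1 * a 4 + a 4 * a 4) +
    (a 2 * a 2 - a 2 * a 5 + a 5 * a 5)

theorem ev_mul_star (a : Fin 6 → ℤ) :
    ∃ b : Fin 6 → ℤ, b 0 = normForm a ∧ ev a * star (ev a) = ev b := by
  -- The product reduced by `ζ₉ ^ 6 = -1 - ζ₉ ^ 3`. Its `ζ₉ ^ 3` coordinate vanishes, so the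
  -- constant coordinate is one sixth of the trace.
  refine ⟨![a 0*a 0 - a 0*a 3 + a 1*a 1 - a 1*a 4 + a 2*a 2 - a 2*a 5 + a 3*a 3 + a 4*a 4 + a 5*a 5,
    a 0*a 1 - a 0*a 2 + a 1*a 2 - a 1*a 3 + a 2*a 3 - a 2*a 4 + a 3*a 4 - a 3*a 5 + a 4*a 5, -a
    0*a 1 + a 0*a 2 - a 1*a 2 + a 1*a 3 - a 2*a 3 + a 2*a 4 - a 3*a 4 + a 3*a 5 - a 4*a 5, 0,
    -a 0*a 2 + a 0*a 4 + a 0*a 5 - a 1*a 3 + a 1*a 5 - a 2*a 4 - a 3*a 5, -a 0*a 1 + a 0*a 4 +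
    a 0*a 5 - a 1*a 2 + a 1*a 5 - a 2*a 3 - a 3*a 4 - a 4*a 5], ?_, ?_⟩
  · simp only [Matrix.cons_val, normForm]
    ring
  · have h : star (ev a) = a 0 + a 1 * ζ₉ ^ 8 + a 2 * ζ₉ ^ 7 + a 3 * ζ₉ ^ 6 + a 4 * ζ₉ ^ 5 +
        a 5 * ζ₉ ^ 4 := by
      rw [ev_eq]
      simp only [star_add, star_mul', star_pow, star_ζ₉, Complex.star_def, map_intCast]
      linear_combination (a 2 * ζ₉ ^ 7 + a 3 * (ζ₉ ^ 15 + ζ₉ ^ 6) +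
        a 4 * (ζ₉ ^ 23 + ζ₉ ^ 14 + ζ₉ ^ 5) +
        a 5 * (ζ₉ ^ 31 + ζ₉ ^ 22 + ζ₉ ^ 13 + ζ₉ ^ 4)) * ζ₉_pow
    rw [h]
    simp only [ev_eq, Matrix.cons_val]
    push_cast
    linear_combination (((a 0 : ℂ)*(a 3 : ℂ) - (a 1 : ℂ)*(a 1 : ℂ) + (a 1 : ℂ)*(a 4 : ℂ) - (a 2 : ℂ)*(a 2 : ℂ) + (a
    2 : ℂ)*(a 5 : ℂ) - (a 3 : ℂ)*(a 3 : ℂ) - (a 4 : ℂ)*(a 4 : ℂ) - (a 5 : ℂ)*(a 5 : ℂ)) * ζ₉ ^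
    0 + ((a 0 : ℂ)*(a 2 : ℂ) - (a 1 : ℂ)*(a 2 : ℂ) + (a 1 : ℂ)*(a 3 : ℂ) - (a 2 : ℂ)*(a 3 : ℂ)
    + (a 2 : ℂ)*(a 4 : ℂ) - (a 3 : ℂ)*(a 4 : ℂ) + (a 3 : ℂ)*(a 5 : ℂ) - (a 4 : ℂ)*(a 5 : ℂ)) *
    ζ₉ ^ 1 + ((a 0 : ℂ)*(a 1 : ℂ) + (a 1 : ℂ)*(a 2 : ℂ) - (a 1 : ℂ)*(a 3 : ℂ) + (a 2 : ℂ)*(a 3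
    : ℂ) - (a 2 : ℂ)*(a 4 : ℂ) + (a 3 : ℂ)*(a 4 : ℂ) - (a 3 : ℂ)*(a 5 : ℂ) + (a 4 : ℂ)*(a 5 :
    ℂ)) * ζ₉ ^ 2 + ((a 1 : ℂ)*(a 1 : ℂ) - (a 1 : ℂ)*(a 4 : ℂ) + (a 2 : ℂ)*(a 2 : ℂ) - (a 2 :
    ℂ)*(a 5 : ℂ) + (a 3 : ℂ)*(a 3 : ℂ) + (a 4 : ℂ)*(a 4 : ℂ) + (a 5 : ℂ)*(a 5 : ℂ)) * ζ₉ ^ 3 +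
    ((a 1 : ℂ)*(a 2 : ℂ) - (a 1 : ℂ)*(a 5 : ℂ) + (a 2 : ℂ)*(a 3 : ℂ) + (a 3 : ℂ)*(a 4 : ℂ) + (a
    4 : ℂ)*(a 5 : ℂ)) * ζ₉ ^ 4 + ((a 1 : ℂ)*(a 3 : ℂ) + (a 2 : ℂ)*(a 4 : ℂ) + (a 3 : ℂ)*(a 5 :
    ℂ)) * ζ₉ ^ 5 + ((a 1 : ℂ)*(a 4 : ℂ) + (a 2 : ℂ)*(a 5 : ℂ)) * ζ₉ ^ 6 + ((a 1 : ℂ)*(a 5 : ℂ))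
    * ζ₉ ^ 7) * ζ₉_rel

theorem normForm_slot (x y : ℤ) : 0 ≤ x * x - x * y + y * y := by
  nlinarith [sq_nonneg (x + y), sq_nonneg (x - y)]

theorem three_mul_sq_le_slot (x y : ℤ) : 3 * x ^ 2 ≤ 4 * (x * x - x * y + y * y) := by
  nlinarith [sq_nonneg (x - 2 * y)]

theorem three_mul_sq_le_slot' (x y : ℤ) : 3 * y ^ 2 ≤ 4 * (x * x - x * y + y * y) := by
  nlinarith [sq_nonneg (2 * x - y)]

theorem three_mul_sq_le_normForm (a : Fin 6 → ℤ) (m : Fin 6) : 3 * a m ^ 2 ≤ 4 * normForm a := by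
  have h0 := normForm_slot (a 0) (a 3)
  have h1 := normForm_slot (a 1) (a 4)
  have h2 := normForm_slot (a 2) (a 5)
  rw [normForm]
  fin_cases m
  · change 3 * a 0 ^ 2 ≤ _
    linarith [three_mul_sq_le_slot (a 0) (a 3)]
  · change 3 * a 1 ^ 2 ≤ _
    linarith [three_mul_sq_le_slot (a 1) (a 4)]
  · change 3 * a 2 ^ 2 ≤ _
    linarith [three_mul_sq_le_slot (a 2) (a 5)]
  · change 3 * a 3 ^ 2 ≤ _
    linarith [three_mul_sq_le_slot' (a 0) (a 3)]
  · change 3 * a 4 ^ 2 ≤ _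
    linarith [three_mul_sq_le_slot' (a 1) (a 4)]
  · change 3 * a 5 ^ 2 ≤ _
    linarith [three_mul_sq_le_slot' (a 2) (a 5)]

theorem normForm_nonneg (a : Fin 6 → ℤ) : 0 ≤ normForm a := by
  nlinarith [three_mul_sq_le_normForm a 0, sq_nonneg (a 0)]

theorem normForm_pos {a : Fin 6 → ℤ} (ha : ev a ≠ 0) : 1 ≤ normForm a := by
  by_contra! h
  apply ha
  have h0 : a = 0 := by
    funext m
    have h1 := three_mul_sq_le_normForm a m
    have h2 : a m ^ 2 ≤ 0 := by linarith
    exact pow_eq_zero_iff (two_ne_zero) |>.mp (le_antisymm h2 (sq_nonneg _))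
  rw [h0, ev_zero]

/-- Comparison of constant coordinates in a sum of squares of absolute values. -/
theorem sum_normForm {ι : Type*} (s : Finset ι) (a : ι → Fin 6 → ℤ) (n : Fin 6 → ℤ)
    (h : ∑ j ∈ s, ev (a j) * star (ev (a j)) = ev n) : ∑ j ∈ s, normForm (a j) = n 0 := by
  choose b hb hb' using fun j => ev_mul_star (a j)
  simp only [hb', ← ev_sum] at h
  rw [← ev_injective h, Finset.sum_apply]
  exact Finset.sum_congr rfl fun j _ => (hb j).symm

theorem slot_eq_one {x y : ℤ} (h : x * x - x * y + y * y = 1) :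
    (x = 1 ∧ y = 0) ∨ (x = -1 ∧ y = 0) ∨ (x = 0 ∧ y = 1) ∨ (x = 0 ∧ y = -1) ∨
      (x = 1 ∧ y = 1) ∨ (x = -1 ∧ y = -1) := by
  have hx := three_mul_sq_le_slot x y
  have hy := three_mul_sq_le_slot' x y
  rw [h] at hx hy
  have h1 : x ≤ 1 := by nlinarith
  have h2 : -1 ≤ x := by nlinarith
  have h3 : y ≤ 1 := by nlinarith
  have h4 : -1 ≤ y := by nlinarith
  interval_cases x <;> interval_cases y <;> simp_all

theorem slot_eq_zero {x y : ℤ} (h : x * x - x * y + y * y = 0) : x = 0 ∧ y = 0 := by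
  constructor
  · nlinarith [three_mul_sq_le_slot x y, sq_nonneg x]
  · nlinarith [three_mul_sq_le_slot' x y, sq_nonneg y]

/-- The Eisenstein integers of norm one are `±1, ±ζ₃, ±ζ₃²`, with `1 + ζ₃ = -ζ₃²`. -/
theorem ev_slot {x y : ℤ} (h : x * x - x * y + y * y = 1) :
    ∃ (s : ℤˣ) (n : ℤ), (x : ℂ) + y * ζ₉ ^ 3 = ((s : ℤ) : ℂ) * ζ₉ ^ n := by
  have h6 : ζ₉ ^ (6 : ℤ) = -1 - ζ₉ ^ 3 := by
    have := ζ₉_rel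
    rw [show (6 : ℤ) = ((6 : ℕ) : ℤ) by rfl, zpow_natCast]
    linear_combination this
  have h3 : ζ₉ ^ (3 : ℤ) = ζ₉ ^ 3 := by
    rw [show (3 : ℤ) = ((3 : ℕ) : ℤ) by rfl, zpow_natCast]
  rcases slot_eq_one h with h | h | h | h | h | h <;> obtain ⟨rfl, rfl⟩ := h
  · exact ⟨1, 0, by simp⟩
  · exact ⟨-1, 0, by simp⟩
  · exact ⟨1, 3, by rw [h3]; simp⟩
  · exact ⟨-1, 3, by rw [h3]; simp⟩
  · exact ⟨-1, 6, by rw [h6]; push_cast; ring⟩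
  · exact ⟨1, 6, by rw [h6]; push_cast; ring⟩

/-- Elements of norm form one are roots of unity. -/
theorem ev_of_normForm_eq_one {a : Fin 6 → ℤ} (h : normForm a = 1) :
    ∃ (s : ℤˣ) (n : ℤ), ev a = ((s : ℤ) : ℂ) * ζ₉ ^ n := by
  have h0 := normForm_slot (a 0) (a 3)
  have h1 := normForm_slot (a 1) (a 4)
  have h2 := normForm_slot (a 2) (a 5)
  rw [normForm] at h
  have key : ∀ (j : ℕ) (x y : ℤ), x * x - x * y + y * y = 1 → ev a = (x + y * ζ₉ ^ 3) * ζ₉ ^ j →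
      ∃ (s : ℤˣ) (n : ℤ), ev a = ((s : ℤ) : ℂ) * ζ₉ ^ n := by
    intro j x y hxy he
    obtain ⟨s, n, hs⟩ := ev_slot hxy
    refine ⟨s, n + j, ?_⟩
    rw [he, hs, zpow_add₀ ζ₉_ne_zero, zpow_natCast, mul_assoc]
  rcases (by omega : (a 0 * a 0 - a 0 * a 3 + a 3 * a 3 = 1 ∧
      a 1 * a 1 - a 1 * a 4 + a 4 * a 4 = 0 ∧ a 2 * a 2 - a 2 * a 5 + a 5 * a 5 = 0) ∨
      (a 0 * a 0 - a 0 * a 3 + a 3 * a 3 = 0 ∧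
      a 1 * a 1 - a 1 * a 4 + a 4 * a 4 = 1 ∧ a 2 * a 2 - a 2 * a 5 + a 5 * a 5 = 0) ∨
      (a 0 * a 0 - a 0 * a 3 + a 3 * a 3 = 0 ∧
      a 1 * a 1 - a 1 * a 4 + a 4 * a 4 = 0 ∧ a 2 * a 2 - a 2 * a 5 + a 5 * a 5 = 1))
    with ⟨e0, e1, e2⟩ | ⟨e0, e1, e2⟩ | ⟨e0, e1, e2⟩
  · obtain ⟨h1, h4⟩ := slot_eq_zero e1
    obtain ⟨h2, h5⟩ := slot_eq_zero e2
    exact key 0 _ _ e0 (by rw [ev_eq, h1, h2, h4, h5]; push_cast; ring)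
  · obtain ⟨h0, h3⟩ := slot_eq_zero e0
    obtain ⟨h2, h5⟩ := slot_eq_zero e2
    exact key 1 _ _ e1 (by rw [ev_eq, h0, h2, h3, h5]; push_cast; ring)
  · obtain ⟨h0, h3⟩ := slot_eq_zero e0
    obtain ⟨h1, h4⟩ := slot_eq_zero e1
    exact key 2 _ _ e2 (by rw [ev_eq, h0, h1, h3, h4]; push_cast; ring)

theorem star_unit_mul (s : ℤˣ) (n : ℤ) :
    (((s : ℤ) : ℂ) * ζ₉ ^ n) * star (((s : ℤ) : ℂ) * ζ₉ ^ n) = 1 := by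
  have hz : star ζ₉ = ζ₉⁻¹ := by
    rw [star_ζ₉]
    exact eq_inv_of_mul_eq_one_left (by linear_combination ζ₉_pow)
  have hs : ((s : ℤ) : ℂ) * ((s : ℤ) : ℂ) = 1 := by
    rw [← Int.cast_mul, Int.units_coe_mul_self, Int.cast_one]
  have hn : ζ₉ ^ n ≠ 0 := zpow_ne_zero _ ζ₉_ne_zero
  rw [star_mul', star_zpow₀, hz, _root_.inv_zpow, Complex.star_def, map_intCast]
  calc _ = (((s : ℤ) : ℂ) * ((s : ℤ) : ℂ)) * (ζ₉ ^ n * (ζ₉ ^ n)⁻¹) := by ring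
    _ = 1 := by rw [hs, mul_inv_cancel₀ hn, one_mul]

/-! ## The valuation -/

theorem piE_mem_OE : piE ∈ OE := OE.sub_mem OE.one_mem ζ₉_mem_OE

theorem piE_ne_zero : piE ≠ 0 :=
  sub_ne_zero.mpr (ζ₉_prim.ne_one (by norm_num)).symm

theorem OE_le_Opi : OE ≤ Opi := fun x hx => ⟨x, hx, 1, OE.one_mem, not_dvdPi_one, by simp⟩

/-- `x` lies in `π ^ n 𝒪`. -/
def Val (n : ℤ) (x : ℂ) : Prop := x * piE ^ (-n) ∈ Opi

theorem val_zero_iff {x : ℂ} : Val 0 x ↔ x ∈ Opi := by simp [Val]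

theorem val_of_OE {x : ℂ} (hx : x ∈ OE) : Val 0 x := val_zero_iff.mpr (OE_le_Opi hx)

theorem Val.zero (n : ℤ) : Val n 0 := by
  rw [Val, zero_mul]; exact Opi.zero_mem

theorem Val.add {n : ℤ} {x y : ℂ} (hx : Val n x) (hy : Val n y) : Val n (x + y) := by
  rw [Val, add_mul]; exact Opi.add_mem hx hy

theorem Val.neg {n : ℤ} {x : ℂ} (hx : Val n x) : Val n (-x) := by
  rw [Val, neg_mul]; exact Opi.neg_mem hx

theorem Val.sub {n : ℤ} {x y : ℂ} (hx : Val n x) (hy : Val n y) : Val n (x - y) := by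
  rw [sub_eq_add_neg]; exact hx.add hy.neg

theorem Val.mul {m n : ℤ} {x y : ℂ} (hx : Val m x) (hy : Val n y) : Val (m + n) (x * y) := by
  have h := Opi.mul_mem hx hy
  rw [Val, neg_add, zpow_add₀ piE_ne_zero]
  convert h using 1
  ring

theorem Val.sum {ι : Type*} {n : ℤ} {s : Finset ι} {f : ι → ℂ} (h : ∀ i ∈ s, Val n (f i)) :
    Val n (∑ i ∈ s, f i) := by
  rw [Val, Finset.sum_mul]; exact Opi.sum_mem h

theorem val_zpow (n : ℤ) : Val n (piE ^ n) := by
  rw [Val, ← zpow_add₀ piE_ne_zero, add_neg_cancel, zpow_zero]; exact Opi.one_mem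

theorem val_piE : Val 1 piE := by simpa using val_zpow 1

theorem val_pow (n : ℕ) : Val n (piE ^ n) := by simpa using val_zpow n

theorem Val.mono {m n : ℤ} (hmn : m ≤ n) {x : ℂ} (hx : Val n x) : Val m x := by
  obtain ⟨k, hk⟩ := Int.eq_ofNat_of_zero_le (sub_nonneg.mpr hmn)
  have h := Opi.mul_mem hx (Opi.pow_mem (OE_le_Opi piE_mem_OE) k)
  rw [Val]
  have e : piE ^ (-m) = piE ^ (-n) * piE ^ k := by
    rw [← zpow_natCast, ← zpow_add₀ piE_ne_zero]
    congr 1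
    lia
  rwa [e, ← mul_assoc]

theorem Val.mul' {k m n : ℤ} {x y : ℂ} (hx : Val m x) (hy : Val n y) (h : k ≤ m + n) :
    Val k (x * y) := (hx.mul hy).mono h

theorem Val.shift {n : ℤ} (m : ℤ) {x : ℂ} : Val (m + n) (piE ^ m * x) ↔ Val n x := by
  rw [Val, Val, neg_add, zpow_add₀ piE_ne_zero, _root_.zpow_neg]
  have : piE ^ m * x * ((piE ^ m)⁻¹ * piE ^ (-n)) = x * piE ^ (-n) := by
    have := zpow_ne_zero m piE_ne_zero
    field_simp
  rw [this]

theorem val_one : Val 0 1 := val_of_OE OE.one_mem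

theorem val_int (n : ℤ) : Val 0 (n : ℂ) := val_of_OE (intCast_mem _ _)

theorem val_ζ₉_pow (n : ℕ) : Val 0 (ζ₉ ^ n) := val_of_OE (OE.pow_mem ζ₉_mem_OE n)

theorem ζ₉_inv : ζ₉⁻¹ = ζ₉ ^ 8 := by
  symm; exact eq_inv_of_mul_eq_one_left (by linear_combination ζ₉_pow)

theorem ζ₉_zpow_mem (n : ℤ) : ζ₉ ^ n ∈ OE := by
  obtain ⟨k, h | h⟩ := n.eq_nat_or_neg
  · rw [h, zpow_natCast]; exact OE.pow_mem ζ₉_mem_OE k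
  · rw [h, _root_.zpow_neg, ← _root_.inv_zpow, ζ₉_inv, zpow_natCast]
    exact OE.pow_mem (OE.pow_mem ζ₉_mem_OE 8) k

theorem val_mul_piE_iff {m n : ℤ} {x : ℂ} (h : m = n + 1) : Val m (piE * x) ↔ Val n x := by
  have := Val.shift (n := n) 1 (x := x)
  rwa [zpow_one, add_comm, ← h] at this

theorem dvdPi_iff_val {x : ℂ} (hx : x ∈ OE) : DvdPi x ↔ Val 1 x := by
  constructor
  · rintro ⟨c, hc, rfl⟩
    exact (val_mul_piE_iff (n := 0) (by norm_num)).mpr (val_of_OE hc)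
  · rintro ⟨a, ha, b, hb, hb', h⟩
    by_contra hx'
    apply not_dvdPi_mul hx hx' hb hb'
    refine ⟨a, ha, ?_⟩
    have hb0 := ne_zero_of_not_dvdPi hb'
    have hp := piE_ne_zero
    rw [_root_.zpow_neg, zpow_one] at h
    field_simp at h
    exact h

theorem not_val_one_one : ¬ Val 1 1 := fun h => not_dvdPi_one ((dvdPi_iff_val OE.one_mem).mpr h)

/-- Conjugation multiplies `π` by the unit `-ζ₉ ^ 8`, so it preserves the valuation. -/
theorem Val.conj {n : ℤ} {x : ℂ} (hx : Val n x) : Val n (star x) := by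
  have h := star_mem_Opi hx
  have e : star piE = -ζ₉ ^ 8 * piE := by
    rw [piE, star_sub, star_one, star_ζ₉]
    linear_combination -ζ₉_pow
  have hu : (-ζ₉ ^ 8) ^ n ∈ Opi := by
    apply OE_le_Opi
    rw [neg_eq_neg_one_mul, mul_zpow]
    refine OE.mul_mem ?_ ?_
    · rcases Int.even_or_odd n with h | h
      · rw [h.neg_one_zpow]; exact OE.one_mem
      · rw [h.neg_one_zpow]; exact OE.neg_mem OE.one_mem
    · rw [← ζ₉_inv, _root_.inv_zpow, ← _root_.zpow_neg]; exact ζ₉_zpow_mem _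
  have h2 := Opi.mul_mem h hu
  rw [star_mul', star_zpow₀, e, mul_zpow, mul_assoc] at h2
  rw [Val]
  convert h2 using 2
  have h0 : (-ζ₉ ^ 8 : ℂ) ≠ 0 := neg_ne_zero.mpr (pow_ne_zero _ ζ₉_ne_zero)
  have := zpow_ne_zero n h0
  rw [_root_.zpow_neg (-ζ₉ ^ 8)]
  field_simp

theorem val_star_iff {n : ℤ} {x : ℂ} : Val n (star x) ↔ Val n x :=
  ⟨fun h => by simpa using h.conj, fun h => h.conj⟩

theorem Val.inv {x : ℂ} (hx : Val 0 x) (hx' : ¬ Val 1 x) : Val 0 x⁻¹ := by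
  rw [val_zero_iff] at hx ⊢
  obtain ⟨a, ha, b, hb, hb', rfl⟩ := hx
  refine ⟨b, hb, a, ha, fun h => hx' ?_, inv_div a b⟩
  have h1 : Val 0 (1 / b) := val_zero_iff.mpr ⟨1, OE.one_mem, b, hb, hb', rfl⟩
  have := ((dvdPi_iff_val ha).mp h).mul h1
  rwa [mul_one_div, add_zero] at this

theorem ne_zero_of_not_val {n : ℤ} {x : ℂ} (hx : ¬ Val n x) : x ≠ 0 := by
  rintro rfl
  exact hx (Val.zero n)

theorem Val.of_mul_unit {n : ℤ} {x y : ℂ} (hx : Val 0 x) (hx' : ¬ Val 1 x) (h : Val n (x * y)) :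
    Val n y := by
  have := (hx.inv hx').mul h
  rwa [zero_add, inv_mul_cancel_left₀ (ne_zero_of_not_val hx')] at this

theorem not_val_mul {x y : ℂ} (hx : Val 0 x) (hx' : ¬ Val 1 x) (hy' : ¬ Val 1 y) :
    ¬ Val 1 (x * y) := fun h => hy' (Val.of_mul_unit hx hx' h)

/-- Total ramification of `3`: the cofactor is a unit, whose inverse is the one written out in
`val_three`. -/
theorem piE_pow_six : piE ^ 6 = 3 * ev ![0, -2, 5, -7, 5, -2] := by
  simp only [ev_eq, Matrix.cons_val, piE]
  push_cast
  linear_combination ζ₉_rel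

theorem val_three : Val 6 3 := by
  have h : (3 : ℂ) = piE ^ 6 * ev ![10, 11, 7, 10, 4, -4] := by
    simp only [ev_eq, Matrix.cons_val, piE]
    push_cast
    linear_combination (-(7 - 49 * ζ₉ + 91 * ζ₉ ^ 2 - 74 * ζ₉ ^ 3 + 28 * ζ₉ ^ 4 - 4 * ζ₉ ^ 5)) *
      ζ₉_rel
  rw [h]
  exact (val_pow 6).mul' (val_of_OE (ev_mem _)) (by norm_num)

theorem val_third : Val (-6) (1 / 3) := by
  have h : (1 / 3 : ℂ) = piE ^ (-6 : ℤ) * ev ![0, -2, 5, -7, 5, -2] := by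
    have h6 := piE_pow_six
    have h0 : piE ^ (6 : ℤ) ≠ 0 := zpow_ne_zero _ piE_ne_zero
    rw [_root_.zpow_neg, eq_inv_mul_iff_mul_eq₀ h0]
    rw [show (6 : ℤ) = ((6 : ℕ) : ℤ) by rfl, zpow_natCast, h6]
    ring
  rw [h]
  exact (val_zpow (-6)).mul' (val_of_OE (ev_mem _)) (by norm_num)

/-- Every integral element is congruent to `0`, `1` or `-1`. -/
theorem Val.residue {x : ℂ} (hx : Val 0 x) :
    ∃ n : ℤ, (n = 0 ∨ n = 1 ∨ n = -1) ∧ Val 1 (x - n) := by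
  have hint : ∃ n : ℤ, Val 1 (x - n) := by
    rw [val_zero_iff] at hx
    obtain ⟨a, ha, b, hb, hb', rfl⟩ := hx
    obtain ⟨c, hc, hbc⟩ := exists_inv_mod hb hb'
    obtain ⟨n, hn⟩ := exists_int_sub (OE.mul_mem ha hc)
    refine ⟨n, Val.of_mul_unit (val_of_OE hb) (fun h => hb' ((dvdPi_iff_val hb).mpr h)) ?_⟩
    have h1 : Val 1 (a * c - n) := by
      rwa [← dvdPi_iff_val (OE.sub_mem (OE.mul_mem ha hc) (intCast_mem _ _))]
    have h2 : Val 1 (b * c - 1) := by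
      rwa [← dvdPi_iff_val (OE.sub_mem (OE.mul_mem hb hc) OE.one_mem)]
    have e : b * (a / b - n) = b * (a * c - n) - a * (b * c - 1) := by
      field_simp [ne_zero_of_not_dvdPi hb']
      ring
    rw [e]
    exact ((val_of_OE hb).mul' h1 (by norm_num)).sub ((val_of_OE ha).mul' h2 (by norm_num))
  obtain ⟨n, hn⟩ := hint
  have h3 : ∀ q : ℤ, Val 1 (3 * (q : ℂ)) := fun q => val_three.mul' (val_int q) (by norm_num)
  have key : ∀ m q : ℤ, n = m + 3 * q → Val 1 (x - m) := by
    intro m q h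
    have := hn.add (h3 q)
    rw [h] at this
    convert this using 1
    push_cast
    ring
  rcases (by omega : n = 0 + 3 * (n / 3) ∨ n = 1 + 3 * (n / 3) ∨ n = -1 + 3 * (n / 3 + 1))
    with h | h | h
  · exact ⟨0, by simp, key _ _ h⟩
  · exact ⟨1, by simp, key _ _ h⟩
  · exact ⟨-1, by simp, key _ _ h⟩

theorem val_one_int_iff {n : ℤ} : Val 1 (n : ℂ) ↔ 3 ∣ n := by
  constructor
  · intro h
    have h3 : ∀ q : ℤ, Val 1 (3 * (q : ℂ)) := fun q => val_three.mul' (val_int q) (by norm_num)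
    have key : ∀ m q : ℤ, n = m + 3 * q → Val 1 (m : ℂ) := by
      intro m q hm
      have := h.sub (h3 q)
      rw [hm] at this
      convert this using 1
      push_cast
      ring
    rcases (by omega : 3 ∣ n ∨ n = 1 + 3 * (n / 3) ∨ n = -1 + 3 * (n / 3 + 1)) with h | h | h
    · exact h
    · exact absurd (by simpa using key _ _ h) not_val_one_one
    · have := (key _ _ h).neg
      exact absurd (by simpa using this) not_val_one_one
  · rintro ⟨q, rfl⟩
    push_cast
    exact val_three.mul' (val_int q) (by norm_num)

theorem not_val_one_of_unit_sign {x : ℂ} {n : ℤ} (hn : n = 1 ∨ n = -1) (h : Val 1 (x - n)) :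
    ¬ Val 1 x := by
  intro hx
  have := hx.sub h
  rw [sub_sub_cancel, val_one_int_iff] at this
  omega

/-- Divisibility in the localization implies divisibility in `ℤ[ζ₉]`. -/
theorem exists_OE_of_val {x : ℂ} (hx : x ∈ OE) (n : ℕ) (h : Val n x) :
    ∃ c ∈ OE, x = piE ^ n * c := by
  induction n generalizing x with
  | zero => exact ⟨x, hx, by simp⟩
  | succ n ih =>
    obtain ⟨c, hc, rfl⟩ := (dvdPi_iff_val hx).mpr (h.mono (by push_cast; lia))
    obtain ⟨d, hd, rfl⟩ := ih hc ((val_mul_piE_iff (by push_cast; ring)).mp h)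
    exact ⟨d, hd, by ring⟩

theorem third_mul_mem_OE {x : ℂ} (hx : x ∈ OE) (h : Val 6 x) : x * (1 / 3) ∈ OE := by
  obtain ⟨c, hc, rfl⟩ := exists_OE_of_val hx 6 (by exact_mod_cast h)
  rw [piE_pow_six]
  have := OE.mul_mem (ev_mem ![0, -2, 5, -7, 5, -2]) hc
  convert this using 1
  ring

theorem mem_OE_of_three_pow {x : ℂ} (hx : Val 0 x) (k : ℕ) (h : 3 ^ k * x ∈ OE) : x ∈ OE := by
  induction k with
  | zero => simpa using h
  | succ k ih =>
    apply ih
    have h1 : ∀ k : ℕ, Val (6 * k) (3 ^ k) := by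
      intro k
      induction k with
      | zero => simpa using val_one
      | succ k ih => rw [pow_succ]; exact ih.mul' val_three (by push_cast; lia)
    have := third_mul_mem_OE h ((h1 (k + 1)).mul' hx (by push_cast; lia))
    convert this using 1
    ring

theorem exists_three_pow_mul_mem {x : ℂ} (hx : x ∈ OEinv3) :
    ∃ k : ℕ, 3 ^ k * x ∈ OE := by
  have h3 : (3 : ℂ) ∈ OE := by exact_mod_cast natCast_mem OE 3
  have up : ∀ {y : ℂ} {k : ℕ} (l : ℕ), 3 ^ k * y ∈ OE → 3 ^ (l + k) * y ∈ OE := by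
    intro y k l h
    rw [pow_add, mul_assoc]
    exact OE.mul_mem (OE.pow_mem h3 l) h
  induction hx using Subring.closure_induction with
  | mem x hx =>
    rcases hx with rfl | rfl
    · exact ⟨0, by simpa using ζ₉_mem_OE⟩
    · exact ⟨1, by norm_num⟩
  | zero => exact ⟨0, by simp⟩
  | one => exact ⟨0, by simp⟩
  | add x y _ _ hx hy =>
    obtain ⟨k, hk⟩ := hx
    obtain ⟨l, hl⟩ := hy
    refine ⟨l + k, ?_⟩
    rw [mul_add]
    have := up k hl
    rw [add_comm k l] at this
    exact OE.add_mem (up l hk) this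
  | neg x _ hx =>
    obtain ⟨k, hk⟩ := hx
    exact ⟨k, by rw [mul_neg]; exact OE.neg_mem hk⟩
  | mul x y _ _ hx hy =>
    obtain ⟨k, hk⟩ := hx
    obtain ⟨l, hl⟩ := hy
    refine ⟨k + l, ?_⟩
    have := OE.mul_mem hk hl
    rw [pow_add]
    convert this using 1
    ring

theorem val_of_three_pow {x : ℂ} {k : ℕ} (h : 3 ^ k * x ∈ OE) : Val (-(6 * k)) x := by
  have h1 : ∀ k : ℕ, Val (-(6 * k)) ((1 / 3) ^ k) := by
    intro k
    induction k with
    | zero => simpa using val_one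
    | succ k ih => rw [pow_succ]; exact ih.mul' val_third (by push_cast; lia)
  have := (h1 k).mul' (val_of_OE h) (k := -(6 * k)) (by lia)
  rwa [← mul_assoc, ← mul_pow, one_div_mul_cancel (by norm_num), one_pow, one_mul] at this

/-- Only powers of `3` occur as denominators, and `π` is the only prime above `3`; integrality at
`π` therefore removes them all. -/
theorem OEinv3_mem_OE {x : ℂ} (hx : x ∈ OEinv3) (h : Val 0 x) : x ∈ OE := by
  obtain ⟨k, hk⟩ := exists_three_pow_mul_mem hx
  exact mem_OE_of_three_pow h k hk

theorem OE_le_OEinv3 : OE ≤ OEinv3 :=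
  Subring.closure_mono (by simp)

/-! ## The denominator exponent of an element of `Γ` -/

/-- All entries of the matrix lie in `π ^ n 𝒪`. -/
def MVal (n : ℤ) (M : Matrix (Fin 3) (Fin 3) ℂ) : Prop := ∀ i j, Val n (M i j)

theorem MVal.mono {m n : ℤ} (hmn : m ≤ n) {M : Matrix (Fin 3) (Fin 3) ℂ} (h : MVal n M) :
    MVal m M := fun i j => (h i j).mono hmn

theorem MVal.mul {k m n : ℤ} {A B : Matrix (Fin 3) (Fin 3) ℂ} (hA : MVal m A) (hB : MVal n B)
    (h : k ≤ m + n) : MVal k (A * B) := fun i j => by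
  rw [Matrix.mul_apply]
  exact Val.sum fun l _ => (hA i l).mul' (hB l j) h

theorem MVal.smul {k m n : ℤ} {c : ℂ} {A : Matrix (Fin 3) (Fin 3) ℂ} (hc : Val m c) (hA : MVal n A)
    (h : k ≤ m + n) : MVal k (c • A) := fun i j => by
  rw [Matrix.smul_apply, smul_eq_mul]
  exact hc.mul' (hA i j) h

theorem MVal.star {n : ℤ} {A : Matrix (Fin 3) (Fin 3) ℂ} (hA : MVal n A) : MVal n (star A) :=
  fun i j => (hA j i).conj

theorem mval_one : MVal 0 1 := fun i j => by
  rw [Matrix.one_apply]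
  split_ifs
  · exact val_one
  · exact Val.zero 0

/-- The underlying matrix of an element of `Γ`. -/
abbrev mat (g : Γ) : Matrix (Fin 3) (Fin 3) ℂ := ((g : U3) : Matrix (Fin 3) (Fin 3) ℂ)

theorem mat_mul (g h : Γ) : mat (g * h) = mat g * mat h := rfl

theorem mat_mul_star (g : Γ) : mat g * star (mat g) = 1 := Matrix.mem_unitaryGroup_iff.mp g.1.2

theorem star_mul_mat (g : Γ) : star (mat g) * mat g = 1 := Matrix.mem_unitaryGroup_iff'.mp g.1.2

theorem row_orth (g : Γ) (i k : Fin 3) :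
    mat g i 0 * star (mat g k 0) + mat g i 1 * star (mat g k 1) + mat g i 2 * star (mat g k 2) =
      if i = k then 1 else 0 := by
  have h := congrFun (congrFun (mat_mul_star g) i) k
  rw [Matrix.mul_apply, Fin.sum_univ_three, Matrix.one_apply] at h
  exact h

theorem col_orth (g : Γ) (i k : Fin 3) :
    star (mat g 0 i) * mat g 0 k + star (mat g 1 i) * mat g 1 k + star (mat g 2 i) * mat g 2 k =
      if i = k then 1 else 0 := by
  have h := congrFun (congrFun (star_mul_mat g) i) k
  rw [Matrix.mul_apply, Fin.sum_univ_three, Matrix.one_apply] at h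
  exact h

theorem exists_three_pow_mat (g : Γ) : ∃ k : ℕ, ∀ i j, 3 ^ k * mat g i j ∈ OE := by
  choose k hk using fun i j => exists_three_pow_mul_mem (g.2 i j)
  refine ⟨∑ i, ∑ j, k i j, fun i j => ?_⟩
  have hle : k i j ≤ ∑ i, ∑ j, k i j :=
    (Finset.single_le_sum (f := fun j => k i j) (fun _ _ => Nat.zero_le _) (Finset.mem_univ j)).trans
      (Finset.single_le_sum (f := fun i => ∑ j, k i j) (fun _ _ => Nat.zero_le _)
        (Finset.mem_univ i))
  obtain ⟨l, hl⟩ := Nat.exists_eq_add_of_le' hle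
  rw [hl, pow_add, mul_assoc]
  exact OE.mul_mem (OE.pow_mem (by exact_mod_cast natCast_mem OE 3) l) (hk i j)

theorem exists_mval (g : Γ) : ∃ t : ℕ, MVal (-t) (mat g) := by
  obtain ⟨k, hk⟩ := exists_three_pow_mat g
  exact ⟨6 * k, fun i j => by simpa using val_of_three_pow (hk i j)⟩

open Classical in
/-- The least `t` such that `π ^ t * g` is integral at `π`. -/
def dexp (g : Γ) : ℕ := Nat.find (exists_mval g)

theorem dexp_spec (g : Γ) : MVal (-dexp g) (mat g) := by
  classical exact Nat.find_spec (exists_mval g)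

theorem dexp_le_iff {g : Γ} {n : ℕ} : dexp g ≤ n ↔ MVal (-n) (mat g) := by
  classical
  constructor
  · intro h
    exact (dexp_spec g).mono (by lia)
  · intro h
    exact Nat.find_min' _ h

/-- Some entry attains the denominator exponent exactly. Minimality gives this only for `dexp g >
0`; for `dexp g = 0` it holds because a row of norm one cannot lie in `π 𝒪³`. -/
theorem exists_not_val (g : Γ) : ∃ i j, ¬ Val (1 - dexp g) (mat g i j) := by
  by_contra! h
  rcases Nat.eq_zero_or_pos (dexp g) with h0 | h0
  · rw [h0] at h
    have h1 := row_orth g 0 0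
    rw [if_pos rfl] at h1
    apply not_val_one_one
    rw [← h1]
    have : ∀ j, Val 1 (mat g 0 j * star (mat g 0 j)) := fun j =>
      (h 0 j).mul' (h 0 j).conj (by norm_num)
    exact ((this 0).add (this 1)).add (this 2)
  · have : dexp g ≤ dexp g - 1 := dexp_le_iff.mpr fun i j => (h i j).mono (by lia)
    omega

theorem dexp_inv (g : Γ) : dexp g⁻¹ = dexp g := by
  have h : ∀ g : Γ, dexp g⁻¹ ≤ dexp g := fun g => dexp_le_iff.mpr (dexp_spec g).star
  exact le_antisymm (h g) (by simpa using h g⁻¹)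

theorem dexp_mul_of_dexp_eq_zero (g k : Γ) (hk : dexp k = 0) : dexp (g * k) = dexp g := by
  have h : ∀ g k : Γ, dexp k = 0 → dexp (g * k) ≤ dexp g := by
    intro g k hk
    have h1 := dexp_spec k
    rw [hk] at h1
    exact dexp_le_iff.mpr ((dexp_spec g).mul h1 (by simp))
  refine le_antisymm (h g k hk) ?_
  simpa using h (g * k) k⁻¹ (by rw [dexp_inv, hk])

theorem Val.det {M : Matrix (Fin 3) (Fin 3) ℂ} (hM : MVal 0 M) : Val 0 M.det := by
  rw [Matrix.det_fin_three]
  have h : ∀ {a b c}, Val 0 a → Val 0 b → Val 0 c → Val 0 (a * b * c) := fun ha hb hc => by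
    simpa using (ha.mul hb).mul hc
  have h' := fun i j k l m n => h (hM i j) (hM k l) (hM m n)
  exact (((((h' _ _ _ _ _ _).sub (h' _ _ _ _ _ _)).sub (h' _ _ _ _ _ _)).add
    (h' _ _ _ _ _ _)).add (h' _ _ _ _ _ _)).sub (h' _ _ _ _ _ _)

theorem det_mul_star (g : Γ) : (mat g).det * star (mat g).det = 1 := by
  have h := congrArg Matrix.det (mat_mul_star g)
  rwa [Matrix.det_mul, Matrix.star_eq_conjTranspose, Matrix.det_conjTranspose,
    Matrix.det_one] at h

theorem det_mem_OEinv3 (g : Γ) : (mat g).det ∈ OEinv3 := by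
  rw [Matrix.det_fin_three]
  have h' := fun i j k l m n => OEinv3.mul_mem (OEinv3.mul_mem (g.2 i j) (g.2 k l)) (g.2 m n)
  exact OEinv3.sub_mem (OEinv3.add_mem (OEinv3.add_mem (OEinv3.sub_mem (OEinv3.sub_mem
    (h' _ _ _ _ _ _) (h' _ _ _ _ _ _)) (h' _ _ _ _ _ _)) (h' _ _ _ _ _ _)) (h' _ _ _ _ _ _))
    (h' _ _ _ _ _ _)

/-- An element of absolute value one in `ℤ[ζ₉, 1/3]` is integral at `π`. -/
theorem val_of_mul_star {x : ℂ} (hx : x ∈ OEinv3) (h : x * star x = 1) : Val 0 x := by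
  obtain ⟨k, hk⟩ := exists_three_pow_mul_mem hx
  have h1 := val_of_three_pow hk
  by_contra h0
  have hex : ∃ n : ℕ, Val (-n) x := ⟨6 * k, by simpa using h1⟩
  classical
  have hs := Nat.find_spec hex
  have hpos : 0 < Nat.find hex := by
    rw [Nat.pos_iff_ne_zero]
    intro h2
    rw [h2] at hs
    exact h0 (by simpa using hs)
  have hm : ¬ Val (-((Nat.find hex - 1 : ℕ) : ℤ)) x := Nat.find_min hex (by omega)
  set n := Nat.find hex
  -- With the least `n`, necessarily positive, `π ^ n x` is a unit at `π`, and so is its norm; but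
  -- the norm equals that of `π ^ n`, which is divisible by `π`.
  have hu : Val 0 (piE ^ n * x) := by
    have := (Val.shift (n : ℤ)).mpr hs
    simpa using this
  have hu' : ¬ Val 1 (piE ^ n * x) := by
    intro h2
    apply hm
    have : Val ((n : ℤ) + (-((n - 1 : ℕ) : ℤ))) (piE ^ (n : ℤ) * x) := by
      rw [zpow_natCast]
      exact h2.mono (by lia)
    exact Val.shift _ |>.mp this
  apply not_val_mul hu hu' (mt val_star_iff.mp hu')
  have e : piE ^ n * x * star (piE ^ n * x) = piE ^ n * star (piE ^ n) := by
    rw [star_mul']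
    linear_combination piE ^ n * star (piE ^ n) * h
  rw [e]
  exact (val_pow n).mul' (val_pow n).conj (by lia)

theorem val_det (g : Γ) : Val 0 (mat g).det := val_of_mul_star (det_mem_OEinv3 g) (det_mul_star g)

/-- For unitary `g` the adjugate is `det g` times `g*`, and the determinant is integral at `π`. -/
theorem mval_adjugate (g : Γ) : MVal (-dexp g) (mat g).adjugate := by
  have h : (mat g).adjugate = (mat g).det • star (mat g) := by
    calc (mat g).adjugate = (mat g).adjugate * (mat g * star (mat g)) := by
          rw [mat_mul_star, mul_one]
      _ = _ := by rw [← mul_assoc, Matrix.adjugate_mul, smul_mul_assoc, one_mul]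
  rw [h]
  exact MVal.smul (val_det g) (dexp_spec g).star (by lia)

/-- The `2 × 2` minors have no larger denominators than the entries. -/
theorem val_minor (g : Γ) (i j a b : Fin 3) :
    Val (-dexp g) (mat g i a * mat g j b - mat g i b * mat g j a) := by
  have hadj := mval_adjugate g
  rw [Matrix.adjugate_fin_three] at hadj
  have H : ∀ i j : Fin 3, i < j → ∀ a b : Fin 3, a < b →
      Val (-dexp g) (mat g i a * mat g j b - mat g i b * mat g j a) := by
    have hp : ∀ i j : Fin 3, i < j → (i = 0 ∧ j = 1) ∨ (i = 0 ∧ j = 2) ∨ (i = 1 ∧ j = 2) := by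
      decide
    have key : ∀ (p q : Fin 3) (x : ℂ), (Matrix.adjugate (mat g) p q = x ∨
        Matrix.adjugate (mat g) p q = -x) → Val (-dexp g) x := by
      rintro p q x (h | h)
      · rw [← h]; exact mval_adjugate g p q
      · rw [← neg_neg x, ← h]; exact (mval_adjugate g p q).neg
    intro i j hij a b hab
    rw [Matrix.adjugate_fin_three] at key
    rcases hp i j hij with h | h | h <;> obtain ⟨rfl, rfl⟩ := h <;>
      rcases hp a b hab with h | h | h <;> obtain ⟨rfl, rfl⟩ := h
    · exact key 2 2 _ (by simp)
    · refine key 1 2 _ (Or.inr ?_); simp; ring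
    · exact key 0 2 _ (by simp)
    · refine key 2 1 _ (Or.inr ?_); simp; ring
    · exact key 1 1 _ (by simp)
    · refine key 0 1 _ (Or.inr ?_); simp; ring
    · exact key 2 0 _ (by simp)
    · refine key 1 0 _ (Or.inr ?_); simp; ring
    · exact key 0 0 _ (by simp)
  have H2 : ∀ i j : Fin 3, i < j → ∀ a b : Fin 3,
      Val (-dexp g) (mat g i a * mat g j b - mat g i b * mat g j a) := by
    intro i j hij a b
    rcases lt_trichotomy a b with h | rfl | h
    · exact H i j hij a b h
    · rw [sub_self]; exact Val.zero _
    · have := (H i j hij b a h).neg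
      rwa [neg_sub] at this
  rcases lt_trichotomy i j with h | rfl | h
  · exact H2 i j h a b
  · rw [mul_comm, sub_self]; exact Val.zero _
  · have := (H2 j i h a b).neg
    convert this using 1
    ring

/-- An isotropic vector modulo `π` has only units or only nonunits as coordinates. -/
theorem not_val_of_isotropic {v : Fin 3 → ℂ} (hv : ∀ i, Val 0 (v i))
    (h : Val 1 (v 0 * star (v 0) + v 1 * star (v 1) + v 2 * star (v 2))) {i : Fin 3}
    (hi : ¬ Val 1 (v i)) (j : Fin 3) : ¬ Val 1 (v j) := by
  choose n hn hn' using fun i => (hv i).residue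
  -- Integers represent all residues, so conjugation is trivial modulo `π` and each norm reduces to
  -- a square, `0` or `1`. Three of these sum to a multiple of `3` only if they are all equal.
  have hsq : ∀ i, Val 1 (v i * star (v i) - ((n i ^ 2 : ℤ) : ℂ)) := by
    intro i
    have h1 := (hn' i).conj
    rw [star_sub, Complex.star_def, map_intCast, ← Complex.star_def] at h1
    have h2 := ((hn' i).mul' (hv i).conj (k := 1) (by norm_num)).add
      ((val_int (n i)).mul' h1 (k := 1) (by norm_num))
    convert h2 using 1
    push_cast
    ring
  have hs : Val 1 ((n 0 ^ 2 + n 1 ^ 2 + n 2 ^ 2 : ℤ) : ℂ) := by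
    have := h.sub (((hsq 0).add (hsq 1)).add (hsq 2))
    convert this using 1
    push_cast
    ring
  rw [val_one_int_iff] at hs
  have hiff : ∀ i, Val 1 (v i) ↔ n i = 0 := by
    intro i
    constructor
    · intro hvi
      rcases hn i with h0 | h0
      · exact h0
      · exact absurd hvi (not_val_one_of_unit_sign h0 (hn' i))
    · intro h0
      have := hn' i
      rw [h0] at this
      simpa using this
  have hall : ∀ i, n i = 0 ∨ n i ^ 2 = 1 := by
    intro i
    rcases hn i with h0 | h0 | h0 <;> simp [h0]
  rw [hiff] at hi ⊢
  intro hj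
  apply hi
  have hz : ∀ i, n i = 0 ↔ n i ^ 2 = 0 := fun i => by simp
  rw [hz] at hj ⊢
  have h0 := hall 0
  have h1 := hall 1
  have h2 := hall 2
  simp only [hz] at h0 h1 h2
  fin_cases i <;> fin_cases j <;> simp only [Fin.zero_eta, Fin.mk_one, Fin.reduceFinMk] at * <;>
    omega

/-! ## Distances in the tree: the lower bound -/

/-- The matrix of an element of `GL₃(E)`. -/
abbrev glmat (g : GLE) : Matrix (Fin 3) (Fin 3) ℂ := ((g : GL (Fin 3) ℂ) : Matrix (Fin 3) (Fin 3) ℂ)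

theorem glmat_mul (g h : GLE) : glmat (g * h) = glmat g * glmat h := rfl

theorem glmat_inv_mul (g : GLE) : glmat g⁻¹ * glmat g = 1 := by
  rw [← glmat_mul, inv_mul_cancel]; rfl

theorem glmat_mul_inv (g : GLE) : glmat g * glmat g⁻¹ = 1 := by
  rw [← glmat_mul, mul_inv_cancel]; rfl

theorem glmat_toGLE (g : Γ) : glmat (toGLE g) = mat g := rfl

theorem mval_of_GLsub {k : GL (Fin 3) ℂ} (hk : k ∈ GLsub Opi) :
    MVal 0 (k : Matrix (Fin 3) (Fin 3) ℂ) := fun i j => val_zero_iff.mpr (hk.1 i j)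

/-- The vertex `v` is represented by a lattice `L` with `π ^ l 𝒪³ ⊆ L ⊆ 𝒪³`. -/
def Near (l : ℤ) (v : BVertex) : Prop :=
  ∃ g : GLE, (g : BVertex) = v ∧ ∃ c : ℂ, c ≠ 0 ∧ MVal 0 (c • glmat g) ∧
    MVal (-l) (c⁻¹ • glmat g⁻¹)

/-- A change of representative in `E^× GL₃(𝒪)` only alters the scalar `c`, so nearness can be tested
on any representative. -/
theorem Near.rep {l : ℤ} {g : GLE} (h : Near l g) : ∃ c : ℂ, c ≠ 0 ∧ MVal 0 (c • glmat g) ∧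
    MVal (-l) (c⁻¹ • glmat g⁻¹) := by
  obtain ⟨g', hg', c, hc, h1, h2⟩ := h
  have hk := QuotientGroup.eq.mp hg'
  obtain ⟨d, hd, hd0, k, hk, hdk⟩ := hk
  have hg : glmat g = d • (glmat g' * (k : Matrix (Fin 3) (Fin 3) ℂ)) := by
    rw [← Matrix.mul_smul, ← hdk]
    change glmat g = glmat (g' * (g'⁻¹ * g))
    rw [mul_inv_cancel_left]
  have hgi : glmat g⁻¹ =
      d⁻¹ • (((k⁻¹ : GL (Fin 3) ℂ) : Matrix (Fin 3) (Fin 3) ℂ) * glmat g'⁻¹) := by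
    refine (left_inv_eq_right_inv ?_ (glmat_mul_inv g)).symm
    rw [hg, smul_mul_smul_comm, inv_mul_cancel₀ hd0, one_smul, Matrix.mul_assoc,
      ← Matrix.mul_assoc (glmat g'⁻¹), glmat_inv_mul, Matrix.one_mul, Units.inv_mul]
  refine ⟨c / d, div_ne_zero hc hd0, ?_, ?_⟩
  · rw [hg, smul_smul, div_mul_cancel₀ _ hd0, ← Matrix.smul_mul]
    exact h1.mul (mval_of_GLsub hk) (by norm_num)
  · rw [hgi, smul_smul, inv_div, div_mul_eq_mul_div, mul_inv_cancel₀ hd0, one_div,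
      ← Matrix.mul_smul]
    exact (mval_of_GLsub (inv_mem hk)).mul h2 (by simp)

/-- The sum `a + b` is insensitive to scaling the two lattices; after rescaling by `π ^ (-a)` the
inner radius loses at most one. -/
theorem Near.step {l a b : ℤ} {g g' : GLE} (h : Near l g) (h1 : MVal a (glmat (g⁻¹ * g')))
    (h2 : MVal b (glmat (g'⁻¹ * g))) (hab : -1 ≤ a + b) : Near (l + 1) g' := by
  obtain ⟨c, hc, hc1, hc2⟩ := h.rep
  refine ⟨g', rfl, c * piE ^ (-a), mul_ne_zero hc (zpow_ne_zero _ piE_ne_zero), ?_, ?_⟩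
  · have e : glmat g' = glmat g * glmat (g⁻¹ * g') := by
      rw [← glmat_mul, mul_inv_cancel_left]
    rw [e, mul_smul, smul_comm, ← Matrix.smul_mul]
    exact MVal.smul (val_zpow (-a)) (hc1.mul h1 le_rfl) (by lia)
  · have e : glmat g'⁻¹ = glmat (g'⁻¹ * g) * glmat g⁻¹ := by
      rw [← glmat_mul, mul_inv_cancel_right]
    rw [e, mul_inv, mul_comm, mul_smul, ← Matrix.mul_smul, ← _root_.zpow_neg, neg_neg]
    exact MVal.smul (val_zpow a) (h2.mul hc2 le_rfl) (by lia)

theorem mval_of_lattice_le {g h : GLE} {n : ℕ}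
    (hsub : (fun v => piE ^ n • v) '' lattice g ⊆ lattice h) : MVal (-n) (glmat (h⁻¹ * g)) := by
  intro i j
  have hmem : piE ^ n • (glmat g *ᵥ Pi.single j 1) ∈ lattice h := by
    apply hsub
    refine ⟨_, ⟨Pi.single j 1, fun i => ?_, rfl⟩, rfl⟩
    by_cases hij : i = j
    · subst hij; simp
    · simp [hij]
  obtain ⟨x, hx, hxe⟩ := hmem
  have h2 := congrArg (fun v => glmat h⁻¹ *ᵥ v) hxe
  simp only [Matrix.mulVec_smul, Matrix.mulVec_mulVec] at h2
  rw [← glmat_mul] at h2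
  have h3 := congrFun h2 i
  rw [show ((h : GL (Fin 3) ℂ) : Matrix (Fin 3) (Fin 3) ℂ) = glmat h from rfl, glmat_inv_mul,
    Matrix.one_mulVec] at h3
  simp only [Pi.smul_apply, smul_eq_mul, Matrix.mulVec_single_one, Matrix.col_apply] at h3
  have h4 : Val 0 (piE ^ n * glmat (h⁻¹ * g) i j) := by rw [h3, val_zero_iff]; exact hx i
  have := (Val.shift (n := -n) (n : ℤ) (x := glmat (h⁻¹ * g) i j)).mp
  rw [zpow_natCast, add_neg_cancel] at this
  exact this h4

/-- For two lattices `L ⊆ L'` of a chain also `π L' ⊆ L`: one transition matrix is integral and the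
other has at most a simple pole. -/
theorem IsChain.mval {x : Fin 3 → BVertex} (h : IsChain (x 0) (x 1) (x 2)) (p q : Fin 3) :
    ∃ g g' : GLE, (g : BVertex) = x p ∧ (g' : BVertex) = x q ∧ ∃ a b : ℤ, -1 ≤ a + b ∧
      MVal a (glmat (g⁻¹ * g')) ∧ MVal b (glmat (g'⁻¹ * g)) := by
  obtain ⟨g₁, g₂, g₃, h₁, h₂, h₃, h31, h12, h23⟩ := h
  have hid : ∀ g h : GLE, lattice g ⊆ lattice h → MVal 0 (glmat (h⁻¹ * g)) := by
    intro g h hs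
    have := mval_of_lattice_le (g := g) (h := h) (n := 0) (by simpa using hs)
    simpa using this
  have hpi : ∀ g h : GLE, (fun v => piE • v) '' lattice g ⊆ lattice h →
      MVal (-1) (glmat (h⁻¹ * g)) := by
    intro g h hs
    have := mval_of_lattice_le (g := g) (h := h) (n := 1) (by simpa using hs)
    simpa using this
  have key : ∀ (g h : GLE) (p q : Fin 3), (g : BVertex) = x p → (h : BVertex) = x q →
      lattice g ⊆ lattice h → (fun v => piE • v) '' lattice h ⊆ lattice g →
      (∃ g g' : GLE, (g : BVertex) = x p ∧ (g' : BVertex) = x q ∧ ∃ a b : ℤ, -1 ≤ a + b ∧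
        MVal a (glmat (g⁻¹ * g')) ∧ MVal b (glmat (g'⁻¹ * g))) ∧
      (∃ g g' : GLE, (g : BVertex) = x q ∧ (g' : BVertex) = x p ∧ ∃ a b : ℤ, -1 ≤ a + b ∧
        MVal a (glmat (g⁻¹ * g')) ∧ MVal b (glmat (g'⁻¹ * g))) :=
    fun g h p q hp hq h1 h2 => ⟨⟨g, h, hp, hq, -1, 0, by norm_num, hpi _ _ h2, hid _ _ h1⟩,
      ⟨h, g, hq, hp, 0, -1, by norm_num, hid _ _ h1, hpi _ _ h2⟩⟩
  have k01 := key g₁ g₂ 0 1 h₁ h₂ h12.subset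
    ((Set.image_mono h23.subset).trans h31.subset)
  have k12 := key g₂ g₃ 1 2 h₂ h₃ h23.subset (h31.subset.trans h12.subset)
  have k02 := key g₁ g₃ 0 2 h₁ h₃ (h12.subset.trans h23.subset) h31.subset
  have k : ∀ p : Fin 3, ∃ g g' : GLE, (g : BVertex) = x p ∧ (g' : BVertex) = x p ∧ ∃ a b : ℤ,
      -1 ≤ a + b ∧ MVal a (glmat (g⁻¹ * g')) ∧ MVal b (glmat (g'⁻¹ * g)) := by
    intro p
    obtain ⟨g, hg⟩ := QuotientGroup.mk_surjective (x p)
    refine ⟨g, g, hg, hg, 0, 0, by norm_num, ?_, ?_⟩ <;>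
    · rw [glmat_mul, glmat_inv_mul]; exact mval_one
  fin_cases p <;> fin_cases q
  exacts [k 0, k01.1, k02.1, k01.2, k 1, k12.1, k02.2, k12.2, k 2]

theorem Near.triangle {l : ℤ} {v : Fin 3 → BVertex} (hv : IsTriangle v) {i : Fin 3}
    (h : Near l (v i)) (j : Fin 3) : Near (l + 1) (v j) := by
  obtain ⟨σ, hσ⟩ := hv
  obtain ⟨g, g', hg, hg', a, b, hab, h1, h2⟩ :=
    IsChain.mval (x := fun p => v (σ p)) hσ (σ.symm i) (σ.symm j)
  simp only [Equiv.apply_symm_apply] at hg hg'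
  rw [← hg] at h
  rw [← hg']
  exact h.step h1 h2 hab

/-- The version of `Near` for the vertices of the tree. -/
def TNear (l : ℤ) : TVertex → Prop
  | Sum.inl v => Near l v.1
  | Sum.inr e => ∀ x ∈ e.1, Near l x

theorem tree_adj_inl_inr {v : LVertex} {e : RVertex} (h : tree.Adj (Sum.inl v) (Sum.inr e)) :
    ∃ x, e.1 = s(x, sharp x) ∧ IsTriangle ![v.1, x, sharp x] := by
  rw [tree, SimpleGraph.fromRel_adj] at h
  exact h.2.resolve_right id

/-- The fixed vertex and both ends of the reflected edge lie in one triangle. A midpoint counts as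
near when both ends are, so one tree edge costs a single building step. -/
theorem TNear.step {l : ℤ} {a b : TVertex} (hab : tree.Adj a b) (h : TNear l a) :
    TNear (l + 1) b := by
  rcases a with v | e <;> rcases b with w | f
  · rw [tree, SimpleGraph.fromRel_adj] at hab
    exact absurd hab.2 (by simp)
  · obtain ⟨x, hx, ht⟩ := tree_adj_inl_inr hab
    intro y hy
    rw [hx, Sym2.mem_iff] at hy
    have h' : Near l (![v.1, x, sharp x] 0) := h
    rcases hy with rfl | rfl
    · exact h'.triangle ht 1
    · exact h'.triangle ht 2
  · obtain ⟨x, hx, ht⟩ := tree_adj_inl_inr hab.symm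
    have h' : Near l (![w.1, x, sharp x] 1) := h x (by rw [hx]; exact Sym2.mem_mk_left _ _)
    exact h'.triangle ht 0
  · rw [tree, SimpleGraph.fromRel_adj] at hab
    exact absurd hab.2 (by simp)

theorem TNear.walk {a b : TVertex} (w : tree.Walk a b) {l : ℤ} (h : TNear l a) :
    TNear (l + w.length) b := by
  induction w generalizing l with
  | nil => simpa using h
  | cons hab w ih =>
    have := ih (h.step hab)
    rw [SimpleGraph.Walk.length_cons]
    convert this using 1
    push_cast
    ring

/-- Since `g⁻¹ = g*`, the scalar `c` cancels in the product of an entry of `c g` with the transposed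
entry of `c⁻¹ g⁻¹`. This leaves the norm of an entry of `g`, of exact valuation `-2 * dexp g` for
the right entry. -/
theorem two_mul_dexp_le_of_near {g : Γ} {l : ℤ} (h : Near l (toGLE g)) : 2 * dexp g ≤ l := by
  obtain ⟨c, hc, h1, h2⟩ := h.rep
  obtain ⟨i, j, hij⟩ := exists_not_val g
  have hs := dexp_spec g i j
  have hu : Val 0 (piE ^ (dexp g : ℤ) * mat g i j) := by
    have := (Val.shift (dexp g : ℤ)).mpr hs
    rwa [add_neg_cancel] at this
  have hu' : ¬ Val 1 (piE ^ (dexp g : ℤ) * mat g i j) := by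
    have := (Val.shift (n := 1 - dexp g) (dexp g : ℤ) (x := mat g i j)).not.mpr hij
    rwa [add_sub_cancel] at this
  have e2 : glmat (toGLE g)⁻¹ = star (mat g) := rfl
  have h3 : Val (-l) (mat g i j * star (mat g i j)) := by
    have := (h1 i j).mul' (h2 j i) (k := -l) (by simp)
    rw [e2, glmat_toGLE, Matrix.smul_apply, Matrix.smul_apply, Matrix.star_apply, smul_eq_mul,
      smul_eq_mul] at this
    convert this using 1
    field_simp
  by_contra! hlt
  apply not_val_mul hu hu' (mt val_star_iff.mp hu')
  have h4 := ((val_pow (dexp g)).mul (val_pow (dexp g)).conj).mul' h3 (k := 1) (by lia)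
  convert h4 using 1
  rw [star_mul', zpow_natCast]
  ring

theorem two_mul_dexp_le_length {g : Γ} (w : tree.Walk (orbitVertex 1) (orbitVertex g)) :
    2 * dexp g ≤ w.length := by
  have h0 : TNear 0 (orbitVertex 1) := by
    refine ⟨toGLE 1, rfl, 1, one_ne_zero, ?_, ?_⟩
    · rw [one_smul]; exact mval_one
    · rw [inv_one, one_smul, neg_zero, map_one, inv_one]; exact mval_one
  have h1 := two_mul_dexp_le_of_near (TNear.walk w h0)
  lia

/-! ## Distances in the tree: the upper bound -/

theorem det_mem_of_mem {S : Type*} [SetLike S ℂ] [SubringClass S ℂ] (A : S)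
    {M : Matrix (Fin 3) (Fin 3) ℂ} (hM : ∀ i j, M i j ∈ A) : M.det ∈ A := by
  rw [Matrix.det_fin_three]
  have h' := fun i j k l m n => mul_mem (mul_mem (hM i j) (hM k l)) (hM m n)
  exact sub_mem (add_mem (add_mem (sub_mem (sub_mem (h' _ _ _ _ _ _) (h' _ _ _ _ _ _))
    (h' _ _ _ _ _ _)) (h' _ _ _ _ _ _)) (h' _ _ _ _ _ _)) (h' _ _ _ _ _ _)

theorem exists_GLsub (A : Subring ℂ) {M : Matrix (Fin 3) (Fin 3) ℂ} (hM : ∀ i j, M i j ∈ A)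
    (h0 : M.det ≠ 0) (hd : M.det⁻¹ ∈ A) :
    ∃ k ∈ GLsub A, (k : Matrix (Fin 3) (Fin 3) ℂ) = M := by
  refine ⟨Matrix.GeneralLinearGroup.mkOfDetNeZero M h0, ⟨hM, fun i j => ?_⟩, rfl⟩
  rw [Matrix.coe_units_inv]
  change M⁻¹ i j ∈ A
  rw [Matrix.inv_def, Ring.inverse_eq_inv', Matrix.smul_apply, smul_eq_mul,
    Matrix.adjugate_apply]
  refine A.mul_mem hd (det_mem_of_mem A fun a b => ?_)
  rw [Matrix.updateRow_apply]
  split_ifs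
  · rw [Pi.single_apply]
    split_ifs
    · exact A.one_mem
    · exact A.zero_mem
  · exact hM a b

theorem exists_GLE {M : Matrix (Fin 3) (Fin 3) ℂ} (hM : ∀ i j, M i j ∈ E)
    (h0 : M.det ≠ 0) : ∃ g : GLE, glmat g = M := by
  obtain ⟨k, hk, h⟩ := exists_GLsub E.toSubring hM h0 (E.inv_mem (det_mem_of_mem E hM))
  exact ⟨⟨k, hk⟩, h⟩

theorem mem_Ktilde {g : GLE} (h : MVal 0 (glmat g)) (hd : Val 0 (glmat g).det⁻¹) : g ∈ Ktilde := by
  have h0 : (glmat g).det ≠ 0 := (Matrix.isUnit_iff_isUnit_det _).mp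
    (g : GL (Fin 3) ℂ).isUnit |>.ne_zero
  obtain ⟨k, hk, hkg⟩ := exists_GLsub Opi (fun i j => val_zero_iff.mp (h i j)) h0
    (val_zero_iff.mp hd)
  exact ⟨1, E.one_mem, one_ne_zero, k, hk, by rw [hkg, one_smul]⟩

theorem sharp_eq {g h : GLE} (hm : MVal 0 (star (glmat g) * glmat h))
    (hd : Val 0 (star (glmat g) * glmat h).det⁻¹) : sharp (g : BVertex) = h := by
  change ((sharpGL g : GLE) : BVertex) = h
  refine QuotientGroup.eq.mpr (mem_Ktilde ?_ ?_)
  all_goals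
    have e : glmat ((sharpGL g)⁻¹ * h) = star (glmat g) * glmat h := by
      rw [glmat_mul]
      congr 1
    rw [e]
    assumption

theorem piE_mem_E : piE ∈ E := OE_le_E piE_mem_OE

/-- The diagonal matrix of powers of `π`. -/
def Dpi (a : Fin 3 → ℤ) : Matrix (Fin 3) (Fin 3) ℂ := Matrix.diagonal fun i => piE ^ a i

theorem det_Dpi (a : Fin 3 → ℤ) : (Dpi a).det = piE ^ (a 0 + a 1 + a 2) := by
  rw [Dpi, Matrix.det_diagonal, Fin.prod_univ_three, zpow_add₀ piE_ne_zero, zpow_add₀ piE_ne_zero]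

section Apartment

variable (k : GLE)

/-- The lattice basis `k` scaled by powers of `π`. -/
def apt (a : Fin 3 → ℤ) : GLE :=
  k * (exists_GLE (M := Dpi a) (fun i j => by
    rw [Dpi, Matrix.diagonal_apply]
    split_ifs
    · exact E.zpow_mem piE_mem_E _
    · exact E.zero_mem) (by rw [det_Dpi]; exact zpow_ne_zero _ piE_ne_zero)).choose

theorem glmat_apt (a : Fin 3 → ℤ) : glmat (apt k a) = glmat k * Dpi a := by
  rw [apt, glmat_mul, Exists.choose_spec (p := fun g : GLE => glmat g = Dpi a)]

theorem mem_lattice_apt {a : Fin 3 → ℤ} {v : Fin 3 → ℂ} :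
    v ∈ lattice (apt k a) ↔ ∃ y : Fin 3 → ℂ, (∀ i, Val (a i) (y i)) ∧ v = glmat k *ᵥ y := by
  have e : ((apt k a : GL (Fin 3) ℂ) : Matrix (Fin 3) (Fin 3) ℂ) = glmat k * Dpi a := glmat_apt k a
  constructor
  · rintro ⟨x, hx, rfl⟩
    refine ⟨Dpi a *ᵥ x, fun i => ?_, by rw [e, Matrix.mulVec_mulVec]⟩
    rw [Dpi, Matrix.mulVec_diagonal]
    exact (val_zpow _).mul' (val_zero_iff.mpr (hx i)) (by simp)
  · rintro ⟨y, hy, rfl⟩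
    refine ⟨fun i => y i * piE ^ (-a i), hy, ?_⟩
    rw [e, ← Matrix.mulVec_mulVec]
    congr 1
    funext i
    rw [Dpi, Matrix.mulVec_diagonal, mul_comm, mul_assoc, ← zpow_add₀ piE_ne_zero]
    simp

theorem piE_lattice_apt (a : Fin 3 → ℤ) :
    (fun v => piE • v) '' lattice (apt k a) = lattice (apt k (fun i => a i + 1)) := by
  ext v
  simp only [Set.mem_image, mem_lattice_apt]
  constructor
  · rintro ⟨_, ⟨y, hy, rfl⟩, rfl⟩
    refine ⟨piE • y, fun i => ?_, by rw [Matrix.mulVec_smul]⟩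
    exact (val_mul_piE_iff rfl).mpr (hy i)
  · rintro ⟨y, hy, rfl⟩
    refine ⟨_, ⟨piE⁻¹ • y, fun i => ?_, rfl⟩, ?_⟩
    · refine (val_mul_piE_iff rfl).mp ?_
      rw [Pi.smul_apply, smul_eq_mul, mul_inv_cancel_left₀ piE_ne_zero]
      exact hy i
    · rw [Matrix.mulVec_smul, smul_inv_smul₀ piE_ne_zero]

theorem lattice_apt_ssubset {a b : Fin 3 → ℤ} (h : b < a) :
    lattice (apt k a) ⊂ lattice (apt k b) := by
  obtain ⟨hle, i, hi⟩ := Pi.lt_def.mp h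
  rw [Set.ssubset_iff_subset_ne]
  constructor
  · intro v
    simp only [mem_lattice_apt]
    rintro ⟨y, hy, rfl⟩
    exact ⟨y, fun i => (hy i).mono (hle i), rfl⟩
  · intro heq
    have hmem : glmat k *ᵥ Pi.single i (piE ^ b i) ∈ lattice (apt k b) := by
      refine (mem_lattice_apt k).mpr ⟨_, fun j => ?_, rfl⟩
      by_cases hj : j = i
      · subst hj; rw [Pi.single_eq_same]; exact val_zpow _
      · rw [Pi.single_eq_of_ne hj]; exact Val.zero _
    rw [← heq, mem_lattice_apt] at hmem
    obtain ⟨y, hy, hye⟩ := hmem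
    have h2 := congrArg (fun v => glmat k⁻¹ *ᵥ v) hye
    simp only [Matrix.mulVec_mulVec, glmat_inv_mul, Matrix.one_mulVec] at h2
    have h3 := hy i
    rw [← h2, Pi.single_eq_same] at h3
    have h4 := (Val.shift (-b i)).mpr (h3.mono (show b i + 1 ≤ a i from hi))
    rw [← zpow_add₀ piE_ne_zero, neg_add_cancel, zpow_zero, neg_add_cancel_left] at h4
    exact not_val_one_one h4

theorem isChain_apt {a b c : Fin 3 → ℤ} (hab : b < a) (hbc : c < b) (hca : a < fun i => c i + 1) :
    IsChain (apt k a) (apt k b) (apt k c) :=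
  ⟨_, _, _, rfl, rfl, rfl, by rw [piE_lattice_apt]; exact lattice_apt_ssubset k hca,
    lattice_apt_ssubset k hab, lattice_apt_ssubset k hbc⟩

/-- The involution is lattice duality for the Hermitian form. The two scaled lattices are dual once
their cross Gram matrix is in `GL₃(𝒪)`: `hn` makes it integral and `hs` makes its determinant a
unit. -/
theorem sharp_apt {a b : Fin 3 → ℤ} {n : Fin 3 → Fin 3 → ℤ}
    (hG : ∀ i j, Val (n i j) ((star (glmat k) * glmat k) i j))
    (hd : Val 0 (glmat k).det⁻¹) (hn : ∀ i j, 0 ≤ n i j + a i + b j)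
    (hs : a 0 + a 1 + a 2 + (b 0 + b 1 + b 2) = 0) :
    sharp (apt k a : BVertex) = apt k b := by
  have e : star (glmat (apt k a)) * glmat (apt k b) =
      star (Dpi a) * (star (glmat k) * glmat k) * Dpi b := by
    rw [glmat_apt, glmat_apt, star_mul]
    simp only [Matrix.mul_assoc]
  apply sharp_eq
  · intro i j
    rw [e, Dpi, Dpi, Matrix.star_eq_conjTranspose (diagonal _), Matrix.diagonal_conjTranspose,
      Matrix.mul_diagonal, Matrix.diagonal_mul]
    exact (((val_zpow (a i)).conj).mul (hG i j)).mul' (val_zpow (b j)) (by linarith [hn i j])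
  · rw [e, Matrix.det_mul, Matrix.det_mul, Matrix.det_mul, Matrix.star_eq_conjTranspose,
      Matrix.star_eq_conjTranspose, Matrix.det_conjTranspose, Matrix.det_conjTranspose, det_Dpi,
      det_Dpi, mul_inv, mul_inv, mul_inv, ← star_inv₀, ← star_inv₀, ← _root_.zpow_neg,
      ← _root_.zpow_neg]
    exact ((val_zpow _).conj.mul (hd.conj.mul hd)).mul' (val_zpow _) (by lia)

end Apartment

/-! ### The path from the base vertex to its translate -/

/-- A lattice basis adapted to the isotropic vector `r`. -/
def isoBasis (r : Fin 3 → ℂ) : Matrix (Fin 3) (Fin 3) ℂ :=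
  !![r 0, -star (r 1), 1; r 1, star (r 0), 0; r 2, 0, 0]

theorem det_isoBasis (r : Fin 3 → ℂ) : (isoBasis r).det = -(star (r 0) * r 2) := by
  rw [isoBasis, Matrix.det_fin_three]; simp

/-- The segment of length two from `apt k (-s, 0, s)` to `apt k (-(s+1), 0, s+1)`. -/
theorem exists_walk_two {k : GLE} (s : ℤ) {v w : LVertex}
    (hv : v.1 = apt k ![-s, 0, s]) (hw : w.1 = apt k ![-(s + 1), 0, s + 1])
    (hx : sharp (apt k ![-s, 0, s + 1] : BVertex) = apt k ![-(s + 1), 0, s]) :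
    ∃ p : tree.Walk (Sum.inl v) (Sum.inl w), p.length = 2 := by
  have lt : ∀ {a b : Fin 3 → ℤ}, (∀ i, a i ≤ b i) → (∃ i, a i < b i) → a < b :=
    fun h1 h2 => Pi.lt_def.mpr ⟨h1, h2⟩
  -- The exponents `(-s, 0, s + 1)` and `(-(s + 1), 0, s)` belong to the ends of the reflected edge,
  -- which forms a triangle with each of the two fixed vertices.
  have c1 : IsChain (apt k ![-s, 0, s + 1]) v.1 (apt k ![-(s + 1), 0, s]) := by
    rw [hv]
    refine isChain_apt k (lt ?_ ⟨2, ?_⟩) (lt ?_ ⟨0, ?_⟩) (lt ?_ ⟨1, ?_⟩) <;>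
      first | (intro i; fin_cases i <;> simp) | simp
  have c2 : IsChain (apt k ![-s, 0, s + 1]) w.1 (apt k ![-(s + 1), 0, s]) := by
    rw [hw]
    refine isChain_apt k (lt ?_ ⟨0, ?_⟩) (lt ?_ ⟨2, ?_⟩) (lt ?_ ⟨1, ?_⟩) <;>
      first | (intro i; fin_cases i <;> simp) | simp
  have ht : IsTriangle ![(apt k ![-s, 0, s + 1] : BVertex),
      sharp (apt k ![-s, 0, s + 1] : BVertex), v.1] := by
    refine ⟨Equiv.swap 1 2, ?_⟩
    rw [hx]
    simpa [Equiv.swap_apply_of_ne_of_ne] using c1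
  have ht1 : ∀ u : LVertex, IsChain (apt k ![-s, 0, s + 1]) u.1 (apt k ![-(s + 1), 0, s]) →
      IsTriangle ![u.1, (apt k ![-s, 0, s + 1] : BVertex),
        sharp (apt k ![-s, 0, s + 1] : BVertex)] := by
    intro u hu
    refine ⟨Equiv.swap 0 1, ?_⟩
    rw [hx]
    simpa [Equiv.swap_apply_of_ne_of_ne] using hu
  let e : RVertex := ⟨s((apt k ![-s, 0, s + 1] : BVertex), sharp (apt k ![-s, 0, s + 1] : BVertex)),
    _, _, rfl, ht⟩
  have adj : ∀ u : LVertex, IsChain (apt k ![-s, 0, s + 1]) u.1 (apt k ![-(s + 1), 0, s]) →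
      tree.Adj (Sum.inl u) (Sum.inr e) := by
    intro u hu
    rw [tree, SimpleGraph.fromRel_adj]
    exact ⟨Sum.inl_ne_inr, Or.inl ⟨_, rfl, ht1 u hu⟩⟩
  exact ⟨.cons (adj v c1) (.cons (adj w c2).symm .nil), rfl⟩

/-- The first basis vector has norm in `π ^ (2t) 𝒪`, so it may be divided by `π ^ s` for `s ≤ t`
while the third is multiplied by `π ^ s`, keeping the lattice self-dual. -/
theorem exists_walk_apt {k : GLE} {t : ℕ} {n : Fin 3 → Fin 3 → ℤ}
    (hG : ∀ i j, Val (n i j) ((star (glmat k) * glmat k) i j)) (hd : Val 0 (glmat k).det⁻¹)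
    (hn : n = ![![2 * (t : ℤ), 2 * t, 0], ![2 * (t : ℤ), 0, 0], ![0, 0, 0]]) (s : ℕ) (hs : s ≤ t) {v w : LVertex}
    (hv : v.1 = apt k ![0, 0, 0]) (hw : w.1 = apt k ![-s, 0, s]) :
    ∃ p : tree.Walk (Sum.inl v) (Sum.inl w), p.length = 2 * s := by
  induction s generalizing w with
  | zero =>
    have : v = w := by
      apply Subtype.ext
      rw [hv, hw]
      simp
    subst this
    exact ⟨.nil, rfl⟩
  | succ s ih =>
    have hfix : sharp (apt k ![-s, 0, s] : BVertex) = apt k ![-s, 0, s] := by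
      refine sharp_apt k hG hd (fun i j => ?_) (by simp)
      subst hn
      fin_cases i <;> fin_cases j <;> simp <;> lia
    obtain ⟨p, hp⟩ := ih (by lia) (w := ⟨_, hfix⟩) rfl
    obtain ⟨q, hq⟩ := exists_walk_two (k := k) s (v := ⟨_, hfix⟩) (w := w) rfl
      (by rw [hw]; push_cast; rfl) (by
        refine sharp_apt k hG hd (fun i j => ?_) (by simp)
        subst hn
        fin_cases i <;> fin_cases j <;> simp <;> lia)
    exact ⟨p.append q, by rw [SimpleGraph.Walk.length_append, hp, hq]; ring⟩

theorem exists_walk_orbitVertex (g : Γ) :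
    ∃ p : tree.Walk (orbitVertex 1) (orbitVertex g), p.length = 2 * dexp g := by
  have hmem : ∀ {k : GLE}, MVal 0 (glmat k) → Val 0 (glmat k).det⁻¹ → (1 : GLE) = (k : BVertex) :=
    fun h1 h2 => QuotientGroup.eq.mpr (by rw [inv_one, one_mul]; exact mem_Ktilde h1 h2)
  have hdetg : Val 0 (mat g).det⁻¹ := by
    rw [← eq_inv_of_mul_eq_one_right (det_mul_star g)]
    exact (val_det g).conj
  rcases Nat.eq_zero_or_pos (dexp g) with ht | ht
  · have h1 : orbitVertex 1 = orbitVertex g := by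
      rw [orbitVertex, orbitVertex]
      congr 2
      rw [map_one]
      refine hmem ?_ hdetg
      have := dexp_spec g
      rw [ht, Nat.cast_zero, neg_zero] at this
      exact this
    rw [h1, ht]
    exact ⟨.nil, rfl⟩
  obtain ⟨i₀, j₀, hij⟩ := exists_not_val g
  set t := dexp g with htdef
  set r : Fin 3 → ℂ := fun i => piE ^ (t : ℤ) * mat g i j₀ with hr
  have hr0 : ∀ i, Val 0 (r i) := fun i => by
    have := (Val.shift (t : ℤ)).mpr (dexp_spec g i j₀)
    rwa [add_neg_cancel] at this
  have hri : ¬ Val 1 (r i₀) := by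
    have := (Val.shift (n := 1 - t) (t : ℤ) (x := mat g i₀ j₀)).not.mpr hij
    rwa [add_sub_cancel] at this
  have hnorm : star (r 0) * r 0 + star (r 1) * r 1 + star (r 2) * r 2 =
      star (piE ^ (t : ℤ)) * piE ^ (t : ℤ) := by
    have := col_orth g j₀ j₀
    rw [if_pos rfl] at this
    simp only [hr, star_mul']
    linear_combination star (piE ^ (t : ℤ)) * piE ^ (t : ℤ) * this
  have hnorm' : Val (2 * t) (star (r 0) * r 0 + star (r 1) * r 1 + star (r 2) * r 2) := by
    rw [hnorm]
    exact (val_zpow t).conj.mul' (val_zpow t) (by lia)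
  -- Here `t > 0` is needed: `r` is isotropic modulo `π`, so all its coordinates are units, and with
  -- them the determinant of the adapted basis.
  have hunit := not_val_of_isotropic hr0 (by
    convert hnorm'.mono (show 1 ≤ 2 * (t : ℤ) by lia) using 1; ring) hri
  have hE : ∀ i, r i ∈ E := fun i => E.mul_mem (E.zpow_mem piE_mem_E _) (OEinv3_le_E (g.2 i j₀))
  have hdet : ¬ Val 1 (isoBasis r).det := by
    rw [det_isoBasis]
    intro h
    have := h.neg
    rw [neg_neg] at this
    exact not_val_mul (hr0 0).conj (mt val_star_iff.mp (hunit 0)) (hunit 2) this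
  have hiso : MVal 0 (isoBasis r) := by
    intro i j
    fin_cases i <;> fin_cases j
    exacts [hr0 0, (hr0 1).conj.neg, val_one, hr0 1, (hr0 0).conj, Val.zero 0, hr0 2, Val.zero 0,
      Val.zero 0]
  obtain ⟨k, hk⟩ := exists_GLE (M := isoBasis r) (by
    intro i j
    fin_cases i <;> fin_cases j
    exacts [hE 0, E.neg_mem (star_mem_E (hE 1)), E.one_mem, hE 1, star_mem_E (hE 0), E.zero_mem,
      hE 2, E.zero_mem, E.zero_mem]) (ne_zero_of_not_val hdet)
  have hd : Val 0 (glmat k).det⁻¹ := by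
    rw [hk]; exact (Val.det hiso).inv hdet
  have hG : ∀ i j, Val ((![![2 * t, 2 * t, 0], ![2 * t, 0, 0], ![0, 0, 0]] :
      Fin 3 → Fin 3 → ℤ) i j) ((star (glmat k) * glmat k) i j) := by
    have h0 : MVal 0 (star (isoBasis r) * isoBasis r) := hiso.star.mul hiso (by norm_num)
    rw [hk]
    have e01 : (star (isoBasis r) * isoBasis r) 0 1 = 0 := by
      rw [Matrix.mul_apply, Fin.sum_univ_three]
      simp [isoBasis]
      ring
    have e10 : (star (isoBasis r) * isoBasis r) 1 0 = 0 := by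
      rw [Matrix.mul_apply, Fin.sum_univ_three]
      simp [isoBasis]
      ring
    have e00 : (star (isoBasis r) * isoBasis r) 0 0 =
        star (r 0) * r 0 + star (r 1) * r 1 + star (r 2) * r 2 := by
      rw [Matrix.mul_apply, Fin.sum_univ_three]
      simp [isoBasis]
    intro i j
    fin_cases i <;> fin_cases j
    · exact e00 ▸ hnorm'
    · exact e01 ▸ Val.zero _
    · exact h0 0 2
    · exact e10 ▸ Val.zero _
    exacts [h0 1 1, h0 1 2, h0 2 0, h0 2 1, h0 2 2]
  -- Multiplying the scaled basis by `g*` gives a unit vector, the conjugates of `π ^ t` times `2 ×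
  -- 2` minors of `g`, and `π ^ t` times conjugated entries of `g`. All are integral, and the
  -- determinant is a unit.
  have hgk : (apt k ![-t, 0, t] : BVertex) = toGLE g := by
    refine (QuotientGroup.eq.mpr (mem_Ktilde ?_ ?_)).symm
    all_goals
      have e : glmat ((toGLE g)⁻¹ * apt k ![-t, 0, t]) =
          star (mat g) * (isoBasis r * Dpi ![-t, 0, t]) := by
        rw [glmat_mul, glmat_apt, hk]
        rfl
      rw [e]
    · intro i j
      rw [Matrix.mul_apply, Fin.sum_univ_three, Dpi]
      simp only [Matrix.mul_diagonal, Matrix.star_apply]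
      have hπ : piE ^ t ≠ 0 := pow_ne_zero _ piE_ne_zero
      fin_cases j
      · have h1 := col_orth g i j₀
        have h2 : Val 0 (if i = j₀ then (1 : ℂ) else 0) := by
          split_ifs
          · exact val_one
          · exact Val.zero 0
        rw [← h1] at h2
        convert h2 using 1
        simp [isoBasis, hr]
        field_simp
      · have h1 := ((val_zpow t).mul' (val_minor g 0 1 j₀ i) (k := 0) (by lia)).conj
        convert h1 using 1
        simp [isoBasis, hr]
        ring
      · have h1 := (dexp_spec g 0 i).conj.mul' (val_zpow t) (k := 0) (by lia)
        convert h1 using 1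
        simp [isoBasis]
    · rw [Matrix.det_mul, Matrix.det_mul, det_Dpi, Matrix.star_eq_conjTranspose,
        Matrix.det_conjTranspose, mul_inv, ← star_inv₀, mul_inv, ← hk]
      simpa using hdetg.conj.mul hd
  refine exists_walk_apt (k := k) hG hd rfl (dexp g) le_rfl ?_ ?_
  · change ((toGLE 1 : GLE) : BVertex) = _
    rw [map_one]
    have e : glmat (apt k ![0, 0, 0]) = isoBasis r := by
      rw [glmat_apt, hk, Dpi]
      have : (fun i => piE ^ (![0, 0, 0] : Fin 3 → ℤ) i) = 1 := by
        funext i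
        fin_cases i <;> simp
      rw [this]
      simp
    refine hmem ?_ ?_ <;> rw [e]
    · exact hiso
    · rw [← hk]; exact hd
  · exact hgk.symm

/-- The distance from `g v₀` to `v₀` is twice the denominator exponent of `g`. -/
theorem distV0_eq (g : Γ) : distV0 g = 2 * dexp g := by
  obtain ⟨p, hp⟩ := exists_walk_orbitVertex g
  rw [distV0, SimpleGraph.dist_comm]
  refine le_antisymm (hp ▸ SimpleGraph.dist_le p) ?_
  obtain ⟨q, hq⟩ := (SimpleGraph.Walk.reachable p).exists_walk_length_eq_dist
  rw [← hq]
  exact two_mul_dexp_le_length q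

/-- Nearness with `l = 0` bounds the exponent in one direction; in the other the constructed path
has length zero. -/
theorem mem_C_iff {g : Γ} : g ∈ C ↔ dexp g = 0 := by
  have h : g ∈ C ↔ (toGLE g : BVertex) = (1 : GLE) := by
    rw [C, Subgroup.mem_comap, MulAction.mem_stabilizer_iff, MulAction.Quotient.smul_mk,
      smul_eq_mul, mul_one]
  rw [h]
  constructor
  · intro h1
    have h2 : Near 0 (toGLE g : BVertex) := by
      rw [h1]
      refine ⟨1, rfl, 1, one_ne_zero, ?_, ?_⟩
      · rw [one_smul]; exact mval_one
      · rw [inv_one, one_smul, neg_zero, inv_one]; exact mval_one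
    have := two_mul_dexp_le_of_near h2
    lia
  · intro h0
    obtain ⟨p, hp⟩ := exists_walk_orbitVertex g
    rw [h0] at hp
    have h1 := SimpleGraph.Walk.eq_of_length_eq_zero hp
    have h2 := congrArg Subtype.val (Sum.inl_injective h1)
    change ((toGLE 1 : GLE) : BVertex) = (toGLE g : BVertex) at h2
    rw [← h2, map_one]

/-! ## Descent -/

/-- The diagonal gate with entries `s i * ζ₉ ^ a i`. -/
def diagGate (s : Fin 3 → ℤˣ) (a : Fin 3 → ℤ) : 𝒟 :=
  ⟨⟨Matrix.diagonal fun i => ((s i : ℤ) : ℂ) * ζ₉ ^ a i, by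
    rw [Matrix.mem_unitaryGroup_iff, Matrix.star_eq_conjTranspose, Matrix.diagonal_conjTranspose,
      Matrix.diagonal_mul_diagonal, ← Matrix.diagonal_one]
    congr 1
    funext i
    exact star_unit_mul (s i) (a i)⟩, s, a, rfl⟩

/-- A diagonal gate as an element of `Γ`. -/
abbrev incl (c : 𝒟) : Γ := Subgroup.inclusion 𝒟_le c

theorem mat_diagGate (s : Fin 3 → ℤˣ) (a : Fin 3 → ℤ) :
    mat (incl (diagGate s a)) = Matrix.diagonal fun i => ((s i : ℤ) : ℂ) * ζ₉ ^ a i := rfl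

theorem mat_HΓ : mat HΓ = Hmat := rfl

theorem exists_diagGate (c : 𝒟) : ∃ s a, c = diagGate s a := by
  obtain ⟨⟨c, hc⟩, s, a, h⟩ := c
  exact ⟨s, a, Subtype.ext (Subtype.ext h)⟩

theorem val_ζ₉_zpow (n : ℤ) : Val 0 (ζ₉ ^ n) := val_of_OE (ζ₉_zpow_mem n)

theorem val_ζ₉_zpow_mul {k n : ℤ} {x : ℂ} (h : Val k x) : Val k (ζ₉ ^ n * x) :=
  (val_ζ₉_zpow n).mul' h (by simp)

/-- Used to multiply by a negative power of `ζ₉` without expanding its inverse in powers of `π`. -/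
theorem val_move {k : ℤ} {x y : ℂ} (n : ℤ) (h : Val k (x - ζ₉ ^ n * y)) :
    Val k (ζ₉ ^ (-n) * x - y) := by
  have := val_ζ₉_zpow_mul (n := -n) h
  rwa [mul_sub, ← mul_assoc, ← zpow_add₀ ζ₉_ne_zero, neg_add_cancel, zpow_zero, one_mul] at this

theorem exists_eq_piE_pow_mul {n : ℕ} {x : ℂ} (h : Val n x) : ∃ y, Val 0 y ∧ x = piE ^ n * y := by
  have h0 : piE ^ (n : ℤ) ≠ 0 := zpow_ne_zero _ piE_ne_zero
  refine ⟨piE ^ (-n : ℤ) * x, ?_, ?_⟩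
  · have := (Val.shift (-n : ℤ)).mpr h
    rwa [neg_add_cancel] at this
  · rw [← mul_assoc, ← zpow_natCast, ← zpow_add₀ piE_ne_zero, add_neg_cancel, zpow_zero, one_mul]

/-- Every element congruent to one modulo `π` is a power of `ζ₉` times `1 + b π ^ 2`, modulo
`π ^ 4`. -/
theorem exists_normal_form {Y : ℂ} (hY : Val 0 Y) (h : Val 1 (Y - 1)) :
    ∃ n b : ℤ, Val 4 (ζ₉ ^ n * Y - (1 + b * piE ^ 2)) := by
  have hζ : ζ₉ = 1 - piE := by rw [piE]; ring
  -- Multiplication by `ζ₉ = 1 - π` shifts the coefficient of `π` by `-1`, so one of the exponents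
  -- `0, 1, -1` removes it.
  have step1 : ∃ n : ℤ, Val 2 (ζ₉ ^ n * Y - 1) := by
    obtain ⟨Y₁, hY₁, e⟩ := exists_eq_piE_pow_mul (n := 1) (by exact_mod_cast h)
    obtain ⟨m, hm, hm'⟩ := hY₁.residue
    have key : ∀ z : ℂ, Val 1 z → Val 2 (piE * z) := fun z hz => val_piE.mul' hz (by norm_num)
    rcases hm with rfl | rfl | rfl
    · refine ⟨0, ?_⟩
      have := key _ hm'
      convert this using 1
      rw [zpow_zero, one_mul, e]
      push_cast
      ring
    · refine ⟨1, ?_⟩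
      have := (key _ hm').sub (((val_pow 2).mul' hY₁ (k := 2) (by norm_num)))
      convert this using 1
      rw [zpow_one, hζ]
      push_cast
      linear_combination (1 - piE) * e
    · refine ⟨-1, val_move 1 ?_⟩
      have := key _ hm'
      convert this using 1
      rw [zpow_one, hζ]
      push_cast
      linear_combination e
  obtain ⟨n, hn⟩ := step1
  set Y' := ζ₉ ^ n * Y with hY'
  have hY'0 : Val 0 Y' := val_ζ₉_zpow_mul hY
  obtain ⟨Y₂, hY₂, e₂⟩ := exists_eq_piE_pow_mul (n := 2) (by exact_mod_cast hn)
  obtain ⟨b, -, hb⟩ := hY₂.residue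
  obtain ⟨Y₃, hY₃, e₃⟩ := exists_eq_piE_pow_mul (n := 1) (by exact_mod_cast hb)
  obtain ⟨m, hm, hm'⟩ := hY₃.residue
  -- Modulo `π ^ 4` this is `1 - π ^ 3`, so powers of `ζ₉ ^ 3` remove the cubic coefficient. The
  -- quadratic coefficient `b` is left over.
  have h3 : ζ₉ ^ (3 : ℤ) = (1 - piE) ^ 3 := by
    rw [← hζ, show (3 : ℤ) = ((3 : ℕ) : ℤ) by rfl, zpow_natCast]
  have key : ∀ z : ℂ, Val 1 z → Val 4 (piE ^ 3 * z) :=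
    fun z hz => (val_pow 3).mul' hz (by norm_num)
  have hthree : ∀ z : ℂ, Val 0 z → Val 4 (3 * z) := fun z hz => val_three.mul' hz (by norm_num)
  have hpi : Val 0 piE := val_piE.mono (by norm_num)
  have hadj : ∃ k : ℤ, Val 4 (ζ₉ ^ k * Y' - (1 + b * piE ^ 2)) := by
    rcases hm with rfl | rfl | rfl
    · refine ⟨0, ?_⟩
      have := key _ hm'
      convert this using 1
      rw [zpow_zero, one_mul]
      push_cast
      linear_combination e₂ + piE ^ 2 * e₃
    · refine ⟨3, ?_⟩
      have h1 := (key _ hm').sub (key _ (hn.mono (by norm_num)))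
      have h2 := hthree _ (((hpi.mul' hpi (k := 0) (by norm_num)).sub hpi).mul' hY'0 (k := 0)
        (by norm_num))
      convert h1.add h2 using 1
      rw [h3]
      push_cast
      linear_combination e₂ + piE ^ 2 * e₃
    · refine ⟨-3, val_move 3 ?_⟩
      have h1 := (key _ hm').add ((val_pow 5).mul' (val_int b) (k := 4) (by norm_num))
      have h2 := hthree _ ((hpi.sub (hpi.mul' hpi (k := 0) (by norm_num))).mul'
        (val_one.add ((val_int b).mul' ((val_pow 2)) (k := 0) (by norm_num))) (k := 0)
        (by norm_num))
      convert h1.add h2 using 1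
      rw [h3]
      push_cast
      linear_combination e₂ + piE ^ 2 * e₃
  obtain ⟨k, hk⟩ := hadj
  refine ⟨k + n, b, ?_⟩
  rwa [zpow_add₀ ζ₉_ne_zero, mul_assoc]

theorem exists_unit_normal_form {x : ℂ} (hx : Val 0 x) (hx' : ¬ Val 1 x) :
    ∃ (s : ℤˣ) (n b : ℤ), Val 4 (((s : ℤ) : ℂ) * ζ₉ ^ n * x - (1 + b * piE ^ 2)) := by
  obtain ⟨m, hm, hm'⟩ := hx.residue
  have : ∃ s : ℤˣ, Val 1 (((s : ℤ) : ℂ) * x - 1) := by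
    rcases hm with rfl | rfl | rfl
    · exact absurd (by simpa using hm') hx'
    · exact ⟨1, by simpa using hm'⟩
    · refine ⟨-1, ?_⟩
      convert hm'.neg using 1
      push_cast
      ring
  obtain ⟨s, hs⟩ := this
  obtain ⟨n, b, h⟩ := exists_normal_form ((val_int _).mul' hx (by norm_num)) hs
  refine ⟨s, n, b, ?_⟩
  convert h using 1
  ring

theorem val_one_of_four {b : ℤ} {x : ℂ} (h : Val 4 (x - (1 + b * piE ^ 2))) : Val 1 (x - 1) := by
  have := (h.mono (show (1 : ℤ) ≤ 4 by norm_num)).add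
    ((val_int b).mul' (val_pow 2) (k := 1) (by norm_num))
  convert this using 1
  ring

/-- The conjugate of `π` is `-π` times a unit congruent to one, so `π ^ 2` and its conjugate agree
modulo `π ^ 3` and the coefficient `b` doubles in the norm. -/
theorem val_mul_star_of_four {b : ℤ} {x : ℂ} (h : Val 4 (x - (1 + b * piE ^ 2))) :
    Val 3 (x * star x - (1 + 2 * b * piE ^ 2)) := by
  set e := x - (1 + b * piE ^ 2) with he
  have hx : x = 1 + b * piE ^ 2 + e := by rw [he]; ring
  have hs : star x = 1 + b * star piE ^ 2 + star e := by
    rw [hx, star_add, star_add, star_one, star_mul', star_pow, Complex.star_def, map_intCast]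
  have hsp : Val 3 (star piE ^ 2 - piE ^ 2) := by
    have e1 : star piE = -ζ₉ ^ 8 * piE := by
      rw [piE, star_sub, star_one, star_ζ₉]
      linear_combination -ζ₉_pow
    have e2 : (1 : ℂ) - ζ₉ ^ 8 = -ζ₉ ^ 8 * piE := by
      rw [piE]; linear_combination -ζ₉_pow
    have h1 : Val 0 (-ζ₉ ^ 8 * (-ζ₉ ^ 8 - 1)) :=
      (val_ζ₉_pow 8).neg.mul' ((val_ζ₉_pow 8).neg.sub val_one) (by norm_num)
    have := (val_pow 3).mul' h1 (k := 3) (by norm_num)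
    convert this using 1
    rw [e1]
    linear_combination piE ^ 2 * (-ζ₉ ^ 8 - 1) * e2
  have hb := val_int b
  have hp : Val 2 (piE ^ 2) := val_pow 2
  have hq : Val 2 (star piE ^ 2) := by rw [← star_pow]; exact hp.conj
  have h1 := hb.mul' hsp (k := 3) (by norm_num)
  have h2 := (hb.mul' hp (k := 2) (by norm_num)).mul' (hb.mul' hq (k := 2) (by norm_num)) (k := 3)
    (by norm_num)
  have hs0 : Val 0 (star x) := by
    rw [hs]
    exact (val_one.add ((hb.mul' hq (by norm_num)))).add (h.conj.mono (by norm_num))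
  have h3 := h.mul' hs0 (k := 3) (by norm_num)
  have h4 := (val_one.add ((hb.mul' hp (k := 0) (by norm_num)))).mul' h.conj (k := 3) (by norm_num)
  convert ((h1.add h2).add h3).add h4 using 1
  rw [hs]
  linear_combination (1 + b * star piE ^ 2 + star e) * hx

/-- Divide by `v 0` and bring the other two quotients to the form `1 + b π ^ 2` and `1 + b' π ^ 2`.
The norm condition says exactly that `b + b'` vanishes modulo `3`, which is also what the sum of the
coordinates needs. -/
theorem exists_row_descent {v : Fin 3 → ℂ} (hv : ∀ i, Val 0 (v i)) (hv' : ∀ i, ¬ Val 1 (v i))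
    (hn : Val 3 (v 0 * star (v 0) + v 1 * star (v 1) + v 2 * star (v 2))) :
    ∃ (s : Fin 3 → ℤˣ) (a : Fin 3 → ℤ),
      Val 4 (∑ i, ((s i : ℤ) : ℂ) * ζ₉ ^ a i * v i) ∧
      ∀ i, Val 1 (((s i : ℤ) : ℂ) * ζ₉ ^ a i * v i - v 0) := by
  have h0 := ne_zero_of_not_val (hv' 0)
  have hi := (hv 0).inv (hv' 0)
  have hq : ∀ i, Val 0 (v i * (v 0)⁻¹) := fun i => (hv i).mul' hi (by norm_num)
  have hq' : ∀ i, ¬ Val 1 (v i * (v 0)⁻¹) := by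
    intro i h
    apply hv' i
    have := h.mul' (hv 0) (k := 1) (by norm_num)
    rwa [inv_mul_cancel_right₀ h0] at this
  obtain ⟨s, m, b, h1⟩ := exists_unit_normal_form (hq 1) (hq' 1)
  obtain ⟨s', m', b', h2⟩ := exists_unit_normal_form (hq 2) (hq' 2)
  have n1 := val_mul_star_of_four h1
  have n2 := val_mul_star_of_four h2
  have hu : ∀ (s : ℤˣ) (m : ℤ) (x : ℂ), ((s : ℤ) : ℂ) * ζ₉ ^ m * x *
      star (((s : ℤ) : ℂ) * ζ₉ ^ m * x) = x * star x := by
    intro s m x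
    rw [star_mul']
    linear_combination x * star x * star_unit_mul s m
  rw [hu] at n1 n2
  have hnorm : Val 3 (1 + v 1 * (v 0)⁻¹ * star (v 1 * (v 0)⁻¹) +
      v 2 * (v 0)⁻¹ * star (v 2 * (v 0)⁻¹)) := by
    have := (hi.mul hi.conj).mul' hn (k := 3) (by norm_num)
    convert this using 1
    have e : (v 0)⁻¹ * v 0 = 1 := inv_mul_cancel₀ h0
    have e' : star (v 0)⁻¹ * star (v 0) = 1 := by rw [← star_mul', e, star_one]
    rw [star_mul', star_mul']
    linear_combination (-1 : ℂ) * e - (v 0)⁻¹ * v 0 * e'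
  have hsum : Val 3 (piE ^ (2 : ℤ) * ((2 * (b + b') : ℤ) : ℂ)) := by
    have := ((hnorm.sub n1).sub n2).sub (val_three.mono (by norm_num))
    convert this using 1
    push_cast
    rw [show (2 : ℤ) = ((2 : ℕ) : ℤ) by rfl, zpow_natCast]
    ring
  have hdvd : 3 ∣ b + b' := by
    have := (Val.shift (n := 1) 2).mp hsum
    rw [val_one_int_iff] at this
    omega
  refine ⟨![1, s, s'], ![0, m, m'], ?_, ?_⟩
  · obtain ⟨q, hq⟩ := hdvd
    -- The sum of `1`, `1 + b π ^ 2` and `1 + b' π ^ 2`; as `3 ∣ b + b'` it is divisible by `3`,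
    -- hence even by `π ^ 6`.
    have h3 : Val 4 (((b + b' : ℤ) : ℂ) * piE ^ 2 + 3) := by
      rw [hq]
      push_cast
      have := val_three.mul' (((val_int q).mul' (val_pow 2) (k := 0) (by norm_num)).add val_one)
        (k := 4) (by norm_num)
      convert this using 1
      ring
    have := (hv 0).mul' ((h1.add h2).add h3) (k := 4) (by norm_num)
    convert this using 1
    rw [Fin.sum_univ_three]
    simp only [Matrix.cons_val, Units.val_one, Int.cast_one, zpow_zero]
    push_cast
    linear_combination (-(s : ℂ) * ζ₉ ^ m * v 1 - (s' : ℂ) * ζ₉ ^ m' * v 2) * mul_inv_cancel₀ h0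
  · intro i
    have g1 := (val_one_of_four h1).mul' (hv 0) (k := 1) (by norm_num)
    have g2 := (val_one_of_four h2).mul' (hv 0) (k := 1) (by norm_num)
    fin_cases i
    · simpa using Val.zero 1
    · convert g1 using 1
      simp only [Fin.mk_one, Matrix.cons_val]
      linear_combination (-(s : ℂ) * ζ₉ ^ m * v 1) * mul_inv_cancel₀ h0
    · convert g2 using 1
      simp only [Fin.reduceFinMk, Matrix.cons_val]
      linear_combination (-(s' : ℂ) * ζ₉ ^ m' * v 2) * mul_inv_cancel₀ h0

/-! ### The effect of `H` on denominators -/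

theorem val_ζ₉_cube_sub_one : Val 3 (ζ₉ ^ 3 - 1) := by
  have hpi : Val 0 piE := val_piE.mono (by norm_num)
  have := (val_three.mul' ((hpi.mul' hpi (k := 0) (by norm_num)).sub hpi) (k := 3)
    (by norm_num)).sub (val_pow 3)
  convert this using 1
  rw [piE]
  ring

theorem val_inv_sqrtNegThree : Val (-3) (1 / sqrtNegThree) := by
  have h : Val 3 sqrtNegThree := by
    have := ((val_ζ₉_pow 3).mul' val_ζ₉_cube_sub_one (k := 3) (by norm_num)).neg
    rw [sqrtNegThree_eq]
    convert this using 1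
    ring
  rw [one_div, sqrtNegThree_inv]
  exact (h.mul' val_third (by norm_num)).neg

/-- The sum of the rows of the Fourier matrix against a vector. -/
theorem val_fourier {m : Fin 3 → ℂ} (hm : ∀ i, Val 0 (m i)) (hS : Val 4 (m 0 + m 1 + m 2))
    (h : Val 1 (m 1 - m 2)) :
    Val 4 (m 0 + m 1 * ζ₉ ^ 3 + m 2 * ζ₉ ^ 6) ∧ Val 4 (m 0 + m 1 * ζ₉ ^ 6 + m 2 * ζ₉ ^ 3) := by
  have h3 := val_ζ₉_cube_sub_one
  have h6 : Val 1 (1 - ζ₉ ^ 6) := by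
    have := (h3.mul' ((val_ζ₉_pow 3).add val_one) (k := 1) (by norm_num)).neg
    convert this using 1
    ring
  constructor
  · have h1 := h.add (h6.mul' (hm 2) (k := 1) (by norm_num))
    -- The Fourier sum differs from the plain sum by `(ζ₃ - 1)(m 1 - ζ₃² m 2)`: the first factor
    -- lies in `π ^ 3 𝒪` and the second in `π 𝒪`.
    have := hS.add (h3.mul' h1 (k := 4) (by norm_num))
    convert this using 1
    linear_combination (-m 2) * (1 - ζ₉ ^ 3) * ζ₉_rel
  · have h1 := h.neg.add (h6.mul' (hm 1) (k := 1) (by norm_num))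
    have := hS.add (h3.mul' h1 (k := 4) (by norm_num))
    convert this using 1
    linear_combination (-m 1) * (1 - ζ₉ ^ 3) * ζ₉_rel

/-- One primitive row determines the gate. The bound on minors makes every other row a multiple of
it modulo `π ^ t`, and `t ≥ 3` with orthogonality carries the congruence modulo `π ^ 4` over to all
rows. -/
theorem exists_descent_of_three_le (g : Γ) (ht : 3 ≤ dexp g) :
    ∃ c : 𝒟, dexp (g * incl c * HΓ) < dexp g := by
  obtain ⟨i₀, j₀, hij⟩ := exists_not_val g
  set t := dexp g with htdef
  set M : Fin 3 → Fin 3 → ℂ := fun i j => piE ^ (t : ℤ) * mat g i j with hM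
  have hM0 : ∀ i j, Val 0 (M i j) := fun i j => by
    have := (Val.shift (t : ℤ)).mpr (dexp_spec g i j)
    rwa [add_neg_cancel] at this
  have hMi : ¬ Val 1 (M i₀ j₀) := by
    have := (Val.shift (n := 1 - t) (t : ℤ) (x := mat g i₀ j₀)).not.mpr hij
    rwa [add_sub_cancel] at this
  have horth : ∀ i k, Val 6 (M i 0 * star (M k 0) + M i 1 * star (M k 1) + M i 2 * star (M k 2)) := by
    intro i k
    have h1 : Val 0 (if i = k then (1 : ℂ) else 0) := by
      split_ifs
      · exact val_one
      · exact Val.zero 0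
    rw [← row_orth g i k] at h1
    have := ((val_zpow t).mul (val_zpow t).conj).mul' h1 (k := 6) (by lia)
    convert this using 1
    simp only [hM, star_mul']
    ring
  have hunit := not_val_of_isotropic (hM0 i₀) ((horth i₀ i₀).mono (by norm_num)) hMi
  obtain ⟨s, a, hS, hd⟩ := exists_row_descent (hM0 i₀) hunit ((horth i₀ i₀).mono (by norm_num))
  refine ⟨diagGate s a, ?_⟩
  set d : Fin 3 → ℂ := fun i => ((s i : ℤ) : ℂ) * ζ₉ ^ a i with hddef
  have hd0 : ∀ l, Val 0 (d l) := fun l => (val_int _).mul' (val_ζ₉_zpow _) (by norm_num)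
  have hdd : ∀ l, d l * star (d l) = 1 := fun l => star_unit_mul (s l) (a l)
  rw [Fin.sum_univ_three] at hS
  have key : ∀ i, Val 4 (d 0 * M i 0 + d 1 * M i 1 + d 2 * M i 2) ∧
      Val 1 (d 1 * M i 1 - d 2 * M i 2) := by
    intro i
    have hr := ne_zero_of_not_val (hunit 0)
    have hrinv := (hM0 i₀ 0).inv (hunit 0)
    set lam := M i 0 * (M i₀ 0)⁻¹ with hlam
    have hlam0 : Val 0 lam := (hM0 i 0).mul' hrinv (by norm_num)
    have hw : ∀ l, Val 3 (M i l - lam * M i₀ l) := by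
      intro l
      have h1 := val_minor g i i₀ l 0
      have := (((val_zpow t).mul (val_zpow t)).mul h1).mul' hrinv (k := 3) (by lia)
      convert this using 1
      have e := mul_inv_cancel₀ hr
      simp only [hlam, hM] at e ⊢
      linear_combination (-(piE ^ (t : ℤ) * mat g i l)) * e
    choose w hw0 hwe using fun l => exists_eq_piE_pow_mul (n := 3) (by exact_mod_cast hw l)
    have hsum : Val 1 (w 0 * star (M i₀ 0) + w 1 * star (M i₀ 1) + w 2 * star (M i₀ 2)) := by
      have h1 := (horth i i₀).sub (hlam0.mul' (horth i₀ i₀) (k := 6) (by norm_num))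
      have h2 : Val (3 + 1) (piE ^ (3 : ℤ) *
          (w 0 * star (M i₀ 0) + w 1 * star (M i₀ 1) + w 2 * star (M i₀ 2))) := by
        refine Val.mono (n := 6) (by norm_num) ?_
        convert h1 using 1
        rw [show (3 : ℤ) = ((3 : ℕ) : ℤ) by rfl, zpow_natCast]
        linear_combination (-star (M i₀ 0)) * hwe 0 - star (M i₀ 1) * hwe 1 -
          star (M i₀ 2) * hwe 2
      exact (Val.shift 3).mp h2
    -- Conjugate `d l * M i₀ l ≡ M i₀ 0` and multiply by `d l`. This turns orthogonality of `w` to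
    -- the row into `∑ w l * d l ≡ 0` modulo `π`.
    have hbar : ∀ l, Val 1 (star (M i₀ l) - star (M i₀ 0) * d l) := by
      intro l
      have := (hd0 l).mul' (hd l).conj (k := 1) (by norm_num)
      change Val 1 (d l * star (d l * M i₀ l - M i₀ 0)) at this
      convert this using 1
      rw [star_sub, star_mul' (d l) (M i₀ l)]
      linear_combination (-star (M i₀ l)) * hdd l
    have hdw : Val 1 (w 0 * d 0 + w 1 * d 1 + w 2 * d 2) := by
      refine Val.of_mul_unit (hM0 i₀ 0).conj (mt val_star_iff.mp (hunit 0)) ?_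
      have h1 := fun l => (hw0 l).mul' (hbar l) (k := 1) (by norm_num)
      convert hsum.sub (((h1 0).add (h1 1)).add (h1 2)) using 1
      ring
    constructor
    · have h1 := (hlam0.mul' hS (k := 4) (by norm_num)).add
        ((val_pow 3).mul' hdw (k := 4) (by norm_num))
      convert h1 using 1
      linear_combination d 0 * hwe 0 + d 1 * hwe 1 + d 2 * hwe 2
    · have h1 := hlam0.mul' ((hd 1).sub (hd 2)) (k := 1) (by norm_num)
      have h2 := fun l => (hd0 l).mul' (hw l) (k := 1) (by norm_num)
      convert (h1.add (h2 1)).sub (h2 2) using 1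
      simp only [hddef]
      ring
  have hle : dexp (g * incl (diagGate s a) * HΓ) ≤ t - 1 := by
    refine dexp_le_iff.mpr fun i j => ?_
    have hF := val_fourier (m := fun l => d l * M i l)
      (fun l => (hd0 l).mul' (hM0 i l) (by norm_num)) (key i).1 (key i).2
    have hall : Val 4 (d 0 * M i 0 * (!![1, 1, 1; 1, ζ₉ ^ 3, ζ₉ ^ 6; 1, ζ₉ ^ 6, ζ₉ ^ 3] : Matrix _ _ ℂ) 0 j +
        d 1 * M i 1 * (!![1, 1, 1; 1, ζ₉ ^ 3, ζ₉ ^ 6; 1, ζ₉ ^ 6, ζ₉ ^ 3] : Matrix _ _ ℂ) 1 j +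
        d 2 * M i 2 * (!![1, 1, 1; 1, ζ₉ ^ 3, ζ₉ ^ 6; 1, ζ₉ ^ 6, ζ₉ ^ 3] : Matrix _ _ ℂ) 2 j) := by
      fin_cases j
      · simpa using (key i).1
      · simpa using hF.1
      · simpa using hF.2
    have := ((val_zpow (-t)).mul val_inv_sqrtNegThree).mul' hall (k := -((t - 1 : ℕ) : ℤ)) (by lia)
    convert this using 1
    rw [mat_mul, mat_mul, mat_diagGate, mat_HΓ, Hmat, Matrix.mul_apply, Fin.sum_univ_three]
    simp only [Matrix.mul_diagonal, Matrix.smul_apply, smul_eq_mul, hM, hddef]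
    have hπ : piE ^ (-t : ℤ) * piE ^ (t : ℤ) = 1 := by
      rw [← zpow_add₀ piE_ne_zero, neg_add_cancel, zpow_zero]
    generalize (!![1, 1, 1; 1, ζ₉ ^ 3, ζ₉ ^ 6; 1, ζ₉ ^ 6, ζ₉ ^ 3] : Matrix _ _ ℂ) = F
    linear_combination (-(1 / sqrtNegThree) * (mat g i 0 * (((s 0 : ℤ) : ℂ) * ζ₉ ^ a 0) * F 0 j +
      mat g i 1 * (((s 1 : ℤ) : ℂ) * ζ₉ ^ a 1) * F 1 j +
      mat g i 2 * (((s 2 : ℤ) : ℂ) * ζ₉ ^ a 2) * F 2 j)) * hπ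
  omega

/-! ## The stabilizer `C` and the group generated by the gates -/

theorem sum_normForm_row {g : Γ} {N : ℂ} {n : Fin 6 → ℤ} (hN : N * star N = ev n)
    {A : Fin 3 → Fin 6 → ℤ} {i : Fin 3} (hA : ∀ j, ev (A j) = N * mat g i j) :
    normForm (A 0) + normForm (A 1) + normForm (A 2) = n 0 := by
  rw [← Fin.sum_univ_three (fun j => normForm (A j))]
  apply sum_normForm
  rw [Fin.sum_univ_three, hA, hA, hA, ← hN]
  have := row_orth g i i
  rw [if_pos rfl] at this
  simp only [star_mul']
  linear_combination N * star N * this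

/-- If `dexp g` were `1` or `2`, scaling by `ρ = (1 - ζ₉)(1 - ζ₉²)` would clear a row with three
nonzero entries. The norm of `ρ` has constant coordinate `3`, so each scaled entry would have form
value one and be a root of unity, forcing `ρ ρ̄ = 3`. -/
theorem three_le_dexp {g : Γ} (h : dexp g ≠ 0) : 3 ≤ dexp g := by
  by_contra! hlt
  obtain ⟨i, j₀, hij⟩ := exists_not_val g
  have hunit : ∀ j, mat g i j ≠ 0 := by
    intro j
    have h0 : ∀ j, Val 0 (piE ^ (dexp g : ℤ) * mat g i j) := fun j => by
      have := (Val.shift (dexp g : ℤ)).mpr (dexp_spec g i j)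
      rwa [add_neg_cancel] at this
    have h1 : ¬ Val 1 (piE ^ (dexp g : ℤ) * mat g i j₀) := by
      have := (Val.shift (n := 1 - dexp g) (dexp g : ℤ) (x := mat g i j₀)).not.mpr hij
      rwa [add_sub_cancel] at this
    have h2 : Val 0 (if i = i then (1 : ℂ) else 0) := by rw [if_pos rfl]; exact val_one
    rw [← row_orth g i i] at h2
    have h3 := ((val_zpow (dexp g)).mul (val_zpow (dexp g)).conj).mul' h2 (k := 1) (by lia)
    have := not_val_of_isotropic (v := fun j => piE ^ (dexp g : ℤ) * mat g i j) h0 (by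
      convert h3 using 1
      simp only [star_mul']
      ring) h1 j
    exact right_ne_zero_of_mul (ne_zero_of_not_val this)
  have hρ : Val 2 (piE * (1 - ζ₉ ^ 2)) := by
    have := (val_pow 2).mul' ((val_one.add (val_ζ₉_pow 1))) (k := 2) (by norm_num)
    convert this using 1
    rw [piE]
    ring
  have hρ0 : piE * (1 - ζ₉ ^ 2) ≠ 0 := mul_ne_zero piE_ne_zero
    (sub_ne_zero.mpr (ζ₉_prim.pow_ne_one_of_pos_of_lt (by norm_num) (by norm_num)).symm)
  have hmem : ∀ j, piE * (1 - ζ₉ ^ 2) * mat g i j ∈ OE := fun j =>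
    OEinv3_mem_OE (OEinv3.mul_mem (OE_le_OEinv3 (OE.mul_mem piE_mem_OE
      (OE.sub_mem OE.one_mem (OE.pow_mem ζ₉_mem_OE 2)))) (g.2 i j))
      (hρ.mul' (dexp_spec g i j) (by lia))
  choose A hA using fun j => exists_ev (hmem j)
  have hN : piE * (1 - ζ₉ ^ 2) * star (piE * (1 - ζ₉ ^ 2)) = ev ![3, 1, -1, 0, 2, 1] := by
    rw [star_mul', piE, star_sub, star_sub, star_one, star_pow, star_ζ₉]
    simp only [ev_eq, Matrix.cons_val]
    push_cast
    linear_combination (-2 * ζ₉ ^ 0 - 2 * ζ₉ ^ 1 + 3 * ζ₉ ^ 3 - ζ₉ ^ 5 - ζ₉ ^ 6 + 2 * ζ₉ ^ 7 - ζ₉ ^ 9 - ζ₉ ^ 10 + 2 * ζ₉ ^ 12 - ζ₉ ^ 13 - ζ₉ ^ 15 + ζ₉ ^ 16 + ζ₉ ^ 17 - ζ₉ ^ 19 - ζ₉ ^ 20 + ζ₉ ^ 21) * ζ₉_rel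
  have hsum := sum_normForm_row hN hA
  have hpos : ∀ j, 1 ≤ normForm (A j) := fun j => normForm_pos (by
    rw [hA]; exact mul_ne_zero hρ0 (hunit j))
  have h1 : ∀ j, normForm (A j) = 1 := by
    have := hpos 0
    have := hpos 1
    have := hpos 2
    simp only [Matrix.cons_val] at hsum
    intro j
    fin_cases j <;> simp only [Fin.zero_eta, Fin.mk_one, Fin.reduceFinMk] <;> omega
  have h2 : ∀ j, ev (A j) * star (ev (A j)) = 1 := by
    intro j
    obtain ⟨s, n, hs⟩ := ev_of_normForm_eq_one (h1 j)
    rw [hs, star_unit_mul]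
  have h3 : ev ![3, 1, -1, 0, 2, 1] = ev ((3 : ℤ) • Pi.single 0 1) := by
    rw [ev_int, ← hN]
    have := row_orth g i i
    rw [if_pos rfl] at this
    have e0 := h2 0
    have e1 := h2 1
    have e2 := h2 2
    rw [hA, star_mul'] at e0 e1 e2
    push_cast
    linear_combination e0 + e1 + e2 -
      piE * (1 - ζ₉ ^ 2) * star (piE * (1 - ζ₉ ^ 2)) * this
  -- The coordinate of `ζ₉` is `1` in the norm of `ρ` and `0` in `3`.
  have h4 := congrFun (ev_injective h3) 1
  simp at h4

theorem mat_mem_OE {g : Γ} (hg : dexp g = 0) (i j : Fin 3) : mat g i j ∈ OE := by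
  have := dexp_spec g i j
  rw [hg] at this
  exact OEinv3_mem_OE (g.2 i j) (by simpa using this)

/-- The elements of `C` are monomial matrices. -/
theorem exists_monomial {g : Γ} (hg : dexp g = 0) (i : Fin 3) :
    ∃ (j : Fin 3) (s : ℤˣ) (n : ℤ), mat g i j = ((s : ℤ) : ℂ) * ζ₉ ^ n ∧
      ∀ k, k ≠ j → mat g i k = 0 := by
  choose A hA using fun j => exists_ev (mat_mem_OE hg i j)
  have hsum := sum_normForm_row (g := g) (N := 1) (n := (1 : ℤ) • Pi.single 0 1)
    (by rw [ev_int]; simp) (A := A) (i := i) (by simpa using hA)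
  have hn := fun j => normForm_nonneg (A j)
  have hzero : ∀ j, normForm (A j) = 0 → mat g i j = 0 := by
    intro j hj
    by_contra h
    have := normForm_pos (a := A j) (by rwa [hA])
    omega
  have hone : ∀ j, normForm (A j) = 1 →
      ∃ (s : ℤˣ) (n : ℤ), mat g i j = ((s : ℤ) : ℂ) * ζ₉ ^ n := by
    intro j hj
    rw [← hA]
    exact ev_of_normForm_eq_one hj
  have h0 := hn 0
  have h1 := hn 1
  have h2 := hn 2
  have key : ∃ j, normForm (A j) = 1 ∧ ∀ k, k ≠ j → normForm (A k) = 0 := by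
    simp only [Pi.smul_apply, Pi.single_eq_same, smul_eq_mul, mul_one] at hsum
    rcases (by omega : normForm (A 0) = 1 ∨ normForm (A 1) = 1 ∨ normForm (A 2) = 1)
      with h | h | h
    · refine ⟨0, h, fun k hk => ?_⟩
      fin_cases k <;> simp only [Fin.zero_eta, Fin.mk_one, Fin.reduceFinMk] at * <;>
        omega
    · refine ⟨1, h, fun k hk => ?_⟩
      fin_cases k <;> simp only [Fin.zero_eta, Fin.mk_one, Fin.reduceFinMk] at * <;>
        omega
    · refine ⟨2, h, fun k hk => ?_⟩
      fin_cases k <;> simp only [Fin.zero_eta, Fin.mk_one, Fin.reduceFinMk] at * <;>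
        omega
  obtain ⟨j, hj, hk⟩ := key
  obtain ⟨s, n, hs⟩ := hone j hj
  exact ⟨j, s, n, hs, fun k h => hzero k (hk k h)⟩

/-! ### Permutation matrices as words in the gates -/

theorem one_div_sqrtNegThree_sq : (1 / sqrtNegThree) * (1 / sqrtNegThree) = -(1 / 3) := by
  rw [one_div, ← mul_inv, ← sq, sqrtNegThree_sq]
  norm_num

theorem Hmat_mul_Hmat : Hmat * Hmat = !![-1, 0, 0; 0, 0, -1; 0, -1, 0] := by
  rw [Hmat, smul_mul_smul_comm, one_div_sqrtNegThree_sq]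
  ext i j
  rw [Matrix.smul_apply, smul_eq_mul, Matrix.mul_apply, Fin.sum_univ_three]
  fin_cases i <;> fin_cases j <;> simp <;>
    first
      | linear_combination ζ₉_rel
      | linear_combination ζ₉_rel + ζ₉ ^ 3 * ζ₉_pow
      | linear_combination (2 / 3 : ℂ) * ζ₉_pow
      | norm_num

theorem H_pow_four : H * H * (H * H) = 1 := by
  apply Subtype.ext
  change Hmat * Hmat * (Hmat * Hmat) = 1
  rw [Hmat_mul_Hmat]
  ext i j
  fin_cases i <;> fin_cases j <;> simp [Matrix.mul_apply, Fin.sum_univ_three]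

theorem H_inv : H⁻¹ = H * H * H := by
  refine inv_eq_of_mul_eq_one_right ?_
  rw [← H_pow_four]
  group

theorem H_mem_closure : H ∈ Subgroup.closure gates := Subgroup.subset_closure (Or.inl rfl)

theorem 𝒟_mem_closure (c : 𝒟) : (c : U3) ∈ Subgroup.closure gates :=
  Subgroup.subset_closure (Or.inr c.2)

theorem star_Hmat : star Hmat =
    (star (1 / sqrtNegThree)) • !![1, 1, 1; 1, ζ₉ ^ 6, ζ₉ ^ 3; 1, ζ₉ ^ 3, ζ₉ ^ 6] := by
  have h3 : star (ζ₉ ^ 3) = ζ₉ ^ 6 := by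
    rw [star_pow, star_ζ₉]; linear_combination (ζ₉ ^ 15 + ζ₉ ^ 6) * ζ₉_pow
  have h6 : star (ζ₉ ^ 6) = ζ₉ ^ 3 := by
    rw [← h3, star_star]
  rw [Hmat, star_smul]
  congr 1
  ext i j
  rw [Matrix.star_apply]
  fin_cases i <;> fin_cases j <;> simp [h3, h6, -star_pow]

theorem one_div_sqrtNegThree_mul_star : star (1 / sqrtNegThree) * (1 / sqrtNegThree) = 1 / 3 := by
  rw [one_div, star_inv₀, star_sqrtNegThree, ← mul_inv, neg_mul, ← sq, sqrtNegThree_sq]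
  norm_num

/-- The conjugate of a diagonal matrix by `H` is circulant. -/
theorem conj_diagonal (d : Fin 3 → ℂ) : star Hmat * Matrix.diagonal d * Hmat = (1 / 3 : ℂ) •
    !![d 0 + d 1 + d 2, d 0 + ζ₉ ^ 3 * d 1 + ζ₉ ^ 6 * d 2, d 0 + ζ₉ ^ 6 * d 1 + ζ₉ ^ 3 * d 2;
      d 0 + ζ₉ ^ 6 * d 1 + ζ₉ ^ 3 * d 2, d 0 + d 1 + d 2, d 0 + ζ₉ ^ 3 * d 1 + ζ₉ ^ 6 * d 2;
      d 0 + ζ₉ ^ 3 * d 1 + ζ₉ ^ 6 * d 2, d 0 + ζ₉ ^ 6 * d 1 + ζ₉ ^ 3 * d 2, d 0 + d 1 + d 2] := by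
  rw [star_Hmat, Hmat, smul_mul_assoc, smul_mul_smul_comm, one_div_sqrtNegThree_mul_star]
  congr 1
  ext i j
  rw [Matrix.mul_apply, Fin.sum_univ_three]
  simp only [Matrix.mul_diagonal]
  fin_cases i <;> fin_cases j <;> simp <;>
    first
      | ring1
      | linear_combination (d 1 + d 2) * ζ₉_pow
      | linear_combination (d 1 * ζ₉ ^ 3) * ζ₉_pow
      | linear_combination (d 2 * ζ₉ ^ 3) * ζ₉_pow

/-- The element `w` of `U(3)` is the permutation matrix of `σ`. -/
def IsPerm (w : U3) (σ : Equiv.Perm (Fin 3)) : Prop :=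
  ∀ i j, (w : Matrix (Fin 3) (Fin 3) ℂ) i j = if σ i = j then 1 else 0

/-- Row `i` carries its one in column `σ i`, hence the reversed order. -/
theorem IsPerm.mul {v w : U3} {σ τ : Equiv.Perm (Fin 3)} (hv : IsPerm v σ) (hw : IsPerm w τ) :
    IsPerm (v * w) (τ * σ) := by
  intro i j
  rw [Submonoid.coe_mul, Matrix.mul_apply, Finset.sum_eq_single (σ i)]
  · rw [hv, hw, if_pos rfl, one_mul]
    rfl
  · intro k _ hk
    rw [hv, if_neg hk.symm, zero_mul]
  · simp

/-- The transposition is `-H ^ 2`, the square of a Fourier matrix being index negation up to sign.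
The three-cycle is `diag(1, ζ₃, ζ₃²)` conjugated by `H`. -/
theorem exists_isPerm (σ : Equiv.Perm (Fin 3)) : ∃ w ∈ Subgroup.closure gates, IsPerm w σ := by
  have h1 : ∃ w ∈ Subgroup.closure gates, IsPerm w 1 :=
    ⟨1, one_mem _, fun i j => by rw [Submonoid.coe_one, Matrix.one_apply]; rfl⟩
  have hs : ∃ w ∈ Subgroup.closure gates, IsPerm w (Equiv.swap 1 2) := by
    refine ⟨diagGate (fun _ => -1) 0 * (H * H), mul_mem (𝒟_mem_closure _)
      (mul_mem H_mem_closure H_mem_closure), fun i j => ?_⟩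
    change ((Matrix.diagonal fun i => (((-1 : ℤˣ) : ℤ) : ℂ) * ζ₉ ^ (0 : Fin 3 → ℤ) i) *
      (Hmat * Hmat)) i j = _
    rw [Hmat_mul_Hmat, Matrix.diagonal_mul]
    fin_cases i <;> fin_cases j <;> simp [Equiv.swap_apply_def]
  have hc : ∃ w ∈ Subgroup.closure gates, IsPerm w (finRotate 3)⁻¹ := by
    refine ⟨H⁻¹ * diagGate 1 ![0, 3, 6] * H, mul_mem (mul_mem (inv_mem H_mem_closure)
      (𝒟_mem_closure _)) H_mem_closure, fun i j => ?_⟩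
    change (star Hmat * (Matrix.diagonal fun i => (((1 : ℤˣ) : ℤ) : ℂ) *
      ζ₉ ^ (![0, 3, 6] : Fin 3 → ℤ) i) * Hmat) i j = _
    have h3 : ζ₉ ^ (3 : ℤ) = ζ₉ ^ 3 := zpow_natCast ζ₉ 3
    have h6 : ζ₉ ^ (6 : ℤ) = ζ₉ ^ 6 := zpow_natCast ζ₉ 6
    have hp : ∀ i : Fin 3, ((finRotate 3)⁻¹ : Equiv.Perm (Fin 3)) i = ![2, 0, 1] i := by decide
    rw [conj_diagonal, hp]
    fin_cases i <;> fin_cases j <;> simp [h3, h6] <;>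
      first
        | linear_combination ζ₉_rel
        | linear_combination ζ₉_rel + ζ₉ ^ 3 * ζ₉_pow
        | linear_combination (2 / 3 : ℂ) * ζ₉_pow
  have hmul : ∀ {σ τ : Equiv.Perm (Fin 3)}, (∃ w ∈ Subgroup.closure gates, IsPerm w σ) →
      (∃ w ∈ Subgroup.closure gates, IsPerm w τ) →
      ∃ w ∈ Subgroup.closure gates, IsPerm w (τ * σ) := by
    rintro σ τ ⟨v, hv, hv'⟩ ⟨w, hw, hw'⟩
    exact ⟨v * w, mul_mem hv hw, hv'.mul hw'⟩
  have hall : ∀ σ : Equiv.Perm (Fin 3), σ = 1 ∨ σ = (finRotate 3)⁻¹ ∨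
      σ = (finRotate 3)⁻¹ * (finRotate 3)⁻¹ ∨ σ = Equiv.swap 1 2 ∨
      σ = Equiv.swap 1 2 * (finRotate 3)⁻¹ ∨
      σ = Equiv.swap 1 2 * ((finRotate 3)⁻¹ * (finRotate 3)⁻¹) := by decide
  rcases hall σ with rfl | rfl | rfl | rfl | rfl | rfl
  exacts [h1, hc, hmul hc hc, hs, hmul hc hs, hmul (hmul hc hc) hs]

theorem mem_closure_of_dexp_eq_zero {g : Γ} (hg : dexp g = 0) :
    (g : U3) ∈ Subgroup.closure gates := by
  choose f s n hf hf' using exists_monomial hg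
  have hinj : Function.Injective f := by
    intro i k hik
    by_contra hne
    have h0 := row_orth g i k
    rw [if_neg hne] at h0
    have hsum : mat g i (f i) * star (mat g k (f i)) = 0 := by
      rw [← h0, ← Fin.sum_univ_three (fun j => mat g i j * star (mat g k j)),
        Finset.sum_eq_single (f i)]
      · intro j _ hj
        rw [hf' i j hj, zero_mul]
      · simp
    have hne0 : ∀ i, mat g i (f i) ≠ 0 := fun i h => by
      have := star_unit_mul (s i) (n i)
      rw [← hf, h, zero_mul] at this
      exact zero_ne_one this
    rcases mul_eq_zero.mp hsum with h | h
    · exact hne0 i h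
    · rw [hik, star_eq_zero] at h
      exact hne0 k h
  let σ : Equiv.Perm (Fin 3) := Equiv.ofBijective f (Finite.injective_iff_bijective.mp hinj)
  obtain ⟨w, hw, hwσ⟩ := exists_isPerm σ
  have e : (g : U3) = diagGate s n * w := by
    apply Subtype.ext
    ext i j
    change mat g i j = ((Matrix.diagonal fun i => ((s i : ℤ) : ℂ) * ζ₉ ^ n i) *
      (w : Matrix (Fin 3) (Fin 3) ℂ)) i j
    rw [Matrix.diagonal_mul, hwσ]
    change _ = _ * if f i = j then 1 else 0
    split_ifs with h
    · rw [← h, hf, mul_one]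
    · rw [hf' i j (Ne.symm h), mul_zero]
  rw [e]
  exact mul_mem (𝒟_mem_closure _) hw

/-! ### Coset representatives and generation -/

theorem mem_stabD_iff {c : 𝒟} : c ∈ stabD ↔ dexp (HΓ⁻¹ * incl c * HΓ) = 0 := by
  rw [← mem_C_iff, stabD, Subgroup.mem_comap, Subgroup.mem_map]
  constructor
  · rintro ⟨k, hk, h⟩
    have e : incl c = HΓ * k * HΓ⁻¹ := h.symm
    rw [e]
    convert hk using 1
    group
  · intro h
    refine ⟨_, h, ?_⟩
    change HΓ * (HΓ⁻¹ * incl c * HΓ) * HΓ⁻¹ = incl c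
    group

/-- The descent step, with the diagonal gate in a given set of coset representatives. -/
theorem exists_descent {R : Set 𝒟} (hR : Subgroup.IsComplement R (stabD : Set 𝒟)) {g : Γ}
    (hg : dexp g ≠ 0) : ∃ c ∈ R, dexp (g * incl c * HΓ) < dexp g := by
  obtain ⟨c, hc⟩ := exists_descent_of_three_le g (three_le_dexp hg)
  obtain ⟨⟨r, s⟩, hrs⟩ := hR.2 c
  refine ⟨r, r.2, ?_⟩
  have hs := mem_stabD_iff.mp s.2
  -- The factor `s ∈ stabD` passes through `H` as an element of `C`, which does not affect `dexp`.
  have e : g * incl c * HΓ = g * incl r * HΓ * (HΓ⁻¹ * incl s * HΓ) := by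
    rw [← hrs]
    change g * incl (r * s) * HΓ = _
    rw [incl, map_mul]
    group
  rwa [e, dexp_mul_of_dexp_eq_zero _ _ hs] at hc

theorem closure_gates : Subgroup.closure gates = Γ := by
  apply le_antisymm
  · rw [Subgroup.closure_le]
    rintro g (rfl | hg)
    · exact H_mem
    · exact 𝒟_le hg
  · intro g hg
    have h : ∀ n : ℕ, ∀ g : Γ, dexp g = n → (g : U3) ∈ Subgroup.closure gates := by
      intro n
      induction n using Nat.strong_induction_on with
      | _ n ih =>
        intro g hn
        by_cases h0 : dexp g = 0
        · exact mem_closure_of_dexp_eq_zero h0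
        · obtain ⟨c, hc⟩ := exists_descent_of_three_le g (three_le_dexp h0)
          have h1 := ih _ (hn ▸ hc) _ rfl
          have h2 := mul_mem (mul_mem h1 (inv_mem H_mem_closure)) (inv_mem (𝒟_mem_closure c))
          convert h2 using 1
          change (g : U3) = g * c * H * H⁻¹ * (c : U3)⁻¹
          group
    exact h _ ⟨g, hg⟩ rfl

/-! ## The index of the stabilizer in the diagonal gates -/

theorem unit_eq_iff {s t : ℤˣ} {m n : ℤ} :
    ((s : ℤ) : ℂ) * ζ₉ ^ m = ((t : ℤ) : ℂ) * ζ₉ ^ n ↔ s = t ∧ (m : ZMod 9) = n := by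
  have hz : ∀ m n : ℤ, ζ₉ ^ m = ζ₉ ^ n ↔ (m : ZMod 9) = n := by
    intro m n
    have h1 : ζ₉ ^ m = ζ₉ ^ n ↔ ζ₉ ^ (n - m) = 1 := by
      rw [zpow_sub₀ ζ₉_ne_zero, div_eq_one_iff_eq (zpow_ne_zero _ ζ₉_ne_zero), eq_comm]
    rw [h1, ζ₉_prim.zpow_eq_one_iff_dvd, ← ZMod.intCast_eq_intCast_iff_dvd_sub]
  constructor
  · intro h
    have h9 : ∀ m : ℤ, (ζ₉ ^ m) ^ 9 = 1 := fun m => by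
      rw [← zpow_natCast, ← _root_.zpow_mul, mul_comm, _root_.zpow_mul, zpow_natCast, ζ₉_pow, _root_.one_zpow]
    -- The ninth power kills the root of unity and, nine being odd, retains the sign.
    have h1 := congrArg (fun x => x ^ 9) h
    simp only [mul_pow, h9, mul_one] at h1
    have hs : s = t := by
      rcases Int.units_eq_one_or s with rfl | rfl <;> rcases Int.units_eq_one_or t with rfl | rfl
      · rfl
      · exfalso; norm_num at h1
      · exfalso; norm_num at h1
      · rfl
    refine ⟨hs, (hz m n).mp ?_⟩
    subst hs
    exact mul_left_cancel₀ (by rcases Int.units_eq_one_or s with rfl | rfl <;> simp) h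
  · rintro ⟨rfl, h⟩
    rw [(hz m n).mpr h]

theorem diagGate_eq_iff {s t : Fin 3 → ℤˣ} {a b : Fin 3 → ℤ} :
    diagGate s a = diagGate t b ↔ ∀ i, s i = t i ∧ (a i : ZMod 9) = b i := by
  simp only [← unit_eq_iff]
  constructor
  · intro h i
    have h1 : mat (incl (diagGate s a)) i i = mat (incl (diagGate t b)) i i := by rw [h]
    simpa [mat_diagGate] using h1
  · intro h
    apply Subtype.ext
    apply Subtype.ext
    change Matrix.diagonal _ = Matrix.diagonal _
    congr 1
    funext i
    exact h i

theorem card_𝒟 : Nat.card 𝒟 = 5832 := by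
  let f : (Fin 3 → ℤˣ) × (Fin 3 → ZMod 9) → 𝒟 := fun p => diagGate p.1 fun i => (p.2 i).val
  have hf : Function.Bijective f := by
    constructor
    · rintro ⟨s, a⟩ ⟨t, b⟩ h
      have h1 := diagGate_eq_iff.mp h
      ext i
      · rw [(h1 i).1]
      · have := (h1 i).2
        simpa using this
    · intro c
      obtain ⟨s, a, rfl⟩ := exists_diagGate c
      refine ⟨⟨s, fun i => a i⟩, diagGate_eq_iff.mpr fun i => ⟨rfl, ?_⟩⟩
      simp
  rw [← Nat.card_eq_of_bijective f hf]
  simp [Nat.card_eq_fintype_card, ZMod.card]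

theorem eq_of_fourier_zero {x y z : ℂ} (h1 : x + ζ₉ ^ 3 * y + ζ₉ ^ 6 * z = 0)
    (h2 : x + ζ₉ ^ 6 * y + ζ₉ ^ 3 * z = 0) : y = x ∧ z = x := by
  have hr := ζ₉_rel
  have hp := ζ₉_pow
  constructor <;> grind

theorem eq_of_fourier_one {x y z : ℂ} (h0 : x + y + z = 0)
    (h2 : x + ζ₉ ^ 6 * y + ζ₉ ^ 3 * z = 0) : y = ζ₉ ^ 6 * x ∧ z = ζ₉ ^ 3 * x := by
  have hr := ζ₉_rel
  have hp := ζ₉_pow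
  have hc : ζ₉ ^ 3 - 1 ≠ 0 := sub_ne_zero.mpr
    (ζ₉_prim.pow_ne_one_of_pos_of_lt (by norm_num) (by norm_num))
  constructor <;> grind

theorem eq_of_fourier_two {x y z : ℂ} (h0 : x + y + z = 0)
    (h1 : x + ζ₉ ^ 3 * y + ζ₉ ^ 6 * z = 0) : y = ζ₉ ^ 3 * x ∧ z = ζ₉ ^ 6 * x := by
  have hr := ζ₉_rel
  have hp := ζ₉_pow
  have hc : ζ₉ ^ 3 - 1 ≠ 0 := sub_ne_zero.mpr
    (ζ₉_prim.pow_ne_one_of_pos_of_lt (by norm_num) (by norm_num))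
  constructor <;> grind

/-- The conjugate by `H` is circulant with the Fourier coefficients of the diagonal as entries.
Being integral means being monomial, so two of the three coefficients vanish and the diagonal is a
geometric progression whose ratio is a cube root of unity. -/
theorem mem_stabD_diagGate {s : Fin 3 → ℤˣ} {a : Fin 3 → ℤ} :
    diagGate s a ∈ stabD ↔ (∀ i, s i = s 0) ∧ ∃ m : ZMod 3,
      ∀ i : Fin 3, (a i : ZMod 9) = a 0 + 3 * (m.val * (i : ℕ) : ℕ) := by
  set d : Fin 3 → ℂ := fun i => ((s i : ℤ) : ℂ) * ζ₉ ^ a i with hd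
  have hmat : mat (HΓ⁻¹ * incl (diagGate s a) * HΓ) =
      star Hmat * Matrix.diagonal d * Hmat := rfl
  rw [conj_diagonal] at hmat
  have hp : ∀ m : ℕ, ∀ i, d i = ζ₉ ^ (3 * m) * d 0 ↔ s i = s 0 ∧
      (a i : ZMod 9) = a 0 + 3 * (m : ℕ) := by
    intro m i
    have e : ζ₉ ^ (3 * m) * d 0 = ((s 0 : ℤ) : ℂ) * ζ₉ ^ (a 0 + 3 * m) := by
      rw [zpow_add₀ ζ₉_ne_zero, hd, ← zpow_natCast]
      push_cast
      ring
    rw [e, unit_eq_iff]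
    push_cast
    rfl
  have hcond : ((∀ i, s i = s 0) ∧ ∃ m : ZMod 3,
      ∀ i : Fin 3, (a i : ZMod 9) = a 0 + 3 * (m.val * (i : ℕ) : ℕ)) ↔
      ∃ m : ZMod 3, ∀ i : Fin 3, d i = ζ₉ ^ (3 * (m.val * (i : ℕ))) * d 0 := by
    simp only [hp, forall_and, exists_and_left]
  rw [mem_stabD_iff, hcond]
  constructor
  · intro h
    obtain ⟨j, t, n, -, hj'⟩ := exists_monomial h 0
    rw [hmat] at hj'
    have p0 : j ≠ 0 → d 0 + d 1 + d 2 = 0 := fun h => by simpa using hj' 0 h.symm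
    have p1 : j ≠ 1 → d 0 + ζ₉ ^ 3 * d 1 + ζ₉ ^ 6 * d 2 = 0 := fun h => by
      simpa using hj' 1 h.symm
    have p2 : j ≠ 2 → d 0 + ζ₉ ^ 6 * d 1 + ζ₉ ^ 3 * d 2 = 0 := fun h => by
      simpa using hj' 2 h.symm
    have fin : ∀ m : ZMod 3, d 1 = ζ₉ ^ (3 * m.val) * d 0 → d 2 = ζ₉ ^ (3 * (m.val * 2)) * d 0 →
        ∃ m : ZMod 3, ∀ i : Fin 3, d i = ζ₉ ^ (3 * (m.val * (i : ℕ))) * d 0 := by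
      intro m h1 h2
      refine ⟨m, fun i => ?_⟩
      fin_cases i
      · simp
      · simpa using h1
      · exact h2
    have e12 : ζ₉ ^ 12 = ζ₉ ^ 3 := by linear_combination ζ₉ ^ 3 * ζ₉_pow
    have hj3 := (by decide : ∀ j : Fin 3, j = 0 ∨ j = 1 ∨ j = 2) j
    rcases hj3 with rfl | rfl | rfl
    · obtain ⟨q1, q2⟩ := eq_of_fourier_zero (p1 (by decide)) (p2 (by decide))
      exact fin 0 (by simpa using q1) (by simpa using q2)
    · obtain ⟨q1, q2⟩ := eq_of_fourier_one (p0 (by decide)) (p2 (by decide))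
      exact fin 2 q1 (q2.trans (by rw [← e12]; rfl))
    · obtain ⟨q1, q2⟩ := eq_of_fourier_two (p0 (by decide)) (p1 (by decide))
      exact fin 1 q1 q2
  · rintro ⟨m, hm⟩
    have h1 : d 1 = ζ₉ ^ (3 * m.val) * d 0 := by simpa using hm 1
    have h2 : d 2 = ζ₉ ^ (3 * (m.val * 2)) * d 0 := hm 2
    have hd0 : Val 0 (d 0) := (val_int _).mul' (val_ζ₉_zpow _) (by norm_num)
    have key : ∀ x y : ℂ, (d 0 + x * d 1 + y * d 2 = 0 ∨ d 0 + x * d 1 + y * d 2 = 3 * d 0) →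
        Val 0 ((1 / 3) * (d 0 + x * d 1 + y * d 2)) := by
      rintro x y (h | h)
      · rw [h, mul_zero]; exact Val.zero 0
      · rw [h, ← mul_assoc, one_div_mul_cancel (by norm_num), one_mul]; exact hd0
    have k : (d 0 + 1 * d 1 + 1 * d 2 = 0 ∨ d 0 + 1 * d 1 + 1 * d 2 = 3 * d 0) ∧
        (d 0 + ζ₉ ^ 3 * d 1 + ζ₉ ^ 6 * d 2 = 0 ∨ d 0 + ζ₉ ^ 3 * d 1 + ζ₉ ^ 6 * d 2 = 3 * d 0) ∧
        (d 0 + ζ₉ ^ 6 * d 1 + ζ₉ ^ 3 * d 2 = 0 ∨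
          d 0 + ζ₉ ^ 6 * d 1 + ζ₉ ^ 3 * d 2 = 3 * d 0) := by
      have hr := ζ₉_rel
      have hp := ζ₉_pow
      rw [h1, h2]
      have hm3 := (by decide : ∀ m : ZMod 3, m = 0 ∨ m = 1 ∨ m = 2) m
      rcases hm3 with rfl | rfl | rfl
      · change (_ + 1 * (ζ₉ ^ 0 * _) + 1 * (ζ₉ ^ 0 * _) = 0 ∨ _) ∧ _
        refine ⟨Or.inr ?_, Or.inl ?_, Or.inl ?_⟩ <;> simp
        · ring
        · linear_combination d 0 * hr
        · linear_combination d 0 * hr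
      · change (_ + 1 * (ζ₉ ^ 3 * _) + 1 * (ζ₉ ^ 6 * _) = 0 ∨ _) ∧
          (_ + _ * (ζ₉ ^ 3 * _) + _ * (ζ₉ ^ 6 * _) = 0 ∨ _) ∧ (_ ∨
            _ + _ * (ζ₉ ^ 3 * _) + _ * (ζ₉ ^ 6 * _) = _)
        refine ⟨Or.inl ?_, Or.inl ?_, Or.inr ?_⟩
        · linear_combination d 0 * hr
        · linear_combination d 0 * hr + d 0 * ζ₉ ^ 3 * hp
        · linear_combination 2 * d 0 * hp
      · change (_ + 1 * (ζ₉ ^ 6 * _) + 1 * (ζ₉ ^ 12 * _) = 0 ∨ _) ∧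
          (_ ∨ _ + _ * (ζ₉ ^ 6 * _) + _ * (ζ₉ ^ 12 * _) = _) ∧ (
            _ + _ * (ζ₉ ^ 6 * _) + _ * (ζ₉ ^ 12 * _) = 0 ∨ _)
        refine ⟨Or.inl ?_, Or.inr ?_, Or.inl ?_⟩
        · linear_combination d 0 * hr + d 0 * ζ₉ ^ 3 * hp
        · linear_combination d 0 * hp + d 0 * (ζ₉ ^ 9 + 1) * hp
        · linear_combination d 0 * hr + d 0 * (ζ₉ ^ 6 + ζ₉ ^ 3) * hp
    have k0 := key _ _ k.1
    have k1 := key _ _ k.2.1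
    have k2 := key _ _ k.2.2
    rw [one_mul, one_mul] at k0
    refine Nat.le_zero.mp (dexp_le_iff.mpr fun i j => ?_)
    rw [hmat, Nat.cast_zero, neg_zero]
    fin_cases i <;> fin_cases j
    exacts [k0, k1, k2, k2, k0, k1, k1, k2, k0]

theorem card_stabD : Nat.card stabD = 54 := by
  let f : ℤˣ × ZMod 9 × ZMod 3 → stabD := fun p =>
    ⟨diagGate (fun _ => p.1) fun i => p.2.1.val + 3 * (p.2.2.val * (i : ℕ) : ℕ),
      mem_stabD_diagGate.mpr ⟨fun _ => rfl, p.2.2, fun i => by simp⟩⟩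
  have hf : Function.Bijective f := by
    constructor
    · rintro ⟨s, a, m⟩ ⟨t, b, n⟩ h
      have h1 := diagGate_eq_iff.mp (congrArg Subtype.val h)
      have hs : s = t := (h1 0).1
      have ha : a = b := by simpa using (h1 0).2
      have hm : (3 : ZMod 9) * (m.val : ZMod 9) = 3 * (n.val : ZMod 9) := by
        simpa [ha] using (h1 1).2
      have key : ∀ m n : ZMod 3, (3 : ZMod 9) * (m.val : ZMod 9) = 3 * (n.val : ZMod 9) → m = n := by
        decide
      rw [hs, ha, key m n hm]
    · rintro ⟨c, hc⟩
      obtain ⟨s, a, rfl⟩ := exists_diagGate c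
      obtain ⟨hs, m, hm⟩ := mem_stabD_diagGate.mp hc
      refine ⟨⟨s 0, a 0, m⟩, Subtype.ext (diagGate_eq_iff.mpr fun i => ⟨(hs i).symm, ?_⟩)⟩
      rw [hm i]
      simp
  rw [← Nat.card_eq_of_bijective f hf]
  simp [Nat.card_eq_fintype_card, ZMod.card]

theorem index_stabD : stabD.index = 108 := by
  have h := stabD.card_mul_index
  rw [card_stabD, card_𝒟] at h
  omega

/-! ## Loop-free register programs -/

section Programs

variable {α : Type}

/-- Programs without loops. -/
def LoopFree : Prog α → Prop
  | .seq p q => LoopFree p ∧ LoopFree q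
  | .ite _ p q => LoopFree p ∧ LoopFree q
  | .loop _ _ => False
  | _ => True

/-- The result of a loop-free program. -/
def run : Prog α → Config α → Config α
  | .skip, σ => σ
  | .const r n, σ => σ.set r n
  | .add r a b, σ => σ.set r (σ.reg a + σ.reg b)
  | .sub r a b, σ => σ.set r (σ.reg a - σ.reg b)
  | .mul r a b, σ => σ.set r (σ.reg a * σ.reg b)
  | .div r a b, σ => σ.set r (σ.reg a / σ.reg b)
  | .mod r a b, σ => σ.set r (σ.reg a % σ.reg b)
  | .push s, σ => ⟨σ.reg, s :: σ.out⟩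
  | .seq p q, σ => run q (run p σ)
  | .ite r p q, σ => if 0 < σ.reg r then run p σ else run q σ
  | .loop _ _, σ => σ

theorem bits_le_iff {n : ℤ} {k : ℕ} : bits n ≤ k + 1 ↔ n.natAbs < 2 ^ k := by
  rw [bits, Nat.add_le_add_iff_right, Nat.size_le]

theorem one_le_bits (n : ℤ) : 1 ≤ bits n := Nat.le_add_left _ _

theorem natAbs_lt_of_bits (n : ℤ) : n.natAbs < 2 ^ (bits n - 1) := by
  have := (bits_le_iff (n := n) (k := bits n - 1)).mp (by have := one_le_bits n; omega)
  exact this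

theorem bits_mono {m n : ℤ} (h : m.natAbs ≤ n.natAbs) : bits m ≤ bits n :=
  Nat.add_le_add_right (Nat.size_le_size h) 1

theorem bits_of_natAbs_le_add {m a b : ℤ} (h : m.natAbs ≤ a.natAbs + b.natAbs) :
    bits m ≤ bits a + bits b := by
  have ha := natAbs_lt_of_bits a
  have hb := natAbs_lt_of_bits b
  have h1 := one_le_bits a
  have h2 := one_le_bits b
  have e : bits a + bits b = (bits a + bits b - 1) + 1 := by omega
  rw [e, bits_le_iff]
  have ea : 2 ^ (bits a - 1) ≤ 2 ^ (bits a + bits b - 2) :=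
    Nat.pow_le_pow_right (by norm_num) (by omega)
  have eb : 2 ^ (bits b - 1) ≤ 2 ^ (bits a + bits b - 2) :=
    Nat.pow_le_pow_right (by norm_num) (by omega)
  have e2 : 2 ^ (bits a + bits b - 1) = 2 * 2 ^ (bits a + bits b - 2) := by
    rw [← pow_succ']
    congr 1
    omega
  omega

theorem bits_mul (a b : ℤ) : bits (a * b) ≤ bits a + bits b := by
  have ha := natAbs_lt_of_bits a
  have hb := natAbs_lt_of_bits b
  have h1 := one_le_bits a
  have h2 := one_le_bits b
  have e : bits a + bits b = (bits a + bits b - 1) + 1 := by omega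
  rw [e, bits_le_iff, Int.natAbs_mul]
  calc a.natAbs * b.natAbs < 2 ^ (bits a - 1) * 2 ^ (bits b - 1) := Nat.mul_lt_mul'' ha hb
    _ = 2 ^ (bits a - 1 + (bits b - 1)) := (pow_add _ _ _).symm
    _ ≤ _ := Nat.pow_le_pow_right (by norm_num) (by omega)

theorem bits_ediv (a b : ℤ) : bits (a / b) ≤ bits a :=
  bits_mono (Int.natAbs_ediv_le_natAbs a b)

theorem bits_emod (a b : ℤ) : bits (a % b) ≤ bits a + bits b := by
  apply bits_of_natAbs_le_add
  -- By convention `a % 0 = a`, which the bound also has to cover.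
  rcases eq_or_ne b 0 with rfl | hb
  · simp
  · have h1 := Int.emod_nonneg a hb
    have h2 := Int.emod_lt a hb
    omega

theorem Config.set_bits {σ : Config α} {B B' : ℕ} (h : ∀ r, bits (σ.reg r) ≤ B) (hB : B ≤ B')
    {n : ℤ} (hn : bits n ≤ B') (r₀ r : ℕ) : bits ((σ.set r₀ n).reg r) ≤ B' := by
  rw [Config.set]
  change bits (Function.update σ.reg r₀ n r) ≤ B'
  rw [Function.update_apply]
  split_ifs
  · exact hn
  · exact (h r).trans hB

/-- A loop-free program halts within a quadratic number of bit operations, and its registers grow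
linearly. -/
theorem exec_run {p : Prog α} (hp : LoopFree p) : ∃ c : ℕ, ∀ (σ : Config α) (B : ℕ), 1 ≤ B →
    (∀ r, bits (σ.reg r) ≤ B) →
    (∀ r, bits ((run p σ).reg r) ≤ c * B) ∧ ∃ t, t ≤ c * B ^ 2 ∧ Exec p σ (run p σ) t := by
  have lin : ∀ {B a b : ℕ}, 1 ≤ B → a ≤ B → b ≤ B → 1 + a + b ≤ 3 * B ^ 2 := by
    intro B a b h1 h2 h3
    nlinarith
  have quad : ∀ {B a b : ℕ}, 1 ≤ B → a ≤ B → b ≤ B → 1 + a * b ≤ 3 * B ^ 2 := by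
    intro B a b h1 h2 h3
    nlinarith [Nat.mul_le_mul h2 h3]
  induction p with
  | skip => exact ⟨1, fun σ B hB h => ⟨fun r => (h r).trans (by omega), 1, by nlinarith, .skip σ⟩⟩
  | const r n =>
    refine ⟨1 + bits n, fun σ B hB h => ⟨fun r' => Config.set_bits h ?_ ?_ r r', _, ?_,
      .const σ r n⟩⟩
    · nlinarith
    · nlinarith
    · nlinarith [Nat.one_le_pow 2 B hB]
  | add r a b =>
    refine ⟨3, fun σ B hB h => ⟨fun r' => Config.set_bits h (by omega) ?_ r r', _,
      lin hB (h a) (h b), .add σ r a b⟩⟩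
    have := bits_of_natAbs_le_add (Int.natAbs_add_le (σ.reg a) (σ.reg b))
    linarith [h a, h b]
  | sub r a b =>
    refine ⟨3, fun σ B hB h => ⟨fun r' => Config.set_bits h (by omega) ?_ r r', _,
      lin hB (h a) (h b), .sub σ r a b⟩⟩
    have := bits_of_natAbs_le_add (Int.natAbs_sub_le (σ.reg a) (σ.reg b))
    linarith [h a, h b]
  | mul r a b =>
    refine ⟨3, fun σ B hB h => ⟨fun r' => Config.set_bits h (by omega) ?_ r r', _,
      quad hB (h a) (h b), .mul σ r a b⟩⟩
    linarith [bits_mul (σ.reg a) (σ.reg b), h a, h b]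
  | div r a b =>
    refine ⟨3, fun σ B hB h => ⟨fun r' => Config.set_bits h (by omega) ?_ r r', _,
      quad hB (h a) (h b), .div σ r a b⟩⟩
    linarith [bits_ediv (σ.reg a) (σ.reg b), h a, h b]
  | mod r a b =>
    refine ⟨3, fun σ B hB h => ⟨fun r' => Config.set_bits h (by omega) ?_ r r', _,
      quad hB (h a) (h b), .mod σ r a b⟩⟩
    linarith [bits_emod (σ.reg a) (σ.reg b), h a, h b]
  | push s => exact ⟨1, fun σ B hB h => ⟨fun r => (h r).trans (by omega), 1, by nlinarith, .push σ s⟩⟩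
  | seq p q ihp ihq =>
    obtain ⟨c, hc⟩ := ihp hp.1
    obtain ⟨d, hd⟩ := ihq hp.2
    refine ⟨c + d * (c + 1) + d * (c + 1) ^ 2, fun σ B hB h => ?_⟩
    obtain ⟨h1, t, ht, he⟩ := hc σ B hB h
    -- The bound `(c + 1) * B` instead of `c * B` stays at least one when `c = 0`.
    obtain ⟨h2, u, hu, hf⟩ := hd (run p σ) ((c + 1) * B) (by nlinarith)
      (fun r => (h1 r).trans (by nlinarith))
    refine ⟨fun r => (h2 r).trans ?_, t + u, ?_, .seq he hf⟩
    · have : d * ((c + 1) * B) = d * (c + 1) * B := by ring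
      rw [this]
      exact Nat.mul_le_mul_right _ (by omega)
    · have e : d * ((c + 1) * B) ^ 2 = d * (c + 1) ^ 2 * B ^ 2 := by ring
      rw [e] at hu
      have : (c + d * (c + 1) + d * (c + 1) ^ 2) * B ^ 2 =
          c * B ^ 2 + d * (c + 1) * B ^ 2 + d * (c + 1) ^ 2 * B ^ 2 := by ring
      rw [this]
      have := Nat.zero_le (d * (c + 1) * B ^ 2)
      omega
  | ite r p q ihp ihq =>
    obtain ⟨c, hc⟩ := ihp hp.1
    obtain ⟨d, hd⟩ := ihq hp.2
    refine ⟨c + d + 2, fun σ B hB h => ?_⟩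
    have hr := h r
    have hBB : B ≤ B ^ 2 := by nlinarith
    have e : (c + d + 2) * B ^ 2 = c * B ^ 2 + d * B ^ 2 + 2 * B ^ 2 := by ring
    have z1 := Nat.zero_le (c * B ^ 2)
    have z2 := Nat.zero_le (d * B ^ 2)
    rw [e]
    by_cases h0 : 0 < σ.reg r
    · obtain ⟨h1, t, ht, he⟩ := hc σ B hB h
      rw [run, if_pos h0]
      exact ⟨fun r => (h1 r).trans (Nat.mul_le_mul_right _ (by omega)), _, by omega,
        .ite_pos h0 he⟩
    · obtain ⟨h1, t, ht, he⟩ := hd σ B hB h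
      rw [run, if_neg h0]
      exact ⟨fun r => (h1 r).trans (Nat.mul_le_mul_right _ (by omega)), _, by omega,
        .ite_neg h0 he⟩
  | loop r p _ => exact absurd hp id

/-- A loop with a loop-free body whose registers stay bounded. -/
theorem exec_loop {p : Prog α} {r c B : ℕ} (hB : 1 ≤ B)
    (hc : ∀ (σ : Config α) (B : ℕ), 1 ≤ B → (∀ r, bits (σ.reg r) ≤ B) →
      (∀ r, bits ((run p σ).reg r) ≤ c * B) ∧ ∃ t, t ≤ c * B ^ 2 ∧ Exec p σ (run p σ) t)
    (Good : Config α → ℕ → Prop) (hbits : ∀ σ m, Good σ m → ∀ r, bits (σ.reg r) ≤ B)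
    (hstep : ∀ σ m, Good σ m → 0 < σ.reg r → ∃ m' < m, Good (run p σ) m') (m : ℕ) (σ : Config α)
    (h : Good σ m) : ∃ τ t m', Good τ m' ∧ ¬ 0 < τ.reg r ∧ Exec (.loop r p) σ τ t ∧
      t ≤ (m + 1) * (c * B ^ 2 + B + 1) := by
  induction m using Nat.strong_induction_on generalizing σ with
  | _ m ih =>
    have hr := hbits σ m h r
    by_cases h0 : 0 < σ.reg r
    · obtain ⟨m', hm', hg⟩ := hstep σ m h h0
      obtain ⟨τ, t, m'', hτ, hn, he, ht⟩ := ih m' hm' _ hg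
      obtain ⟨-, u, hu, hf⟩ := hc σ B hB (hbits σ m h)
      refine ⟨τ, _, m'', hτ, hn, .loop_pos h0 hf he, ?_⟩
      have h1 : (m' + 1) * (c * B ^ 2 + B + 1) ≤ m * (c * B ^ 2 + B + 1) :=
        Nat.mul_le_mul_right _ hm'
      have e : (m + 1) * (c * B ^ 2 + B + 1) = m * (c * B ^ 2 + B + 1) + (c * B ^ 2 + B + 1) := by
        ring
      omega
    · refine ⟨σ, _, m, h, h0, .loop_neg h0, ?_⟩
      have e : (m + 1) * (c * B ^ 2 + B + 1) =
          m * (c * B ^ 2 + B + 1) + c * B ^ 2 + B + 1 := by ring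
      have z1 := Nat.zero_le (m * (c * B ^ 2 + B + 1))
      have z2 := Nat.zero_le (c * B ^ 2)
      omega

/-! ## Expressions -/

/-- Binary operations of the register machine. -/
inductive BinOp
  | add
  | mul
  | div
  | mod

/-- The value of a binary operation. -/
def BinOp.fn : BinOp → ℤ → ℤ → ℤ
  | .add, a, b => a + b
  | .mul, a, b => a * b
  | .div, a, b => a / b
  | .mod, a, b => a % b

/-- The instruction for a binary operation. -/
def BinOp.prog : BinOp → ℕ → ℕ → ℕ → Prog α
  | .add => .add
  | .mul => .mul
  | .div => .div
  | .mod => .mod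

theorem BinOp.loopFree (o : BinOp) (r a b : ℕ) : LoopFree (o.prog r a b : Prog α) := by
  cases o <;> trivial

theorem BinOp.run_prog (o : BinOp) (r a b : ℕ) (σ : Config α) :
    run (o.prog r a b) σ = σ.set r (o.fn (σ.reg a) (σ.reg b)) := by
  cases o <;> rfl

/-- Arithmetic expressions in the first 55 registers. -/
inductive Ex
  | reg (r : Fin 55)
  | const (n : ℤ)
  | bin (o : BinOp) (a b : Ex)

/-- The value of an expression. -/
def Ex.eval (f : ℕ → ℤ) : Ex → ℤ
  | .reg r => f r
  | .const n => n
  | .bin o a b => o.fn (a.eval f) (b.eval f)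

theorem Ex.eval_congr {f g : ℕ → ℤ} (h : ∀ r < 55, f r = g r) (e : Ex) : e.eval f = e.eval g := by
  induction e with
  | reg r => exact h r r.2
  | const n => rfl
  | bin o a b iha ihb => rw [Ex.eval, Ex.eval, iha, ihb]

/-- A program writing the value of the expression into register `d`. -/
def Ex.compile : Ex → ℕ → Prog α
  | .reg r, d => .seq (.const d 0) (.add d d r)
  | .const n, d => .const d n
  | .bin o a b, d => .seq (a.compile d) (.seq (b.compile (d + 1)) (o.prog d d (d + 1)))

theorem Ex.loopFree_compile (e : Ex) (d : ℕ) : LoopFree (e.compile d : Prog α) := by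
  induction e generalizing d with
  | reg r => exact ⟨trivial, trivial⟩
  | const n => trivial
  | bin o a b iha ihb => exact ⟨iha d, ihb (d + 1), o.loopFree _ _ _⟩

theorem Config.set_reg_self (σ : Config α) (r : ℕ) (n : ℤ) : (σ.set r n).reg r = n :=
  Function.update_self ..

theorem Config.set_reg_ne (σ : Config α) {r r' : ℕ} (h : r' ≠ r) (n : ℤ) :
    (σ.set r n).reg r' = σ.reg r' := Function.update_of_ne h ..

theorem Config.set_out (σ : Config α) (r : ℕ) (n : ℤ) : (σ.set r n).out = σ.out := rfl

theorem Ex.run_compile (e : Ex) {d : ℕ} (hd : 55 ≤ d) (σ : Config α) :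
    (∀ r < d, (run (e.compile d) σ).reg r = σ.reg r) ∧
      (run (e.compile d) σ).reg d = e.eval σ.reg ∧ (run (e.compile d) σ).out = σ.out := by
  induction e generalizing d σ with
  | reg r =>
    have hr : (r : ℕ) ≠ d := by omega
    simp only [Ex.compile, run, Ex.eval]
    refine ⟨fun r' h => ?_, ?_, rfl⟩
    · rw [Config.set_reg_ne _ (by omega), Config.set_reg_ne _ (by omega)]
    · rw [Config.set_reg_self, Config.set_reg_self, Config.set_reg_ne _ hr, zero_add]
  | const n =>
    exact ⟨fun r' h => Config.set_reg_ne _ (by omega) _, Config.set_reg_self _ _ _, rfl⟩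
  | bin o a b iha ihb =>
    simp only [Ex.compile, run, BinOp.run_prog, Ex.eval]
    obtain ⟨a1, a2, a3⟩ := iha hd σ
    obtain ⟨b1, b2, b3⟩ := ihb (d := d + 1) (by omega) (run (a.compile d) σ)
    refine ⟨fun r' h => ?_, ?_, ?_⟩
    · rw [Config.set_reg_ne _ (by omega), b1 r' (by omega), a1 r' h]
    · rw [Config.set_reg_self, b2, b1 d (by omega), a2,
        Ex.eval_congr (fun r hr => a1 r (by omega)) b]
    · rw [Config.set_out, b3, a3]

/-! ### Specifications that ignore the scratch registers -/

/-- Started in any configuration whose first 55 registers hold `s`, the program ends in one whose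
first 55 registers hold `s'`, and writes `w`. -/
def Does (p : Prog α) (s s' : ℕ → ℤ) (w : List α) : Prop :=
  ∀ σ : Config α, (∀ r < 55, σ.reg r = s r) →
    (∀ r < 55, (run p σ).reg r = s' r) ∧ (run p σ).out = w ++ σ.out

theorem Does.seq {p q : Prog α} {s s' s'' : ℕ → ℤ} {w w' : List α} (hp : Does p s s' w)
    (hq : Does q s' s'' w') : Does (.seq p q) s s'' (w' ++ w) := by
  intro σ hσ
  obtain ⟨h1, h2⟩ := hp σ hσ
  obtain ⟨h3, h4⟩ := hq _ h1
  exact ⟨h3, by rw [run, h4, h2, List.append_assoc]⟩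

/-- Run `p` if the expression is positive and `q` otherwise. -/
def cond (e : Ex) (p q : Prog α) : Prog α := .seq (e.compile 55) (.ite 55 p q)

theorem loopFree_cond {e : Ex} {p q : Prog α} (hp : LoopFree p) (hq : LoopFree q) :
    LoopFree (cond e p q) := ⟨e.loopFree_compile 55, hp, hq⟩

theorem does_cond {e : Ex} {p q : Prog α} {s s' : ℕ → ℤ} {w : List α}
    (hp : 0 < e.eval s → Does p s s' w) (hq : ¬ 0 < e.eval s → Does q s s' w) :
    Does (cond e p q) s s' w := by
  intro σ hσ
  obtain ⟨h1, h2, h3⟩ := e.run_compile le_rfl σ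
  rw [Ex.eval_congr hσ] at h2
  have h4 : ∀ r < 55, (run (e.compile 55) σ).reg r = s r := fun r hr => by rw [h1 r hr, hσ r hr]
  rw [cond, run, run, h2, ← h3]
  split_ifs with h
  · exact hp h _ h4
  · exact hq h _ h4

/-- Run the first program of the list whose expression is positive. -/
def chain : List (Ex × Prog α) → Prog α
  | [] => .skip
  | (e, p) :: l => cond e p (chain l)

theorem loopFree_chain {l : List (Ex × Prog α)} (h : ∀ x ∈ l, LoopFree x.2) :
    LoopFree (chain l) := by
  induction l with
  | nil => trivial
  | cons x l ih =>
    exact loopFree_cond (h x (by simp)) (ih fun y hy => h y (by simp [hy]))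

/-- Which branch is taken depends only on `s`; its effect can be specified after the branch is
known. -/
theorem does_chain {l : List (Ex × Prog α)} {s : ℕ → ℤ} (h : ∃ x ∈ l, 0 < x.1.eval s) :
    ∃ x ∈ l, 0 < x.1.eval s ∧ ∀ s' w, Does x.2 s s' w → Does (chain l) s s' w := by
  induction l with
  | nil => simp at h
  | cons x l ih =>
    by_cases hx : 0 < x.1.eval s
    · exact ⟨x, by simp, hx, fun s' w hd => does_cond (fun _ => hd) (fun hn => absurd hx hn)⟩
    · obtain ⟨y, hy, hpos, hd⟩ := ih (by
        obtain ⟨y, hy, hpos⟩ := h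
        rcases List.mem_cons.mp hy with rfl | hy
        · exact absurd hpos hx
        · exact ⟨y, hy, hpos⟩)
      exact ⟨y, by simp [hy], hpos, fun s' w h' =>
        does_cond (fun hp => absurd hp hx) (fun _ => hd s' w h')⟩

/-- Write a list in front of the output. -/
def pushList : List α → Prog α
  | [] => .skip
  | a :: w => .seq (pushList w) (.push a)

theorem loopFree_pushList (w : List α) : LoopFree (pushList w) := by
  induction w with
  | nil => trivial
  | cons a w ih => exact ⟨ih, trivial⟩

theorem does_pushList (w : List α) (s : ℕ → ℤ) : Does (pushList w) s s w := by
  induction w with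
  | nil => exact fun σ h => ⟨h, rfl⟩
  | cons a w ih =>
    intro σ h
    obtain ⟨h1, h2⟩ := ih σ h
    exact ⟨h1, by simp [pushList, run, h2]⟩

/-- Evaluate expressions into the registers from 55 on. -/
def evalAll (f : ℕ → Ex) : ℕ → Prog α
  | 0 => .skip
  | n + 1 => .seq (evalAll f n) ((f n).compile (55 + n))

/-- Copy the registers from 55 on to the registers from 0 on. -/
def copyBack : ℕ → Prog α
  | 0 => .skip
  | n + 1 => .seq (copyBack n) (.seq (.const n 0) (.add n n (55 + n)))

/-- Simultaneous assignment to the first 55 registers. -/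
def assign (f : ℕ → Ex) : Prog α := .seq (evalAll f 55) (copyBack 55)

theorem loopFree_assign (f : ℕ → Ex) : LoopFree (assign f : Prog α) := by
  have h1 : ∀ n, LoopFree (evalAll f n : Prog α) := by
    intro n
    induction n with
    | zero => trivial
    | succ n ih => exact ⟨ih, Ex.loopFree_compile _ _⟩
  have h2 : ∀ n, LoopFree (copyBack n : Prog α) := by
    intro n
    induction n with
    | zero => trivial
    | succ n ih => exact ⟨ih, trivial, trivial⟩
  exact ⟨h1 55, h2 55⟩

theorem run_evalAll (f : ℕ → Ex) (n : ℕ) (σ : Config α) :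
    (∀ r < 55, (run (evalAll f n) σ).reg r = σ.reg r) ∧
      (∀ i < n, (run (evalAll f n) σ).reg (55 + i) = (f i).eval σ.reg) ∧
      (run (evalAll f n) σ).out = σ.out := by
  induction n with
  | zero => exact ⟨fun _ _ => rfl, fun i hi => absurd hi (Nat.not_lt_zero i), rfl⟩
  | succ n ih =>
    obtain ⟨h1, h2, h3⟩ := ih
    obtain ⟨c1, c2, c3⟩ := (f n).run_compile (d := 55 + n) (by omega) (run (evalAll f n) σ)
    simp only [evalAll, run]
    refine ⟨fun r hr => ?_, fun i hi => ?_, ?_⟩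
    · rw [c1 r (by omega), h1 r hr]
    · rcases Nat.lt_succ_iff_lt_or_eq.mp hi with h | rfl
      · rw [c1 _ (by omega), h2 i h]
      · rw [c2, Ex.eval_congr h1]
    · rw [c3, h3]

theorem run_copyBack {n : ℕ} (hn : n ≤ 55) (σ : Config α) :
    (∀ r < n, (run (copyBack n) σ).reg r = σ.reg (55 + r)) ∧
      (∀ r, n ≤ r → (run (copyBack n) σ).reg r = σ.reg r) ∧
      (run (copyBack n) σ).out = σ.out := by
  induction n with
  | zero => exact ⟨fun r hr => absurd hr (Nat.not_lt_zero r), fun _ _ => rfl, rfl⟩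
  | succ n ih =>
    obtain ⟨h1, h2, h3⟩ := ih (by omega)
    simp only [copyBack, run]
    refine ⟨fun r hr => ?_, fun r hr => ?_, ?_⟩
    · rcases Nat.lt_succ_iff_lt_or_eq.mp hr with h | rfl
      · rw [Config.set_reg_ne _ (by omega), Config.set_reg_ne _ (by omega), h1 r h]
      · rw [Config.set_reg_self, Config.set_reg_self, Config.set_reg_ne _ (by omega), zero_add,
          h2 _ (by omega)]
    · rw [Config.set_reg_ne _ (by omega), Config.set_reg_ne _ (by omega), h2 r (by omega)]
    · exact h3

theorem does_assign {f : ℕ → Ex} {s s' : ℕ → ℤ} (h : ∀ r < 55, (f r).eval s = s' r) :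
    Does (assign f : Prog α) s s' [] := by
  intro σ hσ
  obtain ⟨h1, h2, h3⟩ := run_evalAll f 55 σ
  obtain ⟨c1, -, c3⟩ := run_copyBack le_rfl (run (evalAll f 55) σ)
  rw [assign, run]
  refine ⟨fun r hr => ?_, ?_⟩
  · rw [c1 r hr, h2 r hr, Ex.eval_congr hσ, h r hr]
  · rw [c3, h3]; rfl

/-- All registers written by the program are below this bound. -/
def regBound : Prog α → ℕ
  | .skip | .push _ => 0
  | .const r _ | .add r _ _ | .sub r _ _ | .mul r _ _ | .div r _ _ | .mod r _ _ => r + 1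
  | .seq p q | .ite _ p q => max (regBound p) (regBound q)
  | .loop _ p => regBound p

theorem run_reg_of_le {p : Prog α} {r : ℕ} (h : regBound p ≤ r) (σ : Config α) :
    (run p σ).reg r = σ.reg r := by
  induction p generalizing σ with
  | skip | push _ | loop _ _ => rfl
  | const | add | sub | mul | div | mod =>
    simp only [regBound] at h
    exact Config.set_reg_ne _ (by omega) _
  | seq p q ihp ihq =>
    simp only [regBound, max_le_iff] at h
    rw [run, ihq h.2, ihp h.1]
  | ite r' p q ihp ihq =>
    simp only [regBound, max_le_iff] at h
    rw [run]
    split_ifs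
    · exact ihp h.1 σ
    · exact ihq h.2 σ

/-- Set the `n` registers from 55 on to zero. -/
def clear : ℕ → Prog α
  | 0 => .skip
  | n + 1 => .seq (clear n) (.const (55 + n) 0)

theorem loopFree_clear (n : ℕ) : LoopFree (clear n : Prog α) := by
  induction n with
  | zero => trivial
  | succ n ih => exact ⟨ih, trivial⟩

theorem run_clear (n : ℕ) (σ : Config α) :
    (∀ r, (run (clear n) σ).reg r = if 55 ≤ r ∧ r < 55 + n then 0 else σ.reg r) ∧
      (run (clear n) σ).out = σ.out := by
  induction n with
  | zero => exact ⟨fun r => by rw [if_neg (by omega)]; rfl, rfl⟩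
  | succ n ih =>
    obtain ⟨h1, h2⟩ := ih
    simp only [clear, run]
    refine ⟨fun r => ?_, h2⟩
    by_cases hr : r = 55 + n
    · subst hr
      rw [Config.set_reg_self, if_pos (by omega)]
    · rw [Config.set_reg_ne _ hr, h1]
      congr 1
      rw [eq_iff_iff]
      omega

/-- Run the program and reset the scratch registers. -/
def tidy (p : Prog α) : Prog α := .seq p (clear (regBound p))

theorem loopFree_tidy {p : Prog α} (hp : LoopFree p) : LoopFree (tidy p) :=
  ⟨hp, loopFree_clear _⟩

/-- Clearing the scratch registers determines the whole configuration, so bit lengths cannot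
accumulate there from one round of the loop to the next. -/
theorem run_tidy {p : Prog α} {s s' : ℕ → ℤ} {w : List α} (h : Does p s s' w)
    (hs : ∀ r, 55 ≤ r → s r = 0) (hs' : ∀ r, 55 ≤ r → s' r = 0) (out : List α) :
    run (tidy p) ⟨s, out⟩ = ⟨s', w ++ out⟩ := by
  obtain ⟨h1, h2⟩ := h ⟨s, out⟩ fun _ _ => rfl
  obtain ⟨c1, c2⟩ := run_clear (regBound p) (run p ⟨s, out⟩)
  rw [tidy, run]
  have e : ∀ τ : Config α, τ = ⟨τ.reg, τ.out⟩ := fun _ => rfl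
  rw [e (run _ _), c2, h2]
  congr 1
  funext r
  rw [c1]
  split_ifs with h
  · exact (hs' r h.1).symm
  · by_cases hr : r < 55
    · exact h1 r hr
    · rw [run_reg_of_le (by omega), hs' r (by omega)]
      exact hs r (by omega)

end Programs

/-! ## Matrices over `ℤ[ζ₉]` in the registers -/

/-- The matrix over `ℤ[ζ₉]` with the given coordinates. -/
def emat (A : Fin 3 → Fin 3 → Fin 6 → ℤ) : Matrix (Fin 3) (Fin 3) ℂ :=
  Matrix.of fun i j => ev (A i j)

theorem emat_apply (A : Fin 3 → Fin 3 → Fin 6 → ℤ) (i j : Fin 3) : emat A i j = ev (A i j) := rfl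

theorem exists_emat {M : Matrix (Fin 3) (Fin 3) ℂ} (h : ∀ i j, M i j ∈ OE) : ∃ A, emat A = M := by
  choose A hA using fun i j => exists_ev (h i j)
  exact ⟨A, Matrix.ext hA⟩

/-- The integer data `x` describe the element `g`. -/
def Codes (x : MatrixCode) (g : Γ) : Prop := emat x.coeff = (3 : ℂ) ^ x.k • mat g

theorem codes_iff {x : MatrixCode} {g : Γ} : Codes x g ↔ x.toMatrix = mat g := by
  have h3 : (3 : ℂ) ^ x.k ≠ 0 := pow_ne_zero _ (by norm_num)
  have e : emat x.coeff = (3 : ℂ) ^ x.k • x.toMatrix := by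
    ext i j
    rw [Matrix.smul_apply, smul_eq_mul]
    exact (mul_div_cancel₀ _ h3).symm
  rw [Codes, e]
  exact smul_right_inj h3

theorem exists_codes (g : Γ) : ∃ x, Codes x g := by
  obtain ⟨k, hk⟩ := exists_three_pow_mat g
  obtain ⟨A, hA⟩ := exists_emat (M := (3 : ℂ) ^ k • mat g) hk
  exact ⟨⟨k, A⟩, hA⟩

/-- The initial register content for the integer data. -/
def st (x : MatrixCode) : ℕ → ℤ := fun r => x.toList.getD r 0

/-- The register of a coordinate. -/
def idx (i j : Fin 3) (m : Fin 6) : Fin 55 := ⟨1 + 18 * i + 6 * j + m, by omega⟩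

theorem st_zero (x : MatrixCode) : st x 0 = x.k := rfl

theorem st_idx (x : MatrixCode) (i j : Fin 3) (m : Fin 6) : st x (idx i j m) = x.coeff i j m := by
  fin_cases i <;> fin_cases j <;> fin_cases m <;> rfl

theorem st_of_le (x : MatrixCode) {r : ℕ} (h : 55 ≤ r) : st x r = 0 :=
  List.getD_eq_default _ _ h

theorem eq_idx {r : ℕ} (h0 : r ≠ 0) (h : r < 55) :
    r = idx (Fin.ofNat 3 ((r - 1) / 18)) (Fin.ofNat 3 ((r - 1) / 6)) (Fin.ofNat 6 (r - 1)) := by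
  simp only [idx, Fin.ofNat]
  omega

theorem forall_st {P : ℤ → Prop} {x : MatrixCode} (h0 : P x.k) (h : ∀ i j m, P (x.coeff i j m)) :
    ∀ r < 55, P (st x r) := by
  intro r hr
  by_cases hr0 : r = 0
  · rwa [hr0, st_zero]
  · rw [eq_idx hr0 hr, st_idx]
    exact h _ _ _

/-- Assign new integer data. -/
def assignCode {α : Type} (e : Ex) (F : Fin 3 → Fin 3 → Fin 6 → Ex) : Prog α :=
  assign fun r => if r = 0 then e else
    F (Fin.ofNat 3 ((r - 1) / 18)) (Fin.ofNat 3 ((r - 1) / 6)) (Fin.ofNat 6 (r - 1))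

theorem does_assignCode {α : Type} {e : Ex} {F : Fin 3 → Fin 3 → Fin 6 → Ex} {x y : MatrixCode}
    (he : e.eval (st x) = y.k) (hF : ∀ i j m, (F i j m).eval (st x) = y.coeff i j m) :
    Does (assignCode e F : Prog α) (st x) (st y) [] := by
  apply does_assign
  intro r hr
  by_cases h0 : r = 0
  · rw [if_pos h0, he, h0, st_zero]
  · rw [if_neg h0, hF]
    conv_rhs => rw [eq_idx h0 hr, st_idx]

/-- Sum of a list of expressions. -/
def sumEx : List Ex → Ex
  | [] => .const 0
  | e :: l => .bin .add e (sumEx l)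

theorem eval_sumEx (l : List Ex) (s : ℕ → ℤ) : (sumEx l).eval s = (l.map (Ex.eval s)).sum := by
  induction l with
  | nil => rfl
  | cons e l ih =>
    rw [sumEx, Ex.eval, ih, List.map_cons, List.sum_cons]
    rfl

/-- Sum of a family of expressions over a finite type. -/
def sumAll {ι : Type*} [Fintype ι] (F : ι → Ex) : Ex := sumEx (Finset.univ.toList.map F)

theorem eval_sumAll {ι : Type*} [Fintype ι] (F : ι → Ex) (s : ℕ → ℤ) :
    (sumAll F).eval s = ∑ p, (F p).eval s := by
  rw [sumAll, eval_sumEx, List.map_map]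
  exact Finset.sum_map_toList _ _

/-- An expression that is nonnegative, and zero if and only if all values of `F` are divisible
by `n`. -/
def dvdTest (n : ℤ) (F : Fin 3 → Fin 3 → Fin 6 → Ex) : Ex :=
  sumAll fun p : Fin 3 × Fin 3 × Fin 6 => .bin .mod (F p.1 p.2.1 p.2.2) (.const n)

theorem dvdTest_nonneg {n : ℤ} (hn : n ≠ 0) (F : Fin 3 → Fin 3 → Fin 6 → Ex) (s : ℕ → ℤ) :
    0 ≤ (dvdTest n F).eval s := by
  rw [dvdTest, eval_sumAll]
  exact Finset.sum_nonneg fun p _ => Int.emod_nonneg _ hn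

theorem dvdTest_eq_zero_iff {n : ℤ} (hn : n ≠ 0) {F : Fin 3 → Fin 3 → Fin 6 → Ex} {s : ℕ → ℤ} :
    (dvdTest n F).eval s = 0 ↔ ∀ i j m, n ∣ (F i j m).eval s := by
  rw [dvdTest, eval_sumAll, Finset.sum_eq_zero_iff_of_nonneg fun p _ =>
    (Int.emod_nonneg _ hn : 0 ≤ (F p.1 p.2.1 p.2.2).eval s % n)]
  constructor
  · exact fun h i j m => Int.dvd_of_emod_eq_zero (h (i, j, m) (Finset.mem_univ _))
  · exact fun h p _ => Int.emod_eq_zero_of_dvd (h _ _ _)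

/-- Expressions for the coordinates of the matrix in the registers. -/
def regs (i j : Fin 3) (m : Fin 6) : Ex := .reg (idx i j m)

theorem eval_regs (x : MatrixCode) (i j : Fin 3) (m : Fin 6) :
    (regs i j m).eval (st x) = x.coeff i j m := st_idx x i j m

/-- Right multiplication by a matrix over `ℤ[ζ₉]` is computed by expressions. -/
theorem exists_mulEx {B : Matrix (Fin 3) (Fin 3) ℂ} (hB : ∀ i j, B i j ∈ OE) :
    ∃ F : Fin 3 → Fin 3 → Fin 6 → Ex, ∀ x : MatrixCode,
      emat (fun i j m => (F i j m).eval (st x)) = emat x.coeff * B := by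
  choose c hc using fun (l j : Fin 3) (m : Fin 6) =>
    exists_ev (OE.mul_mem (OE.pow_mem ζ₉_mem_OE (m : ℕ)) (hB l j))
  refine ⟨fun i j n => sumAll fun p : Fin 3 × Fin 6 =>
    .bin .mul (regs i p.1 p.2) (.const (c p.1 j p.2 n)), fun x => ?_⟩
  ext i j
  have e : (fun n => (sumAll fun p : Fin 3 × Fin 6 =>
      .bin .mul (regs i p.1 p.2) (.const (c p.1 j p.2 n))).eval (st x)) =
      ∑ p : Fin 3 × Fin 6, x.coeff i p.1 p.2 • c p.1 j p.2 := by
    funext n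
    rw [eval_sumAll, Finset.sum_apply]
    refine Finset.sum_congr rfl fun p _ => ?_
    rw [Ex.eval, eval_regs]
    rfl
  rw [emat_apply, e, ev_sum, Matrix.mul_apply, Fintype.sum_prod_type]
  refine Finset.sum_congr rfl fun l _ => ?_
  rw [emat_apply, ev, Finset.sum_mul]
  refine Finset.sum_congr rfl fun m _ => ?_
  rw [ev_smul, hc, mul_assoc]

/-! ## Divisibility and valuation -/

/-- Since `3` is `π ^ 6` times a unit and the powers of `ζ₉` form an integral basis, the machine can
read off valuations by dividing coordinates. -/
theorem pow_dvd_iff_val {n : ℕ} {a : Fin 6 → ℤ} :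
    (∀ m, (3 : ℤ) ^ n ∣ a m) ↔ Val (6 * n) (ev a) := by
  induction n generalizing a with
  | zero => simpa using val_of_OE (ev_mem a)
  | succ n ih =>
    constructor
    · intro h
      choose b hb using h
      have e : a = (3 : ℤ) • ((3 : ℤ) ^ n • b) := by
        funext m
        rw [hb, pow_succ']
        simp [mul_assoc]
      rw [e, ev_smul]
      refine val_three.mul' (ih.mp fun m => ?_) (m := 6) (by push_cast; linarith)
      exact ⟨b m, rfl⟩
    · intro h
      have h6 : Val 6 (ev a) := h.mono (by push_cast; linarith)
      obtain ⟨b, hb⟩ := exists_ev (third_mul_mem_OE (ev_mem a) h6)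
      have e : a = (3 : ℤ) • b := ev_injective (by rw [ev_smul, hb]; push_cast; ring)
      have hv : Val (6 * n) (ev b) := by
        rw [hb]
        exact h.mul' val_third (by push_cast; linarith)
      intro m
      rw [e, pow_succ']
      exact mul_dvd_mul_left 3 (ih.mpr hv m)

theorem forall_pow_dvd_iff_mval (n : ℕ) {A : Fin 3 → Fin 3 → Fin 6 → ℤ} :
    (∀ i j m, (3 : ℤ) ^ n ∣ A i j m) ↔ MVal (6 * n) (emat A) :=
  forall₂_congr fun _ _ => pow_dvd_iff_val

theorem mval_pow_smul {n : ℕ} {k : ℤ} {M : Matrix (Fin 3) (Fin 3) ℂ} :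
    MVal (n + k) (piE ^ n • M) ↔ MVal k M :=
  forall₂_congr fun i j => by
    have := Val.shift (n : ℤ) (n := k) (x := M i j)
    rwa [zpow_natCast] at this

theorem val_three_pow_mul_iff {k : ℕ} {n : ℤ} {x : ℂ} :
    Val (6 * k + n) ((3 : ℂ) ^ k * x) ↔ Val n x := by
  induction k generalizing x with
  | zero => simp
  | succ k ih =>
    have h : ∀ {n : ℤ} {y : ℂ}, Val (6 + n) (3 * y) ↔ Val n y := by
      intro n y
      refine ⟨fun h => ?_, fun h => val_three.mul h⟩
      have := val_third.mul' h (k := n) (by linarith)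
      rwa [← mul_assoc, show (1 / 3 : ℂ) * 3 = 1 by norm_num, one_mul] at this
    have e : 6 * ((k + 1 : ℕ) : ℤ) + n = 6 + (6 * k + n) := by
      push_cast
      ring
    rw [pow_succ', mul_assoc, e, h, ih]

/-! ## One step of the algorithm -/

theorem mval_three_pow_smul_iff {k n : ℕ} {g : Γ} :
    MVal (6 * k - n) ((3 : ℂ) ^ k • mat g) ↔ dexp g ≤ n := by
  rw [dexp_le_iff, sub_eq_add_neg]
  exact forall₂_congr fun i j => val_three_pow_mul_iff

theorem exists_codes_of_dexp_le {g : Γ} {k : ℕ} (h : dexp g ≤ 6 * k) :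
    ∃ A, Codes ⟨k, A⟩ g := by
  refine exists_emat (M := (3 : ℂ) ^ k • mat g) fun i j => ?_
  have := mval_three_pow_smul_iff (k := k).mpr h i j
  rw [Nat.cast_mul, Nat.cast_ofNat, sub_self] at this
  refine OEinv3_mem_OE ?_ this
  exact OEinv3.mul_mem (OEinv3.pow_mem (by exact_mod_cast natCast_mem OEinv3 3) k) (g.2 i j)

theorem Codes.dexp_le {x : MatrixCode} {g : Γ} (h : Codes x g) : dexp g ≤ 6 * x.k := by
  rw [← mval_three_pow_smul_iff (k := x.k), ← h, Nat.cast_mul, Nat.cast_ofNat, sub_self]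
  exact fun i j => val_of_OE (ev_mem _)

theorem mat_incl_mem_OE (c : 𝒟) (i j : Fin 3) : mat (incl c) i j ∈ OE := by
  obtain ⟨s, a, rfl⟩ := exists_diagGate c
  rw [mat_diagGate, Matrix.diagonal_apply]
  split_ifs
  · exact OE.mul_mem (intCast_mem _ _) (ζ₉_zpow_mem _)
  · exact OE.zero_mem

theorem three_mul_Hmat_mem_OE (i j : Fin 3) : 3 * Hmat i j ∈ OE := by
  have hz := ζ₉_mem_OE
  have h : 3 * (1 / sqrtNegThree) = ζ₉ ^ 6 - ζ₉ ^ 3 := by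
    rw [one_div, sqrtNegThree_inv, sqrtNegThree_eq]
    ring
  rw [Hmat, Matrix.smul_apply, smul_eq_mul, ← mul_assoc, h]
  refine OE.mul_mem (OE.sub_mem (OE.pow_mem hz 6) (OE.pow_mem hz 3)) ?_
  fin_cases i <;> fin_cases j <;>
    first
      | exact OE.one_mem
      | exact OE.pow_mem hz 3
      | exact OE.pow_mem hz 6

theorem three_smul_mat_mem_OE (c : 𝒟) (i j : Fin 3) :
    ((3 : ℂ) • mat (incl c * HΓ)) i j ∈ OE := by
  rw [mat_mul, ← Matrix.mul_smul, Matrix.mul_apply]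
  exact OE.sum_mem fun l _ => OE.mul_mem (mat_incl_mem_OE c i l) (three_mul_Hmat_mem_OE l j)

theorem emat_three_smul {A B : Fin 3 → Fin 3 → Fin 6 → ℤ} (h : emat A = (3 : ℂ) • emat B)
    (i j : Fin 3) (m : Fin 6) : A i j m / 3 = B i j m := by
  have : A i j = (3 : ℤ) • B i j := ev_injective (by
    rw [ev_smul]
    have := congrFun (congrFun h i) j
    rw [Matrix.smul_apply, smul_eq_mul] at this
    exact_mod_cast this)
  rw [this, Pi.smul_apply, smul_eq_mul]
  exact Int.mul_ediv_cancel_left _ (by norm_num)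

theorem dvdTest_three_pow_eq_zero_iff (n : ℕ) {F : Fin 3 → Fin 3 → Fin 6 → Ex} {s : ℕ → ℤ} :
    (dvdTest (3 ^ n) F).eval s = 0 ↔ MVal (6 * n) (emat fun i j m => (F i j m).eval s) := by
  rw [dvdTest_eq_zero_iff (by positivity), forall_pow_dvd_iff_mval]

/-- Divisibility by powers of `3` sees valuations only in steps of six; the extra factor `π ^ n`
reaches the exponents in between. -/
theorem mval_piE_pow_smul_iff {k n a : ℕ} {g : Γ} (hk : 0 < k) {M : Matrix (Fin 3) (Fin 3) ℂ}
    (hM : M = piE ^ n • (3 : ℂ) ^ a • (3 : ℂ) ^ k • mat g) :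
    MVal (6 * (a + 1 : ℕ)) M ↔ dexp g ≤ 6 * (k - 1) + n := by
  have e : (6 * (a + 1 : ℕ) : ℤ) = n + (6 * (a + k : ℕ) - (6 * (k - 1) + n : ℕ)) := by
    push_cast [Nat.cast_sub hk]
    ring
  rw [hM, e, mval_pow_smul, smul_smul, ← pow_add, mval_three_pow_smul_iff]

/-- A test for `n` and `c` whether multiplication by `c H` lowers the denominator exponent. -/
theorem exists_descentTest (n : Fin 6) (c : 𝒟) : ∃ e : Ex, ∀ x g, Codes x g → 0 < x.k →
    (0 < e.eval (st x) ↔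
      dexp (g * incl c * HΓ) ≤ 6 * (x.k - 1) + n ∧ 6 * (x.k - 1) + n < dexp g) := by
  have hpi : ∀ {M : Matrix (Fin 3) (Fin 3) ℂ}, (∀ i j, M i j ∈ OE) →
      ∀ i j, (piE ^ (n : ℕ) • M) i j ∈ OE := fun h i j =>
    OE.mul_mem (OE.pow_mem piE_mem_OE _) (h i j)
  have h1 : ∀ i j, (1 : Matrix (Fin 3) (Fin 3) ℂ) i j ∈ OE := fun i j => by
    rw [Matrix.one_apply]
    split_ifs
    exacts [OE.one_mem, OE.zero_mem]
  obtain ⟨U, hU⟩ := exists_mulEx (hpi h1)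
  obtain ⟨V, hV⟩ := exists_mulEx (hpi (three_smul_mat_mem_OE c))
  -- With nonnegative tests `u` and `v`, the expression `u * (1 - v)` is positive exactly when `v =
  -- 0` and `u > 0`. The second test uses `3 ^ 2` because `V` carries a factor `3` clearing the
  -- denominator of `H`.
  refine ⟨.bin .mul (dvdTest (3 ^ 1) U)
    (.bin .add (.const 1) (.bin .mul (.const (-1)) (dvdTest (3 ^ 2) V))), fun x g hx hk => ?_⟩
  have u0 := dvdTest_nonneg (n := 3 ^ 1) (by norm_num) U (st x)
  have v0 := dvdTest_nonneg (n := 3 ^ 2) (by norm_num) V (st x)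
  have u1 : (dvdTest (3 ^ 1) U).eval (st x) = 0 ↔ dexp g ≤ 6 * (x.k - 1) + n := by
    rw [dvdTest_three_pow_eq_zero_iff, hU]
    refine mval_piE_pow_smul_iff (a := 0) hk ?_
    rw [hx, Matrix.mul_smul, Matrix.mul_one, pow_zero, one_smul]
  have v1 : (dvdTest (3 ^ 2) V).eval (st x) = 0 ↔
      dexp (g * incl c * HΓ) ≤ 6 * (x.k - 1) + n := by
    rw [dvdTest_three_pow_eq_zero_iff, hV]
    refine mval_piE_pow_smul_iff (a := 1) hk ?_
    rw [hx, Matrix.mul_smul, Matrix.mul_smul, smul_mul_assoc, ← mat_mul, pow_one, mul_assoc]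
  rw [← v1, ← not_le (b := 6 * (x.k - 1) + (n : ℕ)), ← u1]
  simp only [Ex.eval, BinOp.fn]
  constructor
  · intro h
    refine ⟨?_, fun hu => ?_⟩
    · by_contra hv
      have : 1 ≤ (dvdTest (3 ^ 2) V).eval (st x) := by omega
      nlinarith
    · rw [hu, zero_mul] at h
      exact lt_irrefl _ h
  · rintro ⟨hv, hu⟩
    rw [hv]
    omega

/-- The gate `H` as a letter. -/
def gateH : gates := ⟨H, Or.inl rfl⟩

/-- An element of `𝒟` as a letter. -/
def gateD (c : 𝒟) : gates := ⟨c, Or.inr c.2⟩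

instance : Finite 𝒟 := Nat.finite_of_card_ne_zero (by rw [card_𝒟]; norm_num)

/-- The body of the main loop: either `k` decreases, or a factor `c H` with `c ∈ R` is multiplied
on, which lowers the denominator exponent. -/
theorem exists_step {R : Set 𝒟} (hR : Subgroup.IsComplement R (stabD : Set 𝒟)) :
    ∃ p : Prog gates, LoopFree p ∧ ∀ x g, Codes x g → 0 < x.k →
      ∃ y w, Does p (st x) (st y) w ∧
        ((y.k < x.k ∧ Codes y g ∧ w = []) ∨
          ∃ c ∈ R, y.k = x.k ∧ Codes y (g * incl c * HΓ) ∧ dexp (g * incl c * HΓ) < dexp g ∧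
            w = [gateH, gateH, gateH, gateD c⁻¹]) := by
  choose test htest using exists_descentTest
  choose F hF using fun c => exists_mulEx (three_smul_mat_mem_OE c)
  let third : (Fin 3 → Fin 3 → Fin 6 → Ex) → Fin 3 → Fin 3 → Fin 6 → Ex :=
    fun F i j m => .bin .div (F i j m) (.const 3)
  let step : Fin 6 × 𝒟 → Ex × Prog gates := fun p =>
    (test p.1 p.2, .seq (assignCode (.reg 0) (third (F p.2)))
      (pushList [gateH, gateH, gateH, gateD p.2⁻¹]))
  let l : List (Fin 6 × 𝒟) := (Set.toFinite {p : Fin 6 × 𝒟 | p.2 ∈ R}).toFinset.toList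
  have hl : ∀ p, p ∈ l ↔ p.2 ∈ R := fun p => by simp [l]
  refine ⟨cond (dvdTest (3 ^ 1) regs) (chain (l.map step))
    (assignCode (.bin .add (.reg 0) (.const (-1))) (third regs)),
    loopFree_cond (loopFree_chain fun q hq => ?_) (loopFree_assign _), fun x g hx hk => ?_⟩
  · obtain ⟨p, -, rfl⟩ := List.mem_map.mp hq
    exact ⟨loopFree_assign _, loopFree_pushList _⟩
  have e0 := dvdTest_nonneg (n := 3 ^ 1) (by norm_num) regs (st x)
  have hregs : (emat fun i j m => (regs i j m).eval (st x)) = emat x.coeff := by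
    simp only [eval_regs]
  have e1 : (dvdTest (3 ^ 1) regs).eval (st x) = 0 ↔ dexp g ≤ 6 * (x.k - 1) := by
    rw [dvdTest_three_pow_eq_zero_iff, hregs]
    exact mval_piE_pow_smul_iff (n := 0) (a := 0) hk (by rw [hx]; simp)
  by_cases hd : dexp g ≤ 6 * (x.k - 1)
  · obtain ⟨A, hA⟩ := exists_codes_of_dexp_le hd
    refine ⟨⟨x.k - 1, A⟩, [], does_cond (fun h => absurd (e1.mpr hd) h.ne') fun _ =>
      does_assignCode ?_ fun i j m => ?_, Or.inl ⟨Nat.sub_lt hk one_pos, hA, rfl⟩⟩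
    · change st x 0 + -1 = ((x.k - 1 : ℕ) : ℤ)
      rw [st_zero]
      omega
    · refine emat_three_smul (A := fun i j m => (regs i j m).eval (st x)) ?_ i j m
      rw [hregs, hx, hA, smul_smul, ← pow_succ', Nat.sub_add_cancel hk]
  · have hpos : 0 < (dvdTest (3 ^ 1) regs).eval (st x) := by
      rw [← e1] at hd
      omega
    have hle := hx.dexp_le
    obtain ⟨c, hc, hlt⟩ := exists_descent hR (g := g) (by omega)
    have hex : ∃ q ∈ l.map step, 0 < q.1.eval (st x) := by
      -- As `3 ^ k g` is integral but not divisible by `3`, `dexp g` lies in `(6 (k - 1), 6 k]`; the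
      -- threshold `dexp g - 1` is thus within reach of `n < 6`.
      refine ⟨_, List.mem_map_of_mem (a := (⟨dexp g - 1 - 6 * (x.k - 1), by omega⟩, c))
        ((hl _).mpr hc), (htest _ _ x g hx hk).mpr ?_⟩
      dsimp only
      omega
    obtain ⟨q, hq, hqpos, hdoes⟩ := does_chain hex
    obtain ⟨⟨n, c⟩, hp, rfl⟩ := List.mem_map.mp hq
    have ht := (htest n c x g hx hk).mp hqpos
    have hn := n.2
    obtain ⟨A, hA⟩ := exists_codes_of_dexp_le (g := g * incl c * HΓ) (k := x.k) (by omega)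
    refine ⟨⟨x.k, A⟩, [gateH, gateH, gateH, gateD c⁻¹], does_cond (fun _ => hdoes _ _ ?_)
      (fun h => absurd hpos h), Or.inr ⟨c, (hl _).mp hp, rfl, hA, by omega, rfl⟩⟩
    refine Does.seq (w := []) (does_assignCode (e := .reg 0) (F := third (F c))
      (y := ⟨x.k, A⟩) (st_zero x) fun i j m => ?_) (does_pushList _ _)
    refine emat_three_smul (A := fun i j m => (F c i j m).eval (st x)) ?_ i j m
    rw [hF, hx, hA, smul_mul_assoc, Matrix.mul_smul, ← mat_mul, smul_comm, mul_assoc]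

/-! ## Words for the elements of `C` -/

theorem exists_word (g : Γ) : ∃ w : List gates, (w.map Subtype.val).prod = (g : U3) := by
  obtain ⟨g, hg⟩ := g
  change ∃ w : List gates, (w.map Subtype.val).prod = g
  rw [← closure_gates] at hg
  induction hg using Subgroup.closure_induction_left with
  | one => exact ⟨[], rfl⟩
  | mul_left x hx y _ ih =>
    obtain ⟨w, hw⟩ := ih
    exact ⟨⟨x, hx⟩ :: w, by rw [List.map_cons, List.prod_cons, hw]⟩
  | inv_mul_cancel x hx y _ ih =>
    obtain ⟨w, hw⟩ := ih
    rcases hx with rfl | hx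
    · refine ⟨gateH :: gateH :: gateH :: w, ?_⟩
      simp only [List.map_cons, List.prod_cons, hw, gateH, H_inv, mul_assoc]
    · exact ⟨⟨x⁻¹, Or.inr (inv_mem hx)⟩ :: w, by rw [List.map_cons, List.prod_cons, hw]⟩

theorem Codes.sum_normForm {x : MatrixCode} {g : Γ} (h : Codes x g) (i : Fin 3) :
    normForm (x.coeff i 0) + normForm (x.coeff i 1) + normForm (x.coeff i 2) = 9 ^ x.k := by
  have := sum_normForm_row (g := g) (N := 3 ^ x.k) (n := (9 ^ x.k : ℤ) • Pi.single 0 1)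
    (by
      rw [ev_int, star_pow, ← mul_pow]
      norm_num) (A := x.coeff i) (i := i) fun j => congrFun (congrFun h i) j
  rw [this]
  simp

theorem Codes.three_mul_sq_le {x : MatrixCode} {g : Γ} (h : Codes x g) (i j : Fin 3) (m : Fin 6) :
    3 * x.coeff i j m ^ 2 ≤ 4 * 9 ^ x.k := by
  have := h.sum_normForm i
  have h0 := normForm_nonneg (x.coeff i 0)
  have h1 := normForm_nonneg (x.coeff i 1)
  have h2 := normForm_nonneg (x.coeff i 2)
  have hj : normForm (x.coeff i j) ≤ 9 ^ x.k := by
    rw [← this]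
    fin_cases j <;> dsimp <;> omega
  have := three_mul_sq_le_normForm (x.coeff i j) m
  linarith

/-- An expression that is positive if and only if the registers hold the given coordinates. -/
def eqTest (A : Fin 3 → Fin 3 → Fin 6 → ℤ) : Ex :=
  let d : Fin 3 × Fin 3 × Fin 6 → Ex := fun p =>
    .bin .add (regs p.1 p.2.1 p.2.2) (.const (-A p.1 p.2.1 p.2.2))
  .bin .add (.const 1) (.bin .mul (.const (-1)) (sumAll fun p => .bin .mul (d p) (d p)))

theorem eqTest_pos_iff {A : Fin 3 → Fin 3 → Fin 6 → ℤ} {x : MatrixCode} :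
    0 < (eqTest A).eval (st x) ↔ x.coeff = A := by
  simp only [eqTest, Ex.eval, eval_sumAll, BinOp.fn, eval_regs]
  set S := ∑ p : Fin 3 × Fin 3 × Fin 6, (x.coeff p.1 p.2.1 p.2.2 + -A p.1 p.2.1 p.2.2) *
    (x.coeff p.1 p.2.1 p.2.2 + -A p.1 p.2.1 p.2.2) with hS
  have h0 : 0 ≤ S := Finset.sum_nonneg fun p _ => mul_self_nonneg _
  have h1 : S = 0 ↔ x.coeff = A := by
    rw [hS, Finset.sum_eq_zero_iff_of_nonneg fun p _ => mul_self_nonneg _]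
    constructor
    · intro h
      funext i j m
      have := mul_self_eq_zero.mp (h (i, j, m) (Finset.mem_univ _))
      dsimp only at this
      omega
    · rintro rfl p _
      simp
  rw [← h1]
  omega

/-- A program writing words for the elements of `C`. -/
theorem exists_finish : ∃ q : Prog gates, LoopFree q ∧ ∀ x g, Codes x g → x.k = 0 →
    ∃ s w, Does q (st x) s w ∧ (w.map Subtype.val).prod = (g : U3) := by
  have hword : ∀ A, ∃ w : List gates, ∀ g, emat A = mat g → (w.map Subtype.val).prod = (g : U3) := by
    intro A
    by_cases h : ∃ g, emat A = mat g
    · obtain ⟨g, hg⟩ := h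
      obtain ⟨w, hw⟩ := exists_word g
      refine ⟨w, fun g' hg' => ?_⟩
      rw [hw]
      exact Subtype.ext (hg.symm.trans hg')
    · exact ⟨[], fun g hg => absurd ⟨g, hg⟩ h⟩
  -- Words are fixed once for each coordinate array; only the finitely many arrays with entries in
  -- `[-1, 1]` enter the program, as `3 a² ≤ 4` when `k = 0`.
  choose word hword using hword
  have hfin : {A : Fin 3 → Fin 3 → Fin 6 → ℤ | ∀ i j m, A i j m ∈ Set.Icc (-1) 1}.Finite :=
    Set.Finite.pi' fun _ => Set.Finite.pi' fun _ => Set.Finite.pi' fun _ => Set.finite_Icc _ _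
  refine ⟨chain (hfin.toFinset.toList.map fun A => (eqTest A, pushList (word A))),
    loopFree_chain fun q hq => ?_, fun x g hx hk => ?_⟩
  · obtain ⟨A, -, rfl⟩ := List.mem_map.mp hq
    exact loopFree_pushList _
  have hmem : x.coeff ∈ hfin.toFinset.toList := by
    rw [Finset.mem_toList, Set.Finite.mem_toFinset]
    intro i j m
    have := hx.three_mul_sq_le i j m
    rw [hk] at this
    constructor <;> nlinarith
  obtain ⟨q, hq, hpos, hdoes⟩ := does_chain (s := st x)
    ⟨_, List.mem_map_of_mem (f := fun A => (eqTest A, (pushList (word A) : Prog gates))) hmem,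
      eqTest_pos_iff.mpr rfl⟩
  obtain ⟨A, -, rfl⟩ := List.mem_map.mp hq
  refine ⟨_, _, hdoes _ _ (does_pushList _ _), hword A g ?_⟩
  rw [← eqTest_pos_iff.mp hpos, hx, hk, pow_zero, one_smul]

/-! ## Bounds -/

/-- Rows of `3 ^ k g` have norm `9 ^ k`, so the coordinates are bounded through `k` alone, however
many gates have been multiplied on. -/
theorem Codes.bits_st_le {x : MatrixCode} {g : Γ} (h : Codes x g) {k : ℕ} (hk : x.k ≤ k) (r : ℕ) :
    bits (st x r) ≤ 2 * k + 3 := by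
  rw [bits_le_iff]
  by_cases hr : 55 ≤ r
  · rw [st_of_le x hr]
    positivity
  refine forall_st (P := fun n => n.natAbs < 2 ^ (2 * k + 2)) ?_ (fun i j m => ?_) r (not_le.mp hr)
  · rw [Int.natAbs_natCast]
    exact (Nat.lt_two_pow_self).trans (Nat.pow_lt_pow_right (by norm_num) (by omega))
  · have h1 := h.three_mul_sq_le i j m
    have h2 : (9 : ℤ) ^ x.k ≤ 16 ^ k :=
      (pow_le_pow_right₀ (by norm_num) hk).trans (pow_le_pow_left₀ (by norm_num) (by norm_num) k)
    have h3 : ((2 : ℤ) ^ (2 * k + 2)) ^ 2 = 16 * 16 ^ k := by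
      rw [← pow_mul, show (2 * k + 2) * 2 = 4 * (k + 1) by ring, pow_mul, pow_succ']
      norm_num
    have h4 : (0 : ℤ) < 16 ^ k := by positivity
    have := abs_lt_of_sq_lt_sq (a := x.coeff i j m) (b := 2 ^ (2 * k + 2)) (by linarith)
      (by positivity)
    rw [Int.abs_eq_natAbs] at this
    exact_mod_cast this

theorem normForm_le {a : Fin 6 → ℤ} {N : ℤ} (h : ∀ m, |a m| ≤ N) : normForm a ≤ 9 * N ^ 2 := by
  have slot : ∀ x y : ℤ, |x| ≤ N → |y| ≤ N → x * x - x * y + y * y ≤ 3 * N ^ 2 := by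
    intro x y hx hy
    have h1 := abs_le.mp hx
    have h2 := abs_le.mp hy
    nlinarith [mul_nonneg (by linarith : 0 ≤ N - x) (by linarith : 0 ≤ N + x),
      mul_nonneg (by linarith : 0 ≤ N - y) (by linarith : 0 ≤ N + y), sq_nonneg (x + y)]
  have h0 := slot _ _ (h 0) (h 3)
  have h1 := slot _ _ (h 1) (h 4)
  have h2 := slot _ _ (h 2) (h 5)
  rw [normForm]
  linarith

theorem bits_coeff_le_size (x : MatrixCode) (i j : Fin 3) (m : Fin 6) :
    bits (x.coeff i j m) ≤ x.size := by
  refine List.le_sum_of_mem (List.mem_map_of_mem ?_)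
  refine List.mem_cons_of_mem _ (List.mem_flatMap.mpr ⟨i, List.mem_finRange i,
    List.mem_flatMap.mpr ⟨j, List.mem_finRange j, ?_⟩⟩)
  exact List.mem_ofFn.mpr ⟨m, rfl⟩

/-- The exponent of the denominator is bounded by the bit length. -/
theorem Codes.k_le_size {x : MatrixCode} {g : Γ} (h : Codes x g) : x.k ≤ x.size + 2 := by
  have hb : ∀ i j m, |x.coeff i j m| ≤ 3 ^ x.size := by
    intro i j m
    have h1 : (x.coeff i j m).natAbs < 2 ^ x.size :=
      bits_le_iff.mp ((bits_coeff_le_size x i j m).trans (Nat.le_succ _))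
    have h2 : 2 ^ x.size ≤ 3 ^ x.size := Nat.pow_le_pow_left (by norm_num) _
    rw [Int.abs_eq_natAbs]
    exact_mod_cast h1.le.trans h2
  have hs := h.sum_normForm 0
  have hn := fun j => normForm_le (hb 0 j)
  -- Three entries contribute at most `9 * 9 ^ size` each, and `27 < 81`.
  have h9 : (9 : ℤ) ^ x.k < 9 ^ (x.size + 2) := by
    have e : ((3 : ℤ) ^ x.size) ^ 2 = 9 ^ x.size := by
      rw [← pow_mul, mul_comm, pow_mul]
      norm_num
    rw [e] at hn
    have : (0 : ℤ) < 9 ^ x.size := by positivity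
    rw [pow_add, ← hs]
    linarith [hn 0, hn 1, hn 2]
  exact ((pow_lt_pow_iff_right₀ (by norm_num)).mp h9).le

/-! ## The algorithm -/

theorem descend_append (g : Γ) (cs : List 𝒟) (c : 𝒟) :
    descend g (cs ++ [c]) = descend g cs * incl c * HΓ := by
  rw [descend, List.foldl_append]
  rfl

/-- The word `H⁻¹ c_r⁻¹ ⋯ H⁻¹ c₁⁻¹` in gates. -/
def tailGates (cs : List 𝒟) : List gates :=
  cs.foldl (fun w c => [gateH, gateH, gateH, gateD c⁻¹] ++ w) []

theorem tailGates_append (cs : List 𝒟) (c : 𝒟) :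
    tailGates (cs ++ [c]) = [gateH, gateH, gateH, gateD c⁻¹] ++ tailGates cs := by
  rw [tailGates, List.foldl_append]
  rfl

theorem descentTail_append (cs : List 𝒟) (c : 𝒟) :
    descentTail (cs ++ [c]) = H :: H :: H :: (c : U3)⁻¹ :: descentTail cs := by
  -- The list of diagonal gates is coerced entrywise to `U3` through a bind in the list monad, hence
  -- `flatMap`.
  rw [descentTail, List.bind_eq_flatMap, List.flatMap_append, List.foldl_append]
  rfl

theorem map_tailGates (cs : List 𝒟) : (tailGates cs).map Subtype.val = descentTail cs := by
  induction cs using List.reverseRecOn with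
  | nil => rfl
  | append_singleton cs c ih =>
    rw [tailGates_append, List.map_append, ih, descentTail_append]
    rfl

/-- The tail telescopes against the descent because `H ^ 4 = 1`. -/
theorem descend_mul_prod (g : Γ) (cs : List 𝒟) :
    (descend g cs : U3) * (descentTail cs).prod = g := by
  induction cs using List.reverseRecOn with
  | nil => exact mul_one _
  | append_singleton cs c ih =>
    have e' : ((descend g cs * incl c * HΓ : Γ) : U3) = (descend g cs : U3) * c * H := rfl
    rw [descend_append, descentTail_append, e', List.prod_cons, List.prod_cons, List.prod_cons, List.prod_cons]
    calc (descend g cs : U3) * c * H * (H * (H * (H * ((c : U3)⁻¹ * (descentTail cs).prod))))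
        = (descend g cs : U3) * c * (H * H * (H * H)) * (c : U3)⁻¹ * (descentTail cs).prod := by
          group
      _ = g := by rw [H_pow_four, mul_one, mul_inv_cancel_right, ih]

theorem dist_append {g : Γ} {cs : List 𝒟} {c : 𝒟}
    (h : ∀ j < cs.length, distV0 (descend g (cs.take (j + 1))) + 2 ≤ distV0 (descend g (cs.take j)))
    (hc : dexp (descend g cs * incl c * HΓ) < dexp (descend g cs)) :
    ∀ j < (cs ++ [c]).length, distV0 (descend g ((cs ++ [c]).take (j + 1))) + 2 ≤
      distV0 (descend g ((cs ++ [c]).take j)) := by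
  intro j hj
  rw [List.length_append, List.length_singleton] at hj
  rcases Nat.lt_succ_iff_lt_or_eq.mp hj with h' | rfl
  · rw [List.take_append_of_le_length h', List.take_append_of_le_length h'.le]
    exact h j h'
  · rw [List.take_append_of_le_length le_rfl, List.take_length,
      List.take_of_length_le (by simp), descend_append, distV0_eq, distV0_eq]
    omega

/-- The word problem in `Γ` is solved in polynomial time by descent. -/
theorem exists_algorithm {R : Set 𝒟} (hR : Subgroup.IsComplement R (stabD : Set 𝒟)) :
    ∃ (P : Prog gates) (p : Polynomial ℕ), ∀ (g : Γ) (x : MatrixCode), Codes x g →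
      ∃ (w : List gates) (t : ℕ), Computes P x.toList w t ∧ t ≤ p.eval x.size ∧
        (w.map Subtype.val).prod = (g : U3) ∧
        ∃ (cs : List 𝒟) (u : List U3), (∀ c ∈ cs, c ∈ R) ∧ IsDescent g cs ∧
          w.map Subtype.val = u ++ descentTail cs := by
  obtain ⟨p, hp, hstep⟩ := exists_step hR
  obtain ⟨q, hq, hfin⟩ := exists_finish
  obtain ⟨a, ha⟩ := exec_run (loopFree_tidy hp)
  obtain ⟨b, hb⟩ := exec_run hq
  let B : Polynomial ℕ := 2 * Polynomial.X + 7
  refine ⟨.seq (.loop 0 (tidy p)) q,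
    (7 * Polynomial.X + 15) * (Polynomial.C a * B ^ 2 + B + 1) + Polynomial.C b * B ^ 2,
    fun g x hx => ?_⟩
  set n := x.size with hn
  have hk : x.k ≤ n + 2 := hx.k_le_size
  -- Loop invariant: the registers encode the current element of the descent and the output is its
  -- tail word. The measure `m = k + dexp` drops in every round, by way of `k` or of `dexp`.
  let Good : Config gates → ℕ → Prop := fun σ m => ∃ (y : MatrixCode) (cs : List 𝒟),
    σ = ⟨st y, tailGates cs⟩ ∧ m = y.k + dexp (descend g cs) ∧ Codes y (descend g cs) ∧
      y.k ≤ n + 2 ∧ (∀ c ∈ cs, c ∈ R) ∧ ∀ j < cs.length,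
        distV0 (descend g (cs.take (j + 1))) + 2 ≤ distV0 (descend g (cs.take j))
  have hbits : ∀ σ m, Good σ m → ∀ r, bits (σ.reg r) ≤ 2 * n + 7 := by
    rintro _ m ⟨y, cs, rfl, -, hy, hyk, -⟩ r
    exact (hy.bits_st_le hyk r).trans (by omega)
  have hred : ∀ σ m, Good σ m → 0 < σ.reg 0 → ∃ m' < m, Good (run (tidy p) σ) m' := by
    rintro _ m ⟨y, cs, rfl, rfl, hy, hyk, hR', hd⟩ h0
    obtain ⟨z, w, hdoes, h⟩ := hstep y _ hy (Int.natCast_pos.mp h0)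
    have hrun := run_tidy hdoes (fun _ => st_of_le y) (fun _ => st_of_le z) (tailGates cs)
    rcases h with ⟨hlt, hz, rfl⟩ | ⟨c, hc, hzk, hz, hlt, rfl⟩
    · exact ⟨_, by omega, z, cs, hrun, rfl, hz, by omega, hR', hd⟩
    · refine ⟨z.k + dexp (descend g cs * incl c * HΓ), by omega, z, cs ++ [c], ?_, ?_, ?_,
        by omega, ?_, dist_append hd hlt⟩
      · rw [hrun, tailGates_append]
      · rw [descend_append]
      · rwa [descend_append]
      · intro d hd'
        rcases List.mem_append.mp hd' with h | h
        · exact hR' d h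
        · rwa [List.mem_singleton.mp h]
  obtain ⟨τ, t, m, hgood, hpos, hexec, ht⟩ := exec_loop (B := 2 * n + 7) (by omega) ha Good hbits
    hred (x.k + dexp g) ⟨st x, []⟩ ⟨x, [], rfl, rfl, hx, hk, by simp, by simp⟩
  obtain ⟨-, u, hu, hexec'⟩ := hb τ (2 * n + 7) (by omega) (hbits τ m hgood)
  obtain ⟨y, cs, rfl, -, hy, -, hR', hd⟩ := hgood
  have hy0 : y.k = 0 := by
    by_contra h
    exact hpos (Int.natCast_pos.mpr (Nat.pos_of_ne_zero h))
  obtain ⟨s, w, hdoes, hw⟩ := hfin y _ hy hy0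
  have hout := (hdoes ⟨st y, tailGates cs⟩ fun _ _ => rfl).2
  refine ⟨w ++ tailGates cs, t + u, ⟨_, .seq hexec hexec', hout⟩, ?_, ?_, cs,
    w.map Subtype.val, hR', ⟨hd, ?_⟩, ?_⟩
  -- From `dexp g ≤ 6 k` and `k ≤ n + 2` the measure is at most `7 n + 14`; the final loop test adds
  -- one.
  · have hm : x.k + dexp g + 1 ≤ 7 * n + 15 := by
      have := hx.dexp_le
      omega
    simp only [B, Polynomial.eval_add, Polynomial.eval_mul, Polynomial.eval_pow,
      Polynomial.eval_C, Polynomial.eval_X, Polynomial.eval_one, Polynomial.eval_ofNat]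
    exact add_le_add (ht.trans (Nat.mul_le_mul_right _ hm)) hu
  · rw [List.map_append, List.prod_append, hw, map_tailGates, descend_mul_prod]
  · have := hy.dexp_le
    rw [mem_C_iff]
    omega
  · rw [List.map_append, map_tailGates]

end CliffordD

end

theorem mainTheorem1 :
    Subgroup.closure CliffordD.gates = CliffordD.Γ ∧
    (∀ g : CliffordD.Γ, ∃ x : CliffordD.MatrixCode,
      x.toMatrix = ((g : CliffordD.U3) : Matrix (Fin 3) (Fin 3) ℂ)) ∧
    ∀ R : Set CliffordD.𝒟, Subgroup.IsComplement R (CliffordD.stabD : Set CliffordD.𝒟) →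
      R.ncard = 108 ∧
      ∃ (P : CliffordD.Prog CliffordD.gates) (p : Polynomial ℕ),
        ∀ (g : CliffordD.Γ) (x : CliffordD.MatrixCode),
          x.toMatrix = ((g : CliffordD.U3) : Matrix (Fin 3) (Fin 3) ℂ) →
          ∃ (w : List CliffordD.gates) (t : ℕ),
            CliffordD.Computes P x.toList w t ∧
            t ≤ p.eval x.size ∧
            (w.map Subtype.val).prod = (g : CliffordD.U3) ∧
            ∃ (cs : List CliffordD.𝒟) (u : List CliffordD.U3),
              (∀ c ∈ cs, c ∈ R) ∧
              CliffordD.IsDescent g cs ∧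
              w.map Subtype.val = u ++ CliffordD.descentTail cs := by
  refine ⟨CliffordD.closure_gates, fun g => ?_, fun R hR => ⟨?_, ?_⟩⟩
  · obtain ⟨x, hx⟩ := CliffordD.exists_codes g
    exact ⟨x, CliffordD.codes_iff.mp hx⟩
  · rw [hR.ncard_left, CliffordD.index_stabD]
  · obtain ⟨P, p, h⟩ := CliffordD.exists_algorithm hR
    exact ⟨P, p, fun g x hx => h g x (CliffordD.codes_iff.mpr hx)⟩
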